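/- **Setting.** Fix $p\ge 1$ and a compact set $K\subset\mathbb R$. For every number $n$ of nodes let $Z_{ij}=Z_{ij}^{(n)}\in K^p$ ($1\le i\ne j\le n$) be given covariates, and let $\boldsymbol\theta^*=(\alpha_1^*,\dots,\alpha_n^*,\beta_1^*,\dots,\beta_{n-1}^*)^\top$ (with $\beta_n^*=0$) and $\boldsymbol\gamma^*\in\mathbb R^p$ be the true parameters, which may depend on $n$. For $\boldsymbol\theta=(\alpha_1,\dots,\alpha_n,\beta_1,\dots,\beta_{n-1})^\top$, $\beta_n:=0$, put $\lambda_{ij}(\boldsymbol\theta,\boldsymbol\gamma)=e^{\alpha_i+\beta_j+Z_{ij}^\top\boldsymbol\gamma}$. The edge weights $a_{ij}$, $i\neq j$, are independent Poisson variables with means $\lambda_{ij}(\boldsymbol\theta^*,\boldsymbol\gamma^*)$. Let $$F_i=\sum_{j\ne i}(\lambda_{ij}-a_{ij})\ (1\le i\le n),\qquad F_{n+j}=\sum_{i\ne j}(\lambda_{ij}-a_{ij})\ (1\le j\le n-1),\qquad Q=\sum_{i\ne j}Z_{ij}(\lambda_{ij}-a_{ij}),$$ regarded as functions of $(\boldsymbol\theta,\boldsymbol\gamma)$.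 The MLE $(\widehat{\boldsymbol\theta},\widehat{\boldsymbol\gamma})$ is the solution of $F=0$, $Q=0$ whenever a solution exists (and is defined arbitrarily, with $\widehat{\boldsymbol\theta}$ measurable, otherwise). Let $$H(\boldsymbol\theta,\boldsymbol\gamma)=\frac{\partial Q}{\partial\boldsymbol\gamma^\top}-\frac{\partial Q}{\partial\boldsymbol\theta^\top}\Big[\frac{\partial F}{\partial\boldsymbol\theta^\top}\Big]^{-1}\frac{\partial F}{\partial\boldsymbol\gamma^\top}.$$ Let $\epsilon_{n1},\epsilon_{n2}>0$, and put $$\rho_n=\max_{i\ne j}|\alpha_i^*+\beta_j^*|+2\epsilon_{n1}+pq_n\|\boldsymbol\gamma^*\|_\infty+pq_n\epsilon_{n2},\qquad q_n=\max_{i\neq j}\|Z_{ij}\|_\infty .$$ Assume that, for all large $n$ and all $\boldsymbol\theta$ with $\|\boldsymbol\theta-\boldsymbol\theta^*\|_\infty\le\epsilon_{n1}$, the matrix $H(\boldsymbol\theta,\boldsymbol\gamma^*)$ is positive definite and $\|H^{-1}(\boldsymbol\theta,\boldsymbol\gamma^*)\|_\infty\le\kappa_n/n^2$, where $\|\cdot\|_\infty$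 of a matrix is the maximal absolute row sum. Let $u_{ij}=\lambda_{ij}(\boldsymbol\theta^*,\boldsymbol\gamma^*)$ for $i\ne j$, $u_{ii}=0$, $u_{i\cdot}=\sum_j u_{ij}$, $u_{\cdot j}=\sum_i u_{ij}$, and let $S=(s_{ij})$ be the $(2n-1)\times(2n-1)$ matrix (an approximate inverse of the Fisher information matrix of $\boldsymbol\theta$) with $$s_{ij}=\begin{cases}\dfrac{\delta_{ij}}{u_{i\cdot}}+\dfrac1{u_{\cdot n}},& i,j\le n,\\[2mm] \dfrac{\delta_{ij}}{u_{\cdot(j-n)}}+\dfrac1{u_{\cdot n}},& i,j\ge n+1,\\[2mm] -\dfrac1{u_{\cdot n}},&\text{otherwise.}\end{cases}$$ **Theorem 2.** If $\kappa_n e^{23\rho_n}=o(n^{1/2}/\log n)$, then as $n\to\infty$ the MLE exists with probability tending to $1$, and for every fixed $k\ge1$ the vector of the first $k$ entries of $\widehat{\boldsymbol\theta}-\boldsymbol\theta^*$ is asymptotically multivariate normal with mean $\mathbf 0$ and covariance matrix the upper left $k\times k$ block $S_k$ of $S$. That is, $S_k$ is positive definite for all large $n$, and for all $k\times k$ matrices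 $A_n$ with $A_nS_kA_n^\top=I_k$ for all large $n$ (for example $A_n=S_k^{-1/2}$), the vector $A_n\big(\widehat\theta_1-\theta_1^*,\dots,\widehat\theta_k-\theta_k^*\big)^\top$ converges in distribution to $N(\mathbf 0,I_k)$. -/

import Mathlib

open MeasureTheory ProbabilityTheory Filter Topology Asymptotics
open scoped Matrix

namespace NetworkPoisson

noncomputable section

/-! The parameter vector is `θ = (α₁, …, αₙ, β₁, …, βₙ₋₁)`, with the identification `βₙ = 0`
(and `μ = 0`). Nodes are indexed from `0`, so the last node is `n - 1`. -/

/-- The out-degree parameter `αᵢ`, read off from `θ`. -/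
def sendPar {n : ℕ} (θ : Fin (2 * n - 1) → ℝ) (i : Fin n) : ℝ :=
  θ ⟨i, by omega⟩

/-- The in-degree parameter `βⱼ`, read off from `θ`; it is `0` for the last node. -/
def recvPar {n : ℕ} (θ : Fin (2 * n - 1) → ℝ) (j : Fin n) : ℝ :=
  if h : (j : ℕ) + 1 < n then θ ⟨n + j, by omega⟩ else 0

/-- The Poisson rate `λᵢⱼ(θ, γ) = exp (αᵢ + βⱼ + Zᵢⱼᵀ γ)` of the weight of the edge `(i, j)`. -/
def rate {n p : ℕ} (Z : Fin n → Fin n → Fin p → ℝ) (θ : Fin (2 * n - 1) → ℝ) (γ : Fin p → ℝ)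
    (i j : Fin n) : ℝ :=
  Real.exp (sendPar θ i + recvPar θ j + Z i j ⬝ᵥ γ)

/-- The sum of the entries of row `i`, without the diagonal entry. -/
def rowSum {n : ℕ} (x : Fin n → Fin n → ℝ) (i : Fin n) : ℝ :=
  ∑ j ∈ Finset.univ.erase i, x i j

/-- The sum of the entries of column `j`, without the diagonal entry. -/
def colSum {n : ℕ} (x : Fin n → Fin n → ℝ) (j : Fin n) : ℝ :=
  ∑ i ∈ Finset.univ.erase j, x i j

/-- The vector of all row sums, followed by all column sums except the last one. For a weighted
adjacency matrix this is the bi-degree vector `(d₁, …, dₙ, b₁, …, bₙ₋₁)`. -/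
def biSum {n : ℕ} (x : Fin n → Fin n → ℝ) (l : Fin (2 * n - 1)) : ℝ :=
  if h : (l : ℕ) < n then rowSum x ⟨l, h⟩ else colSum x ⟨l - n, by omega⟩

/-- The system `F(θ, γ)`: expected bi-degrees minus observed bi-degrees. -/
def scoreF {n p : ℕ} (Z : Fin n → Fin n → Fin p → ℝ) (a : Fin n → Fin n → ℕ)
    (θ : Fin (2 * n - 1) → ℝ) (γ : Fin p → ℝ) : Fin (2 * n - 1) → ℝ :=
  fun l => biSum (rate Z θ γ) l - biSum (fun i j => (a i j : ℝ)) l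

/-- The function `Q(θ, γ) = ∑_{i ≠ j} Zᵢⱼ (λᵢⱼ(θ, γ) - aᵢⱼ)`. -/
def scoreQ {n p : ℕ} (Z : Fin n → Fin n → Fin p → ℝ) (a : Fin n → Fin n → ℕ)
    (θ : Fin (2 * n - 1) → ℝ) (γ : Fin p → ℝ) : Fin p → ℝ :=
  fun c => ∑ i, ∑ j ∈ Finset.univ.erase i, Z i j c * (rate Z θ γ i j - (a i j : ℝ))

/-- `(θ, γ)` is a maximum likelihood estimate for the data `a`: it solves the score equations. -/
def IsMLE {n p : ℕ} (Z : Fin n → Fin n → Fin p → ℝ) (a : Fin n → Fin n → ℕ)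
    (θ : Fin (2 * n - 1) → ℝ) (γ : Fin p → ℝ) : Prop :=
  scoreF Z a θ γ = 0 ∧ scoreQ Z a θ γ = 0

/-- The Jacobian matrix `∂f/∂xᵀ` of `f` at `x`. -/
def jacobian {d e : ℕ} (f : (Fin d → ℝ) → Fin e → ℝ) (x : Fin d → ℝ) :
    Matrix (Fin e) (Fin d) ℝ :=
  Matrix.of fun l m => fderiv ℝ f x (Pi.single m 1) l

/-- The profile information
`H(θ, γ) = ∂Q/∂γᵀ - (∂Q/∂θᵀ) (∂F/∂θᵀ)⁻¹ (∂F/∂γᵀ)`.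
The data enter `F` and `Q` only through additive constants, hence do not affect the derivatives;
they are set to `0`. -/
def profileInfo {n p : ℕ} (Z : Fin n → Fin n → Fin p → ℝ) (θ : Fin (2 * n - 1) → ℝ)
    (γ : Fin p → ℝ) : Matrix (Fin p) (Fin p) ℝ :=
  jacobian (fun γ' => scoreQ Z 0 θ γ') γ
    - jacobian (fun θ' => scoreQ Z 0 θ' γ) θ * (jacobian (fun θ' => scoreF Z 0 θ' γ) θ)⁻¹
      * jacobian (fun γ' => scoreF Z 0 θ γ') γ

/-- The matrix norm induced by the `ℓ_∞`-norm: the maximal absolute row sum. -/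
def infNorm {p : ℕ} (M : Matrix (Fin p) (Fin p) ℝ) : ℝ :=
  ⨆ i, ∑ j, |M i j|

/-- The ordered pairs `(i, j)` of distinct nodes. -/
abbrev OffDiag (n : ℕ) : Type := {e : Fin n × Fin n // e.1 ≠ e.2}

/-- The number `max_{i ≠ j} |αᵢ + βⱼ| + 2 ε₁ + p q ‖γ‖_∞ + p q ε₂`,
with `q = max_{i ≠ j} ‖Zᵢⱼ‖_∞`. -/
def rho {n p : ℕ} (Z : Fin n → Fin n → Fin p → ℝ) (θ : Fin (2 * n - 1) → ℝ) (γ : Fin p → ℝ)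
    (ε₁ ε₂ : ℝ) : ℝ :=
  (⨆ e : OffDiag n, |sendPar θ e.1.1 + recvPar θ e.1.2|) + 2 * ε₁
    + p * (⨆ e : OffDiag n, ‖Z e.1.1 e.1.2‖) * ‖γ‖
    + p * (⨆ e : OffDiag n, ‖Z e.1.1 e.1.2‖) * ε₂

/-- The approximate inverse `S` of the Fisher information matrix of `θ`. With `u i j` the variance
of the weight of `(i, j)`, the entries are `δᵢⱼ / u_{i·} + 1 / u_{·n}` in the upper left
`n × n` block, `δᵢⱼ / u_{·(j-n)} + 1 / u_{·n}` in the lower right block and `-1 / u_{·n}`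
elsewhere. -/
def approxInv {n : ℕ} (u : Fin n → Fin n → ℝ) :
    Matrix (Fin (2 * n - 1)) (Fin (2 * n - 1)) ℝ :=
  Matrix.of fun i j =>
    (if i = j then 1 / biSum u i else 0)
      + (if ((i : ℕ) < n ↔ (j : ℕ) < n) then 1 else -1) / colSum u ⟨n - 1, by have := i.isLt; omega⟩

/-- The first `k` coordinates of a vector (padded by `0` if there are fewer than `k`). -/
def firstCoords {d : ℕ} (k : ℕ) (x : Fin d → ℝ) : Fin k → ℝ :=
  fun i => if h : (i : ℕ) < d then x ⟨i, h⟩ else 0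

/-- The upper left `k × k` block of a matrix (padded by `0` if the matrix is smaller). -/
def upperLeft {d : ℕ} (k : ℕ) (M : Matrix (Fin d) (Fin d) ℝ) : Matrix (Fin k) (Fin k) ℝ :=
  Matrix.of fun i j => if h : (i : ℕ) < d ∧ (j : ℕ) < d then M ⟨i, h.1⟩ ⟨j, h.2⟩ else 0

/-- The random vectors `X n` are asymptotically multivariate normal with mean `0` and covariance
matrices `C n`: the `C n` are eventually positive definite, and `A n * X n` converges in
distribution to the standard normal law on `ℝᵏ` for every choice of matrices `A n` that
standardize `C n`, such as `A n = (C n)^{-1/2}`. -/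
def AsymptoticallyNormal {k : ℕ} {Ω : ℕ → Type*} [∀ n, MeasurableSpace (Ω n)]
    (μ : ∀ n, Measure (Ω n)) [∀ n, IsProbabilityMeasure (μ n)]
    (X : ∀ n, Ω n → Fin k → ℝ) (C : ℕ → Matrix (Fin k) (Fin k) ℝ) : Prop :=
  (∀ᶠ n in atTop, (C n).PosDef) ∧
  ∀ A : ℕ → Matrix (Fin k) (Fin k) ℝ, (∀ᶠ n in atTop, A n * C n * (A n)ᵀ = 1) →
    TendstoInDistribution (fun n ω => WithLp.toLp 2 (A n *ᵥ X n ω)) atTop id μ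
      (stdGaussian (EuclideanSpace ℝ (Fin k)))

/-- The random array `a` follows the network Poisson model: the weights of the edges `(i, j)`,
`i ≠ j`, are independent Poisson variables with rates `λᵢⱼ(θ, γ)`. (There are no self-loops; the
diagonal of `a` is never used.) -/
structure IsNetworkPoisson {n p : ℕ} {Ω : Type*} [MeasurableSpace Ω] (μ : Measure Ω)
    (Z : Fin n → Fin n → Fin p → ℝ) (θ : Fin (2 * n - 1) → ℝ) (γ : Fin p → ℝ)
    (a : Ω → Fin n → Fin n → ℕ) : Prop where
  indep : iIndepFun (fun (e : OffDiag n) ω => a ω e.1.1 e.1.2) μ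
  law : ∀ i j : Fin n, i ≠ j →
    HasLaw (fun ω => a ω i j) (poissonMeasure (Real.toNNReal (rate Z θ γ i j))) μ

end

end NetworkPoisson

open NetworkPoisson

/-!
Write `uᵢⱼ` for the true rates, `xᵢⱼ = aᵢⱼ - uᵢⱼ` for the noise, `E = exp ρₙ`, so that
`E⁻¹ ≤ uᵢⱼ ≤ E`, and `κ` for the bound on `n² ‖H⁻¹‖`. Only the profile information at the true
parameter is needed: all estimates take place in a neighbourhood so small that the rates change by
a bounded factor.

*Linear theory.* Linearizing the score equations at the truth gives a weighted regression of `x / u`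
on row effects, column effects and covariates. For row and column effects alone, sup-norm stability
(`abs_add_le_of_weighted_means`) comes from a contraction argument: averaging over two different rows
uses weights that overlap in mass at least `1 / (2 E²)`, so the oscillation of the row effects is at
most a factor `1 - 1 / (2 E²)` of that of the column effects plus the data, and conversely. With
covariates, the slope is `H⁻¹` applied to the noise paired with residual covariates (`residGram`,
`profileInfo_eq_residGram`), which is controlled by `κ`. A lower bound `κ ≥ c E⁻³` (`IsRegular.one_le_mul_eta`) allows every
error term to be expressed through `W = κ E²³ log n / √n`, which tends to `0`.

*Existence.* The score equations are a fixed point equation `y = linSolve (x - s y)` with `s` of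
second order, and `IsRegular.exists_isMLE` solves it by Banach's theorem as soon as `linSolve x` is
small. Row sums, column sums and finitely many other linear functionals of the noise are, by
Chernoff bounds, at most `3 E √(log n)` times the Euclidean norm of their weights with high
probability (`IsRegular.exists_event`). On this event the quadratic remainder is of order `κ E¹⁵ log n / n`.
The score equations have at most one solution by monotonicity of the exponential
(`IsRegular.isMLE_unique`), so the estimator is the solution found.

*Normality.* The leading term of `α̂ᵢ - αᵢ` is `xᵢ. / uᵢ. + x.ₙ / u.ₙ`
(`IsBalanced.sendPar_fit`), whose covariances are the entries of `S` up to `O(E³ / n²)`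
(`IsBalanced.abs_covariance_sub_le`). The characteristic function of a linear combination of
independent Poisson variables is explicit, so no general central limit theorem is needed: its
logarithm is the second cumulant up to a relative error of the size of the largest weight
(`norm_cumulant_add_le`), and Lévy's continuity theorem concludes.
-/

namespace NetworkPoisson

noncomputable section

/-! ### Row sums, column sums and the additive predictor -/

/-- The additive predictor `αᵢ + βⱼ` of the edge `(i, j)`. -/
def linPred {n : ℕ} (θ : Fin (2 * n - 1) → ℝ) (i j : Fin n) : ℝ :=
  sendPar θ i + recvPar θ j

/-- The sum of the off-diagonal entries. -/
def offSum {n : ℕ} (x : Fin n → Fin n → ℝ) : ℝ :=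
  ∑ i, ∑ j ∈ Finset.univ.erase i, x i j

section Sums

variable {n : ℕ}

lemma sum_erase_comm (x : Fin n → Fin n → ℝ) :
    ∑ j, ∑ i ∈ Finset.univ.erase j, x i j = ∑ i, ∑ j ∈ Finset.univ.erase i, x i j := by
  refine Finset.sum_comm' ?_
  intro a b
  simp [ne_comm]

lemma offSum_eq_sum_rowSum (x : Fin n → Fin n → ℝ) : offSum x = ∑ i, rowSum x i := rfl

lemma offSum_eq_sum_colSum (x : Fin n → Fin n → ℝ) : offSum x = ∑ j, colSum x j :=
  (sum_erase_comm x).symm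

lemma sum_fin_split (hn : 1 ≤ n) (f : Fin (2 * n - 1) → ℝ) :
    ∑ l, f l = ∑ i : Fin n, f ⟨i, by omega⟩
      + ∑ j : Fin n, if h : (j : ℕ) + 1 < n then f ⟨n + j, by omega⟩ else 0 := by
  let g : ℕ → ℝ := fun l => if h : l < 2 * n - 1 then f ⟨l, h⟩ else 0
  have h1 : ∑ l, f l = ∑ l ∈ Finset.range (n + (n - 1)), g l := by
    rw [show n + (n - 1) = 2 * n - 1 by omega, Finset.sum_range]
    exact Finset.sum_congr rfl fun l _ => by simp [g]
  rw [h1, Finset.sum_range_add, Finset.sum_range]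
  congr 1
  · refine Finset.sum_congr rfl fun i _ => ?_
    have : (i : ℕ) < 2 * n - 1 := by omega
    simp [g, this]
  · let g' : ℕ → ℝ := fun j => if h : j + 1 < n then f ⟨n + j, by omega⟩ else 0
    have h2 : ∑ j : Fin n, (if h : (j : ℕ) + 1 < n then f ⟨n + j, by omega⟩ else 0)
        = ∑ j ∈ Finset.range (n - 1 + 1), g' j := by
      rw [show n - 1 + 1 = n by omega, Finset.sum_range]
    rw [h2, Finset.sum_range_succ]
    have h3 : g' (n - 1) = 0 := by
      simp only [g']; rw [dif_neg]; omega
    rw [h3, add_zero]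
    refine Finset.sum_congr rfl fun j hj => ?_
    have hj := Finset.mem_range.1 hj
    have e1 : j + 1 < n := by omega
    have e2 : n + j < 2 * n - 1 := by omega
    simp [g, g', e1, e2]

/-- Summation by parts: `biSum` is adjoint to `linPred`. -/
lemma sum_mul_biSum (θ : Fin (2 * n - 1) → ℝ) (x : Fin n → Fin n → ℝ) :
    ∑ l, θ l * biSum x l = offSum fun i j => x i j * linPred θ i j := by
  rcases Nat.eq_zero_or_pos n with rfl | hn
  · simp [offSum]
  rw [sum_fin_split hn]
  have h1 : offSum (fun i j => x i j * linPred θ i j)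
      = offSum (fun i j => x i j * sendPar θ i) + offSum (fun i j => x i j * recvPar θ j) := by
    simp only [offSum, linPred, mul_add, Finset.sum_add_distrib]
  rw [h1, offSum_eq_sum_rowSum, offSum_eq_sum_colSum (fun i j => x i j * recvPar θ j)]
  congr 1
  · refine Finset.sum_congr rfl fun i _ => ?_
    have : biSum x ⟨i, by omega⟩ = rowSum x i := by
      simp [biSum, i.isLt]
    rw [this, rowSum, rowSum, Finset.mul_sum]
    exact Finset.sum_congr rfl fun j _ => by rw [mul_comm]; rfl
  · refine Finset.sum_congr rfl fun j _ => ?_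
    split_ifs with h
    · have : biSum x ⟨n + j, by omega⟩ = colSum x j := by
        simp [biSum]
      rw [this, colSum, colSum, Finset.mul_sum]
      exact Finset.sum_congr rfl fun i _ => by rw [mul_comm]; simp [recvPar, h]
    · simp [colSum, recvPar, h]

lemma rowSum_congr {x y : Fin n → Fin n → ℝ} (h : ∀ i j, i ≠ j → x i j = y i j) (i : Fin n) :
    rowSum x i = rowSum y i :=
  Finset.sum_congr rfl fun j hj => h i j (Finset.ne_of_mem_erase hj).symm

lemma colSum_congr {x y : Fin n → Fin n → ℝ} (h : ∀ i j, i ≠ j → x i j = y i j) (j : Fin n) :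
    colSum x j = colSum y j :=
  Finset.sum_congr rfl fun i hi => h i j (Finset.ne_of_mem_erase hi)

lemma offSum_congr {x y : Fin n → Fin n → ℝ} (h : ∀ i j, i ≠ j → x i j = y i j) :
    offSum x = offSum y :=
  Finset.sum_congr rfl fun i _ => rowSum_congr h i

lemma biSum_congr {x y : Fin n → Fin n → ℝ} (h : ∀ i j, i ≠ j → x i j = y i j) :
    biSum x = biSum y := by
  funext l
  unfold biSum
  split_ifs
  · exact rowSum_congr h _
  · exact colSum_congr h _

lemma rowSum_eq_of_biSum_eq {x y : Fin n → Fin n → ℝ} (h : biSum x = biSum y) (i : Fin n) :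
    rowSum x i = rowSum y i := by
  have := congrFun h ⟨i, by omega⟩
  simpa [biSum, i.isLt] using this

/-- The last column sum, which `biSum` omits, is determined by the other sums. -/
lemma colSum_eq_of_biSum_eq {x y : Fin n → Fin n → ℝ} (h : biSum x = biSum y) (j : Fin n) :
    colSum x j = colSum y j := by
  have key : ∀ j : Fin n, (j : ℕ) + 1 < n → colSum x j = colSum y j := by
    intro j hj
    have := congrFun h ⟨n + j, by omega⟩
    simpa [biSum] using this
  by_cases hj : (j : ℕ) + 1 < n
  · exact key j hj
  · have h1 : ∑ j, colSum x j = ∑ j, colSum y j := by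
      rw [← offSum_eq_sum_colSum, ← offSum_eq_sum_colSum, offSum_eq_sum_rowSum,
        offSum_eq_sum_rowSum]
      exact Finset.sum_congr rfl fun i _ => rowSum_eq_of_biSum_eq h i
    rw [← Finset.add_sum_erase _ _ (Finset.mem_univ j),
      ← Finset.add_sum_erase (a := j) _ (colSum y) (Finset.mem_univ j)] at h1
    have h2 : ∑ l ∈ Finset.univ.erase j, colSum x l = ∑ l ∈ Finset.univ.erase j, colSum y l := by
      refine Finset.sum_congr rfl fun l hl => key l ?_
      have : l ≠ j := Finset.ne_of_mem_erase hl
      have : (l : ℕ) ≠ j := fun h => this (Fin.ext h)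
      omega
    linarith

lemma rowSum_add (x y : Fin n → Fin n → ℝ) (i : Fin n) :
    rowSum (fun i j => x i j + y i j) i = rowSum x i + rowSum y i :=
  Finset.sum_add_distrib

lemma rowSum_sub (x y : Fin n → Fin n → ℝ) (i : Fin n) :
    rowSum (fun i j => x i j - y i j) i = rowSum x i - rowSum y i :=
  Finset.sum_sub_distrib _ _

lemma colSum_sub (x y : Fin n → Fin n → ℝ) (i : Fin n) :
    colSum (fun i j => x i j - y i j) i = colSum x i - colSum y i :=
  Finset.sum_sub_distrib _ _

lemma offSum_add (x y : Fin n → Fin n → ℝ) :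
    offSum (fun i j => x i j + y i j) = offSum x + offSum y := by
  simp [offSum, Finset.sum_add_distrib]

lemma offSum_sub (x y : Fin n → Fin n → ℝ) :
    offSum (fun i j => x i j - y i j) = offSum x - offSum y := by
  simp [offSum, Finset.sum_sub_distrib]

lemma offSum_mul_left (c : ℝ) (x : Fin n → Fin n → ℝ) :
    offSum (fun i j => c * x i j) = c * offSum x := by
  simp only [offSum, Finset.mul_sum]

lemma biSum_add (x y : Fin n → Fin n → ℝ) :
    biSum (fun i j => x i j + y i j) = biSum x + biSum y := by
  funext l
  simp only [biSum, Pi.add_apply]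
  split_ifs <;> simp [rowSum, colSum, Finset.sum_add_distrib]

lemma biSum_sub (x y : Fin n → Fin n → ℝ) :
    biSum (fun i j => x i j - y i j) = biSum x - biSum y := by
  funext l
  simp only [biSum, Pi.sub_apply]
  split_ifs <;> simp [rowSum, colSum, Finset.sum_sub_distrib]

lemma biSum_mul_left (c : ℝ) (x : Fin n → Fin n → ℝ) :
    biSum (fun i j => c * x i j) = c • biSum x := by
  funext l
  simp only [biSum, Pi.smul_apply, smul_eq_mul]
  split_ifs <;> simp only [rowSum, colSum, Finset.mul_sum]

lemma linPred_add (θ θ' : Fin (2 * n - 1) → ℝ) (i j : Fin n) :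
    linPred (θ + θ') i j = linPred θ i j + linPred θ' i j := by
  unfold linPred sendPar recvPar
  split_ifs <;> (simp only [Pi.add_apply]; ring)

lemma linPred_smul (c : ℝ) (θ : Fin (2 * n - 1) → ℝ) (i j : Fin n) :
    linPred (c • θ) i j = c * linPred θ i j := by
  unfold linPred sendPar recvPar
  split_ifs <;> (simp only [Pi.smul_apply, smul_eq_mul]; ring)

lemma linPred_sub (θ θ' : Fin (2 * n - 1) → ℝ) (i j : Fin n) :
    linPred (θ - θ') i j = linPred θ i j - linPred θ' i j := by
  unfold linPred sendPar recvPar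
  split_ifs <;> (simp only [Pi.sub_apply]; ring)

/-- The normalization `βₙ = 0` makes every coordinate of `θ` a difference of at most two values
of the additive predictor. -/
lemma abs_le_of_linPred_le {θ : Fin (2 * n - 1) → ℝ} {D : ℝ}
    (h : ∀ i j : Fin n, |linPred θ i j| ≤ D) (l : Fin (2 * n - 1)) : |θ l| ≤ 2 * D := by
  have hl := l.isLt
  have hn : n - 1 < n := by omega
  have hlast : recvPar θ ⟨n - 1, hn⟩ = 0 := by
    unfold recvPar; rw [dif_neg]; simp only; omega
  have hs : ∀ i, |sendPar θ i| ≤ D := by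
    intro i
    have := h i ⟨n - 1, hn⟩
    rwa [linPred, hlast, add_zero] at this
  have hD : 0 ≤ D := (abs_nonneg _).trans (hs ⟨0, by omega⟩)
  by_cases h1 : (l : ℕ) < n
  · have := hs ⟨l, h1⟩
    simp only [sendPar] at this
    linarith
  · have e : recvPar θ ⟨l - n, by omega⟩ = θ l := by
      unfold recvPar
      rw [dif_pos (by simp; omega)]
      congr 1
      apply Fin.ext; simp; omega
    have h2 := h ⟨0, by omega⟩ ⟨l - n, by omega⟩
    rw [linPred, e] at h2
    have h3 := hs ⟨0, by omega⟩
    rw [abs_le] at *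
    constructor <;> linarith

lemma abs_linPred_le {θ : Fin (2 * n - 1) → ℝ} (i j : Fin n) : |linPred θ i j| ≤ 2 * ‖θ‖ := by
  have h1 : |sendPar θ i| ≤ ‖θ‖ := norm_le_pi_norm θ _
  have h2 : |recvPar θ j| ≤ ‖θ‖ := by
    unfold recvPar
    split_ifs
    · exact norm_le_pi_norm θ _
    · simp
  calc |linPred θ i j| ≤ |sendPar θ i| + |recvPar θ j| := abs_add_le _ _
    _ ≤ 2 * ‖θ‖ := by linarith

lemma abs_offSum_le {x : Fin n → Fin n → ℝ} {D : ℝ} (hD : 0 ≤ D)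
    (h : ∀ i j, i ≠ j → |x i j| ≤ D) : |offSum x| ≤ (n : ℝ) ^ 2 * D := by
  have h1 : ∀ i : Fin n, |∑ j ∈ Finset.univ.erase i, x i j| ≤ n * D := by
    intro i
    refine (Finset.abs_sum_le_sum_abs _ _).trans ?_
    refine (Finset.sum_le_card_nsmul _ _ D fun j hj => h i j (Finset.ne_of_mem_erase hj).symm).trans
      ?_
    rw [nsmul_eq_mul]
    gcongr
    simp
  refine (Finset.abs_sum_le_sum_abs _ _).trans ?_
  refine (Finset.sum_le_card_nsmul _ _ (n * D) fun i _ => h1 i).trans ?_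
  simp [nsmul_eq_mul, sq, mul_assoc]

end Sums

/-! ### Sup-norm stability of the weighted two-way layout -/

section TwoWay

variable {n : ℕ}

/-- Two rows of row-normalized weights overlap in mass at least `1 / (2 E²)`, so averaging over
rows contracts the oscillation of the column effects by the factor `1 - 1 / (2 E²)`. -/
lemma row_effect_sub_le (hn : 3 ≤ n) {u : Fin n → Fin n → ℝ} {E : ℝ} (hE : 1 ≤ E)
    (hl : ∀ i j, i ≠ j → E⁻¹ ≤ u i j) (hu : ∀ i j, i ≠ j → u i j ≤ E)
    {α β : Fin n → ℝ} {ε D : ℝ}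
    (hr : ∀ i, |rowSum (fun i j => u i j * (α i + β j)) i| ≤ ε * rowSum u i)
    (hD : ∀ j j', β j - β j' ≤ D) (i i' : Fin n) :
    α i - α i' ≤ 2 * ε + (1 - 1 / (2 * E ^ 2)) * D := by
  have hE0 : 0 < E := by linarith
  have hn1 : (0 : ℝ) < n - 1 := by
    have : (3 : ℝ) ≤ n := by exact_mod_cast hn
    linarith
  have hpos : ∀ i, 0 < rowSum u i := fun i => by
    refine Finset.sum_pos (fun j hj => ?_) ?_
    · exact lt_of_lt_of_le (inv_pos.2 hE0) (hl i j (Finset.ne_of_mem_erase hj).symm)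
    · rw [← Finset.card_pos, Finset.card_erase_of_mem (Finset.mem_univ _)]; simp; omega
  have hle : ∀ i, rowSum u i ≤ (n - 1) * E := fun i => by
    refine (Finset.sum_le_card_nsmul _ _ E fun j hj =>
      hu i j (Finset.ne_of_mem_erase hj).symm).trans ?_
    rw [nsmul_eq_mul, Finset.card_erase_of_mem (Finset.mem_univ _)]
    simp [Nat.cast_sub (by omega : 1 ≤ n)]
  -- the common part of the two rows of normalized weights
  set T : Finset (Fin n) := (Finset.univ.erase i).erase i' with hT
  set c : ℝ := ((n - 1) * E ^ 2)⁻¹ with hc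
  have hc0 : 0 ≤ c := by positivity
  have hβ : ∃ jm, ∀ j, β jm ≤ β j := by
    have : Nonempty (Fin n) := ⟨i⟩
    exact Finite.exists_min β
  have hβ' : ∃ jM, ∀ j, β j ≤ β jM := by
    have : Nonempty (Fin n) := ⟨i⟩
    exact Finite.exists_max β
  obtain ⟨jm, hjm⟩ := hβ
  obtain ⟨jM, hjM⟩ := hβ'
  have hw : ∀ i j, i ≠ j → c ≤ u i j / rowSum u i := by
    intro i j hij
    rw [le_div_iff₀ (hpos i)]
    calc c * rowSum u i ≤ c * ((n - 1) * E) := by gcongr; exact hle i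
      _ = E⁻¹ := by rw [hc]; field_simp
      _ ≤ u i j := hl i j hij
  have hnorm : ∀ i, ∑ j ∈ Finset.univ.erase i, u i j / rowSum u i = 1 := by
    intro i
    rw [← Finset.sum_div]
    exact div_self (hpos i).ne'
  have hrow : ∀ i, |α i + ∑ j ∈ Finset.univ.erase i, u i j / rowSum u i * β j| ≤ ε := by
    intro i
    have h1 : rowSum (fun i j => u i j * (α i + β j)) i
        = rowSum u i * (α i + ∑ j ∈ Finset.univ.erase i, u i j / rowSum u i * β j) := by
      have : ∑ j ∈ Finset.univ.erase i, u i j / rowSum u i * β j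
          = (∑ j ∈ Finset.univ.erase i, u i j * β j) / rowSum u i := by
        rw [Finset.sum_div]; exact Finset.sum_congr rfl fun j _ => by ring
      rw [this, mul_add, mul_div_cancel₀ _ (hpos i).ne']
      simp only [rowSum, mul_add, Finset.sum_add_distrib, Finset.sum_mul]
    have h2 := hr i
    rw [h1, abs_mul, abs_of_pos (hpos i), mul_comm] at h2
    exact le_of_mul_le_mul_right h2 (hpos i)
  have hTi : T ⊆ Finset.univ.erase i := Finset.erase_subset _ _
  have hTi' : T ⊆ Finset.univ.erase i' := Finset.erase_subset_erase _ (Finset.erase_subset _ _)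
  have hTc : (n : ℝ) - 2 ≤ T.card := by
    have h1 : (Finset.univ.erase i).card = n - 1 := by
      rw [Finset.card_erase_of_mem (Finset.mem_univ _)]; simp
    have h2 : (Finset.univ.erase i).card - 1 ≤ T.card := Finset.pred_card_le_card_erase
    have h3 : n ≤ T.card + 2 := by omega
    have : (n : ℝ) ≤ T.card + 2 := by exact_mod_cast h3
    linarith
  have hmass : 1 / (2 * E ^ 2) ≤ T.card * c := by
    calc 1 / (2 * E ^ 2) ≤ (n - 2) * c := by
          rw [hc, ← div_eq_mul_inv, div_le_div_iff₀ (by positivity) (by positivity)]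
          have : (3 : ℝ) ≤ n := by exact_mod_cast hn
          nlinarith [sq_nonneg E, sq_pos_of_pos hE0]
      _ ≤ T.card * c := by gcongr
  -- the weighted mean of a row is at least `c ∑_T β` plus the remaining mass times the minimum
  have hlow : ∀ i, T ⊆ Finset.univ.erase i →
      c * ∑ j ∈ T, β j + (1 - T.card * c) * β jm
        ≤ ∑ j ∈ Finset.univ.erase i, u i j / rowSum u i * β j := by
    intro i hTi
    have h1 : ∑ j ∈ T, c * (β j - β jm)
        ≤ ∑ j ∈ Finset.univ.erase i, u i j / rowSum u i * (β j - β jm) := by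
      refine (Finset.sum_le_sum fun j hj => ?_).trans
        (Finset.sum_le_sum_of_subset_of_nonneg hTi fun j hj _ => ?_)
      · exact mul_le_mul_of_nonneg_right (hw i j (Finset.ne_of_mem_erase (hTi hj)).symm)
          (sub_nonneg.2 (hjm j))
      · exact mul_nonneg (hc0.trans (hw i j (Finset.ne_of_mem_erase hj).symm))
          (sub_nonneg.2 (hjm j))
    simp only [mul_sub, Finset.sum_sub_distrib, ← Finset.sum_mul, hnorm] at h1
    simp only [Finset.sum_const, nsmul_eq_mul, ← Finset.mul_sum] at h1
    linarith
  have hupp : ∀ i, T ⊆ Finset.univ.erase i →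
      ∑ j ∈ Finset.univ.erase i, u i j / rowSum u i * β j
        ≤ c * ∑ j ∈ T, β j + (1 - T.card * c) * β jM := by
    intro i hTi
    have h1 : ∑ j ∈ T, c * (β jM - β j)
        ≤ ∑ j ∈ Finset.univ.erase i, u i j / rowSum u i * (β jM - β j) := by
      refine (Finset.sum_le_sum fun j hj => ?_).trans
        (Finset.sum_le_sum_of_subset_of_nonneg hTi fun j hj _ => ?_)
      · exact mul_le_mul_of_nonneg_right (hw i j (Finset.ne_of_mem_erase (hTi hj)).symm)
          (sub_nonneg.2 (hjM j))
      · exact mul_nonneg (hc0.trans (hw i j (Finset.ne_of_mem_erase hj).symm))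
          (sub_nonneg.2 (hjM j))
    simp only [mul_sub, Finset.sum_sub_distrib, ← Finset.sum_mul, hnorm] at h1
    simp only [Finset.sum_const, nsmul_eq_mul, ← Finset.mul_sum] at h1
    linarith
  have hTc1 : T.card * c ≤ 1 := by
    have h1 : ∑ j ∈ T, c ≤ ∑ j ∈ Finset.univ.erase i, u i j / rowSum u i :=
      (Finset.sum_le_sum fun j hj => hw i j (Finset.ne_of_mem_erase (hTi hj)).symm).trans
        (Finset.sum_le_sum_of_subset_of_nonneg hTi fun j hj _ =>
          hc0.trans (hw i j (Finset.ne_of_mem_erase hj).symm))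
    rw [hnorm] at h1
    simpa using h1
  have hD0 : 0 ≤ D := by simpa using hD i i
  have a1 := abs_le.1 (hrow i)
  have a2 := abs_le.1 (hrow i')
  have a3 := hlow i hTi
  have a4 := hupp i' hTi'
  have a5 : (1 - T.card * c) * (β jM - β jm) ≤ (1 - 1 / (2 * E ^ 2)) * D :=
    (mul_le_mul_of_nonneg_left (hD jM jm) (by linarith)).trans
      (mul_le_mul_of_nonneg_right (by linarith) hD0)
  rw [mul_sub] at a5
  linarith

/-- Sup-norm stability of the two-way layout: if the weighted row and column means of `αᵢ + βⱼ` are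
at most `ε` in absolute value, then all `|αᵢ + βⱼ|` are of order `ε E²`. -/
lemma abs_add_le_of_weighted_means (hn : 3 ≤ n) {u : Fin n → Fin n → ℝ} {E : ℝ} (hE : 1 ≤ E)
    (hl : ∀ i j, i ≠ j → E⁻¹ ≤ u i j) (hu : ∀ i j, i ≠ j → u i j ≤ E)
    {α β : Fin n → ℝ} {ε : ℝ}
    (hr : ∀ i, |rowSum (fun i j => u i j * (α i + β j)) i| ≤ ε * rowSum u i)
    (hc : ∀ j, |colSum (fun i j => u i j * (α i + β j)) j| ≤ ε * colSum u j)
    (i j : Fin n) : |α i + β j| ≤ 9 * E ^ 2 * ε := by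
  have hE0 : 0 < E := by linarith
  have hne : Nonempty (Fin n × Fin n) := ⟨(i, i)⟩
  obtain ⟨⟨a1, a2⟩, hA⟩ := Finite.exists_max fun q : Fin n × Fin n => α q.1 - α q.2
  obtain ⟨⟨b1, b2⟩, hB⟩ := Finite.exists_max fun q : Fin n × Fin n => β q.1 - β q.2
  have h1 := row_effect_sub_le hn hE hl hu hr (D := β b1 - β b2) (fun j j' => hB (j, j')) a1 a2
  have h2 := row_effect_sub_le hn hE (u := fun i j => u j i) (fun i j hij => hl j i hij.symm)
    (fun i j hij => hu j i hij.symm) (α := β) (β := α) (ε := ε) (D := α a1 - α a2)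
    (fun j => by
      have := hc j
      simp only [add_comm (β _)]
      exact this) (fun j j' => hA (j, j')) b1 b2
  have hD : β b1 - β b2 ≤ 8 * E ^ 2 * ε := by
    have hA0 : 0 ≤ α a1 - α a2 := by simpa using hA (i, i)
    have h3 : 1 / (2 * E ^ 2) * (β b1 - β b2) ≤ 4 * ε := by
      have : 0 ≤ 1 / (2 * E ^ 2) * (α a1 - α a2) := by positivity
      linarith
    rw [div_mul_eq_mul_div, div_le_iff₀ (by positivity)] at h3
    linarith
  have hpos : 0 < rowSum u i := by
    refine Finset.sum_pos (fun j hj => ?_) ?_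
    · exact lt_of_lt_of_le (inv_pos.2 hE0) (hl i j (Finset.ne_of_mem_erase hj).symm)
    · rw [← Finset.card_pos, Finset.card_erase_of_mem (Finset.mem_univ _)]; simp; omega
  have hε : 0 ≤ ε := nonneg_of_mul_nonneg_left ((abs_nonneg _).trans (hr i)) hpos
  have h4 : |rowSum u i * (α i + β j)| ≤ rowSum u i * (ε + 8 * E ^ 2 * ε) := by
    have e : rowSum u i * (α i + β j) = rowSum (fun i j => u i j * (α i + β j)) i
        + ∑ j' ∈ Finset.univ.erase i, u i j' * (β j - β j') := by
      rw [rowSum, rowSum, ← Finset.sum_add_distrib, Finset.sum_mul]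
      exact Finset.sum_congr rfl fun j' _ => by ring
    have e2 : |∑ j' ∈ Finset.univ.erase i, u i j' * (β j - β j')|
        ≤ rowSum u i * (8 * E ^ 2 * ε) := by
      rw [rowSum, Finset.sum_mul]
      refine (Finset.abs_sum_le_sum_abs _ _).trans (Finset.sum_le_sum fun j' hj' => ?_)
      have hu0 : 0 ≤ u i j' :=
        (inv_pos.2 hE0).le.trans (hl i j' (Finset.ne_of_mem_erase hj').symm)
      rw [abs_mul, abs_of_nonneg hu0]
      refine mul_le_mul_of_nonneg_left (abs_le.2 ⟨?_, ?_⟩) hu0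
      · have := hB (j', j); simp only at this; linarith
      · have := hB (j, j'); simp only at this; linarith
    rw [e]
    refine (abs_add_le _ _).trans ?_
    have := hr i
    linarith
  rw [abs_mul, abs_of_pos hpos] at h4
  have h5 := le_of_mul_le_mul_left h4 hpos
  have : 1 * ε ≤ E ^ 2 * ε := by
    gcongr; exact one_le_pow₀ hE
  linarith

end TwoWay

/-! ### Weighted additive fits -/

/-- Weights whose off-diagonal entries lie between `E⁻¹` and `E`, on at least three nodes. -/
structure IsBalanced {n : ℕ} (u : Fin n → Fin n → ℝ) (E : ℝ) : Prop where
  three_le : 3 ≤ n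
  one_le : 1 ≤ E
  lower : ∀ i j, i ≠ j → E⁻¹ ≤ u i j
  upper : ∀ i j, i ≠ j → u i j ≤ E

/-- `biSum` as a linear map. -/
def biSumLin (n : ℕ) : (Fin n → Fin n → ℝ) →ₗ[ℝ] (Fin (2 * n - 1) → ℝ) where
  toFun := biSum
  map_add' := biSum_add
  map_smul' := biSum_mul_left

/-- The Fisher information matrix of `θ` for the edge variances `u`. -/
def fisher {n : ℕ} (u : Fin n → Fin n → ℝ) : Matrix (Fin (2 * n - 1)) (Fin (2 * n - 1)) ℝ :=
  LinearMap.toMatrix' (R := ℝ)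
    { toFun := fun θ => biSum fun i j => u i j * linPred θ i j
      map_add' := fun θ θ' => by
        rw [← biSum_add]
        simp only [linPred_add, mul_add]
      map_smul' := fun c θ => by
        rw [RingHom.id_apply, ← biSum_mul_left]
        simp only [linPred_smul, mul_left_comm] }

/-- The parameter `θ` whose additive predictor, weighted by `u`, has the same row and column sums
as `x`: the coefficient of the weighted regression of `x / u` on the row and column effects. -/
def fit {n : ℕ} (u : Fin n → Fin n → ℝ) : (Fin n → Fin n → ℝ) →ₗ[ℝ] (Fin (2 * n - 1) → ℝ) :=
  (fisher u)⁻¹.mulVecLin ∘ₗ biSumLin n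

section Fit

variable {n : ℕ} {u : Fin n → Fin n → ℝ} {E : ℝ}

lemma fisher_mulVec (u : Fin n → Fin n → ℝ) (θ : Fin (2 * n - 1) → ℝ) :
    fisher u *ᵥ θ = biSum fun i j => u i j * linPred θ i j := by
  rw [fisher, LinearMap.toMatrix'_mulVec]
  rfl

lemma fit_apply (u x : Fin n → Fin n → ℝ) : fit u x = (fisher u)⁻¹ *ᵥ biSum x := rfl

lemma fit_congr {x y : Fin n → Fin n → ℝ} (h : ∀ i j, i ≠ j → x i j = y i j) :
    fit u x = fit u y := by
  rw [fit_apply, fit_apply, biSum_congr h]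

lemma IsBalanced.pos_E (hb : IsBalanced u E) : 0 < E := by linarith [hb.one_le]

lemma IsBalanced.pos (hb : IsBalanced u E) {i j : Fin n} (hij : i ≠ j) : 0 < u i j :=
  (inv_pos.2 hb.pos_E).trans_le (hb.lower i j hij)

lemma IsBalanced.transpose (hb : IsBalanced u E) : IsBalanced (fun i j => u j i) E :=
  ⟨hb.three_le, hb.one_le, fun i j h => hb.lower j i h.symm, fun i j h => hb.upper j i h.symm⟩

lemma IsBalanced.three_le_cast (hb : IsBalanced u E) : (3 : ℝ) ≤ n := by
  exact_mod_cast hb.three_le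

lemma card_erase_cast (i : Fin n) : ((Finset.univ.erase i).card : ℝ) = n - 1 := by
  have := i.isLt
  rw [Finset.card_erase_of_mem (Finset.mem_univ _)]
  simp [Nat.cast_sub (by omega : 1 ≤ n)]

lemma IsBalanced.rowSum_le (hb : IsBalanced u E) (i : Fin n) : rowSum u i ≤ (n - 1) * E := by
  refine (Finset.sum_le_card_nsmul _ _ E fun j hj =>
    hb.upper i j (Finset.ne_of_mem_erase hj).symm).trans ?_
  rw [nsmul_eq_mul, card_erase_cast]

lemma IsBalanced.le_rowSum (hb : IsBalanced u E) (i : Fin n) : (n - 1) * E⁻¹ ≤ rowSum u i := by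
  refine le_trans ?_ (Finset.card_nsmul_le_sum _ _ E⁻¹ fun j hj =>
    hb.lower i j (Finset.ne_of_mem_erase hj).symm)
  rw [nsmul_eq_mul, card_erase_cast]

lemma IsBalanced.rowSum_pos (hb : IsBalanced u E) (i : Fin n) : 0 < rowSum u i := by
  refine lt_of_lt_of_le ?_ (hb.le_rowSum i)
  have := hb.three_le_cast
  have := hb.pos_E
  have : (0 : ℝ) < n - 1 := by linarith
  positivity

lemma IsBalanced.le_colSum (hb : IsBalanced u E) (j : Fin n) : (n - 1) * E⁻¹ ≤ colSum u j :=
  hb.transpose.le_rowSum j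

lemma IsBalanced.colSum_pos (hb : IsBalanced u E) (j : Fin n) : 0 < colSum u j :=
  hb.transpose.rowSum_pos j

lemma eq_zero_of_linPred_le_zero {θ : Fin (2 * n - 1) → ℝ}
    (h : ∀ i j : Fin n, |linPred θ i j| ≤ 0) : θ = 0 := by
  funext l
  have := abs_le_of_linPred_le h l
  rw [mul_zero] at this
  exact abs_nonpos_iff.1 this

lemma IsBalanced.eq_zero_of_biSum_eq_zero (hb : IsBalanced u E) {θ : Fin (2 * n - 1) → ℝ}
    (h : biSum (fun i j => u i j * linPred θ i j) = 0) : θ = 0 := by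
  refine eq_zero_of_linPred_le_zero fun i j => ?_
  have h0 : biSum (fun i j => u i j * linPred θ i j) = biSum (fun _ _ : Fin n => (0 : ℝ)) := by
    rw [h]; funext l; simp [biSum, rowSum, colSum]
  have h1 := rowSum_eq_of_biSum_eq h0
  have h2 := colSum_eq_of_biSum_eq h0
  have := abs_add_le_of_weighted_means hb.three_le hb.one_le hb.lower hb.upper
    (α := sendPar θ) (β := recvPar θ) (ε := 0)
    (fun i => by have := h1 i; simp only [linPred] at this; rw [this]; simp [rowSum])
    (fun i => by have := h2 i; simp only [linPred] at this; rw [this]; simp [colSum]) i j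
  simpa [linPred] using this

lemma IsBalanced.isUnit_det (hb : IsBalanced u E) : IsUnit (fisher u).det := by
  rw [← Matrix.isUnit_iff_isUnit_det, ← Matrix.mulVec_injective_iff_isUnit]
  intro θ θ' h
  rw [← sub_eq_zero]
  refine hb.eq_zero_of_biSum_eq_zero ?_
  rw [← fisher_mulVec, Matrix.mulVec_sub, sub_eq_zero]
  exact h

lemma IsBalanced.biSum_fit (hb : IsBalanced u E) (x : Fin n → Fin n → ℝ) :
    biSum (fun i j => u i j * linPred (fit u x) i j) = biSum x := by
  rw [← fisher_mulVec, fit_apply, Matrix.mulVec_mulVec, Matrix.mul_nonsing_inv _ hb.isUnit_det,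
    Matrix.one_mulVec]

lemma IsBalanced.fit_weighted_linPred (hb : IsBalanced u E) (θ : Fin (2 * n - 1) → ℝ) :
    fit u (fun i j => u i j * linPred θ i j) = θ := by
  rw [fit_apply, ← fisher_mulVec, Matrix.mulVec_mulVec, Matrix.nonsing_inv_mul _ hb.isUnit_det,
    Matrix.one_mulVec]

/-- An additive predictor only sees the row and column sums of the array it is paired with. -/
lemma offSum_mul_linPred_congr {x y : Fin n → Fin n → ℝ} (h : biSum x = biSum y)
    (θ : Fin (2 * n - 1) → ℝ) :
    offSum (fun i j => x i j * linPred θ i j) = offSum fun i j => y i j * linPred θ i j := by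
  rw [← sum_mul_biSum, ← sum_mul_biSum, h]

/-- The additive fit is self-adjoint. -/
lemma IsBalanced.offSum_mul_linPred_fit_comm (hb : IsBalanced u E) (x y : Fin n → Fin n → ℝ) :
    offSum (fun i j => x i j * linPred (fit u y) i j)
      = offSum fun i j => y i j * linPred (fit u x) i j := by
  rw [← offSum_mul_linPred_congr (hb.biSum_fit x), ← offSum_mul_linPred_congr (hb.biSum_fit y)]
  exact congrArg offSum (funext fun i => funext fun j => by ring)

lemma IsBalanced.abs_linPred_fit_le_of_sums (hb : IsBalanced u E) {x : Fin n → Fin n → ℝ} {ε : ℝ}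
    (hr : ∀ i, |rowSum x i| ≤ ε * rowSum u i) (hc : ∀ j, |colSum x j| ≤ ε * colSum u j)
    (i j : Fin n) : |linPred (fit u x) i j| ≤ 9 * E ^ 2 * ε :=
  abs_add_le_of_weighted_means hb.three_le hb.one_le hb.lower hb.upper
    (α := sendPar (fit u x)) (β := recvPar (fit u x))
    (fun i => by have h := hr i; rw [← rowSum_eq_of_biSum_eq (hb.biSum_fit x)] at h; exact h)
    (fun j => by have h := hc j; rw [← colSum_eq_of_biSum_eq (hb.biSum_fit x)] at h; exact h) i j

lemma IsBalanced.abs_linPred_fit_le (hb : IsBalanced u E) {x : Fin n → Fin n → ℝ} {ε : ℝ}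
    (hx : ∀ i j, i ≠ j → |x i j| ≤ ε * u i j) (i j : Fin n) :
    |linPred (fit u x) i j| ≤ 9 * E ^ 2 * ε := by
  refine hb.abs_linPred_fit_le_of_sums (fun i => ?_) (fun j => ?_) i j
  · rw [rowSum, rowSum, Finset.mul_sum]
    exact (Finset.abs_sum_le_sum_abs _ _).trans
      (Finset.sum_le_sum fun j hj => hx i j (Finset.ne_of_mem_erase hj).symm)
  · rw [colSum, colSum, Finset.mul_sum]
    exact (Finset.abs_sum_le_sum_abs _ _).trans
      (Finset.sum_le_sum fun i hi => hx i j (Finset.ne_of_mem_erase hi))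

end Fit

/-! ### The profile information as the Gram matrix of residual covariates -/

/-- The part of the covariate `c` that is not explained by row and column effects. -/
def residCov {n p : ℕ} (Z : Fin n → Fin n → Fin p → ℝ) (u : Fin n → Fin n → ℝ) (c : Fin p)
    (i j : Fin n) : ℝ :=
  Z i j c - linPred (fit u fun i j => u i j * Z i j c) i j

/-- The matrix with entries `∑_{i ≠ j} Zᵢⱼᶜ uᵢⱼ rᵢⱼᵈ`, where `rᵈ` is the residual of the covariate
`d`; it equals the weighted Gram matrix of the residual covariates. -/
def residGram {n p : ℕ} (Z : Fin n → Fin n → Fin p → ℝ) (u : Fin n → Fin n → ℝ) :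
    Matrix (Fin p) (Fin p) ℝ :=
  Matrix.of fun c d => offSum fun i j => Z i j c * (u i j * residCov Z u d i j)

section Jacobian

variable {n p : ℕ}

lemma jacobian_apply {d e : ℕ} {f : (Fin d → ℝ) → Fin e → ℝ} {x : Fin d → ℝ}
    {D : Fin e → (Fin d → ℝ) →L[ℝ] ℝ} (h : ∀ l, HasFDerivAt (fun x => f x l) (D l) x)
    (l : Fin e) (m : Fin d) : jacobian f x l m = D l (Pi.single m 1) := by
  have : HasFDerivAt f (ContinuousLinearMap.pi D) x := hasFDerivAt_pi.2 h
  rw [jacobian, Matrix.of_apply, this.fderiv]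
  rfl

/-- The additive predictor of one edge as a continuous linear functional of `θ`. -/
def linPredCLM (i j : Fin n) : (Fin (2 * n - 1) → ℝ) →L[ℝ] ℝ :=
  LinearMap.toContinuousLinearMap
    { toFun := fun θ => linPred θ i j
      map_add' := fun θ θ' => linPred_add θ θ' i j
      map_smul' := fun c θ => linPred_smul c θ i j }

/-- The pairing with a fixed covariate vector as a continuous linear functional. -/
def dotCLM (z : Fin p → ℝ) : (Fin p → ℝ) →L[ℝ] ℝ :=
  LinearMap.toContinuousLinearMap
    { toFun := fun γ => z ⬝ᵥ γ
      map_add' := dotProduct_add z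
      map_smul' := fun c γ => dotProduct_smul c z γ }

lemma hasFDerivAt_rate_left (Z : Fin n → Fin n → Fin p → ℝ) (θ : Fin (2 * n - 1) → ℝ)
    (γ : Fin p → ℝ) (i j : Fin n) :
    HasFDerivAt (fun θ => rate Z θ γ i j) (rate Z θ γ i j • linPredCLM i j) θ :=
  ((linPredCLM i j).hasFDerivAt.add_const _).exp

lemma hasFDerivAt_rate_right (Z : Fin n → Fin n → Fin p → ℝ) (θ : Fin (2 * n - 1) → ℝ)
    (γ : Fin p → ℝ) (i j : Fin n) :
    HasFDerivAt (fun γ => rate Z θ γ i j) (rate Z θ γ i j • dotCLM (Z i j)) γ :=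
  ((dotCLM (Z i j)).hasFDerivAt.const_add _).exp

lemma jacobian_scoreF {d : ℕ} {R : (Fin d → ℝ) → Fin n → Fin n → ℝ} {x : Fin d → ℝ}
    {D : Fin n → Fin n → (Fin d → ℝ) →L[ℝ] ℝ} {k : Fin (2 * n - 1) → ℝ}
    (h : ∀ i j, HasFDerivAt (fun x => R x i j) (D i j) x) (l : Fin (2 * n - 1)) (m : Fin d) :
    jacobian (fun x l => biSum (R x) l - k l) x l m
      = biSum (fun i j => D i j (Pi.single m 1)) l := by
  let D' : Fin (2 * n - 1) → (Fin d → ℝ) →L[ℝ] ℝ := fun l =>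
    if h : (l : ℕ) < n then ∑ j ∈ Finset.univ.erase ⟨l, h⟩, D ⟨l, h⟩ j
    else ∑ i ∈ Finset.univ.erase ⟨l - n, by omega⟩, D i ⟨l - n, by omega⟩
  rw [jacobian_apply (D := D')]
  · simp only [D', biSum]
    split_ifs
    · rw [_root_.sum_apply]; rfl
    · rw [_root_.sum_apply]; rfl
  · intro l
    refine HasFDerivAt.sub_const _ ?_
    by_cases hl : (l : ℕ) < n
    · simp only [D', biSum, dif_pos hl, rowSum]
      exact HasFDerivAt.fun_sum fun j _ => h _ _
    · simp only [D', biSum, dif_neg hl, colSum]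
      exact HasFDerivAt.fun_sum fun j _ => h _ _

lemma jacobian_scoreQ {d : ℕ} {Z : Fin n → Fin n → Fin p → ℝ}
    {R : (Fin d → ℝ) → Fin n → Fin n → ℝ} {x : Fin d → ℝ}
    {D : Fin n → Fin n → (Fin d → ℝ) →L[ℝ] ℝ} {k : Fin n → Fin n → ℝ}
    (h : ∀ i j, HasFDerivAt (fun x => R x i j) (D i j) x) (c : Fin p) (m : Fin d) :
    jacobian (fun x c => ∑ i, ∑ j ∈ Finset.univ.erase i, Z i j c * (R x i j - k i j)) x c m
      = offSum (fun i j => Z i j c * D i j (Pi.single m 1)) := by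
  rw [jacobian_apply (D := fun c => ∑ i, ∑ j ∈ Finset.univ.erase i, Z i j c • D i j)]
  · simp [offSum]
  · intro c
    refine HasFDerivAt.fun_sum fun i _ => HasFDerivAt.fun_sum fun j _ => ?_
    exact ((h i j).sub_const _).const_mul _

lemma jacobian_scoreF_left (Z : Fin n → Fin n → Fin p → ℝ) (θ : Fin (2 * n - 1) → ℝ)
    (γ : Fin p → ℝ) :
    jacobian (fun θ' => scoreF Z 0 θ' γ) θ = fisher (rate Z θ γ) := by
  ext l m
  refine (jacobian_scoreF (fun i j => hasFDerivAt_rate_left Z θ γ i j) l m).trans ?_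
  have := congrFun (fisher_mulVec (rate Z θ γ) (Pi.single m 1)) l
  rw [Matrix.mulVec_single_one] at this
  exact this.symm

lemma jacobian_scoreF_right (Z : Fin n → Fin n → Fin p → ℝ) (θ : Fin (2 * n - 1) → ℝ)
    (γ : Fin p → ℝ) (l : Fin (2 * n - 1)) (c : Fin p) :
    jacobian (fun γ' => scoreF Z 0 θ γ') γ l c
      = biSum (fun i j => rate Z θ γ i j * Z i j c) l := by
  refine (jacobian_scoreF (fun i j => hasFDerivAt_rate_right Z θ γ i j) l c).trans ?_
  simp [dotCLM]

lemma jacobian_scoreQ_left (Z : Fin n → Fin n → Fin p → ℝ) (θ : Fin (2 * n - 1) → ℝ)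
    (γ : Fin p → ℝ) (c : Fin p) (m : Fin (2 * n - 1)) :
    jacobian (fun θ' => scoreQ Z 0 θ' γ) θ c m
      = biSum (fun i j => rate Z θ γ i j * Z i j c) m := by
  refine (jacobian_scoreQ (fun i j => hasFDerivAt_rate_left Z θ γ i j) c m).trans ?_
  have h := sum_mul_biSum (Pi.single m 1) (fun i j => rate Z θ γ i j * Z i j c)
  simp only [Pi.single_apply, ite_mul, one_mul, zero_mul, Finset.sum_ite_eq',
    Finset.mem_univ, if_true] at h
  rw [h]
  refine offSum_congr fun i j _ => ?_
  change Z i j c * (rate Z θ γ i j * linPred (Pi.single m 1) i j) = _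
  ring

lemma jacobian_scoreQ_right (Z : Fin n → Fin n → Fin p → ℝ) (θ : Fin (2 * n - 1) → ℝ)
    (γ : Fin p → ℝ) (c d : Fin p) :
    jacobian (fun γ' => scoreQ Z 0 θ γ') γ c d
      = offSum fun i j => Z i j c * (rate Z θ γ i j * Z i j d) := by
  refine (jacobian_scoreQ (fun i j => hasFDerivAt_rate_right Z θ γ i j) c d).trans ?_
  simp [dotCLM]

lemma profileInfo_eq_residGram (Z : Fin n → Fin n → Fin p → ℝ) (θ : Fin (2 * n - 1) → ℝ)
    (γ : Fin p → ℝ) : profileInfo Z θ γ = residGram Z (rate Z θ γ) := by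
  ext c d
  set u := rate Z θ γ with hu
  have h1 : (jacobian (fun θ' => scoreQ Z 0 θ' γ) θ * (jacobian (fun θ' => scoreF Z 0 θ' γ) θ)⁻¹
      * jacobian (fun γ' => scoreF Z 0 θ γ') γ) c d
      = offSum fun i j => u i j * Z i j c * linPred (fit u fun i j => u i j * Z i j d) i j := by
    rw [← sum_mul_biSum, Matrix.mul_assoc, jacobian_scoreF_left, ← hu, Matrix.mul_apply]
    refine Finset.sum_congr rfl fun m _ => ?_
    rw [jacobian_scoreQ_left, mul_comm, ← hu]
    congr 1
    rw [fit_apply, Matrix.mul_apply]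
    exact Finset.sum_congr rfl fun l _ => by rw [jacobian_scoreF_right]
  rw [profileInfo, Matrix.sub_apply, jacobian_scoreQ_right, h1, ← hu, ← offSum_sub]
  rw [residGram, Matrix.of_apply]
  refine offSum_congr fun i j _ => ?_
  rw [residCov]
  ring

end Jacobian

/-! ### The linearized score equations -/

/-- The hypotheses on a fixed design under which the linearized score equations are solved: balanced
weights, covariates bounded by `B`, and a profile information whose inverse has norm at
most `η`. -/
structure IsRegular {n p : ℕ} (Z : Fin n → Fin n → Fin p → ℝ) (u : Fin n → Fin n → ℝ)
    (E B η : ℝ) : Prop extends IsBalanced u E where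
  one_le_p : 1 ≤ p
  one_le_B : 1 ≤ B
  cov_le : ∀ i j, i ≠ j → ∀ c, |Z i j c| ≤ B
  isUnit_det_residGram : IsUnit (residGram Z u).det
  infNorm_le : infNorm (residGram Z u)⁻¹ ≤ η

section Solve

variable {n p : ℕ} {Z : Fin n → Fin n → Fin p → ℝ} {u : Fin n → Fin n → ℝ} {E B η : ℝ}

lemma abs_mulVec_le_infNorm (M : Matrix (Fin p) (Fin p) ℝ) {v : Fin p → ℝ} {D : ℝ}
    (hv : ∀ c, |v c| ≤ D) (c : Fin p) : |(M *ᵥ v) c| ≤ infNorm M * D := by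
  have h1 : ∑ d, |M c d| ≤ infNorm M :=
    le_ciSup (f := fun i => ∑ j, |M i j|) (Set.finite_range _).bddAbove c
  have hD : 0 ≤ D := (abs_nonneg _).trans (hv c)
  change |∑ d, M c d * v d| ≤ _
  calc |∑ d, M c d * v d| ≤ ∑ d, |M c d * v d| := Finset.abs_sum_le_sum_abs _ _
    _ ≤ ∑ d, |M c d| * D := Finset.sum_le_sum fun d _ => by
        rw [abs_mul]; exact mul_le_mul_of_nonneg_left (hv d) (abs_nonneg _)
    _ = (∑ d, |M c d|) * D := by rw [Finset.sum_mul]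
    _ ≤ infNorm M * D := by gcongr

lemma dotProduct_sub_linPred_fit (Z : Fin n → Fin n → Fin p → ℝ) (u : Fin n → Fin n → ℝ)
    (g : Fin p → ℝ) (i j : Fin n) :
    Z i j ⬝ᵥ g - linPred (fit u fun i j => u i j * (Z i j ⬝ᵥ g)) i j
      = ∑ d, residCov Z u d i j * g d := by
  have h1 : (fun i j => u i j * (Z i j ⬝ᵥ g))
      = ∑ d, g d • (fun i j => u i j * Z i j d) := by
    funext i j
    simp only [Finset.sum_apply, Pi.smul_apply, smul_eq_mul, dotProduct, Finset.mul_sum]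
    exact Finset.sum_congr rfl fun d _ => by ring
  have h2 : linPred (fit u fun i j => u i j * (Z i j ⬝ᵥ g)) i j
      = ∑ d, g d * linPred (fit u fun i j => u i j * Z i j d) i j := by
    rw [h1, map_sum]
    change linPredCLM i j _ = _
    rw [map_sum]
    refine Finset.sum_congr rfl fun d _ => ?_
    rw [map_smul, map_smul]
    rfl
  rw [h2, dotProduct, ← Finset.sum_sub_distrib]
  exact Finset.sum_congr rfl fun d _ => by rw [residCov]; ring

lemma residGram_mulVec (Z : Fin n → Fin n → Fin p → ℝ) (u : Fin n → Fin n → ℝ)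
    (g : Fin p → ℝ) (c : Fin p) :
    (residGram Z u *ᵥ g) c = offSum fun i j => Z i j c *
      (u i j * (Z i j ⬝ᵥ g - linPred (fit u fun i j => u i j * (Z i j ⬝ᵥ g)) i j)) := by
  simp only [dotProduct_sub_linPred_fit, Finset.mul_sum]
  simp only [Matrix.mulVec, dotProduct, residGram, Matrix.of_apply, offSum, Finset.sum_mul]
  rw [Finset.sum_comm]
  refine Finset.sum_congr rfl fun i _ => ?_
  rw [Finset.sum_comm]
  exact Finset.sum_congr rfl fun j _ => Finset.sum_congr rfl fun d _ => by ring

/-- The slope of the regression of `t / u` on covariates and additive effects. -/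
def slope (Z : Fin n → Fin n → Fin p → ℝ) (u : Fin n → Fin n → ℝ) :
    (Fin n → Fin n → ℝ) →ₗ[ℝ] (Fin p → ℝ) :=
  (residGram Z u)⁻¹.mulVecLin ∘ₗ
    { toFun := fun t c => offSum fun i j => residCov Z u c i j * t i j
      map_add' := fun t t' => by
        funext c
        rw [Pi.add_apply, ← offSum_add]
        simp only [Pi.add_apply, mul_add]
      map_smul' := fun r t => by
        funext c
        rw [RingHom.id_apply, Pi.smul_apply, smul_eq_mul, ← offSum_mul_left]
        simp only [Pi.smul_apply, smul_eq_mul, mul_left_comm] }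

/-- The solution operator of the linearized score equations: `y = linSolve Z u t` is the change of
parameters for which the first-order change `u * edgePred Z y` of the rates has the same row sums,
column sums and covariate sums as `t`. The slope is found first, from the residual covariates, and
its contribution is then removed from the additive fit of `t`. -/
def linSolve (Z : Fin n → Fin n → Fin p → ℝ) (u : Fin n → Fin n → ℝ) :
    (Fin n → Fin n → ℝ) →ₗ[ℝ] (Fin (2 * n - 1) → ℝ) × (Fin p → ℝ) where
  toFun t := (fit u t - fit u fun i j => u i j * (Z i j ⬝ᵥ slope Z u t), slope Z u t)
  map_add' t t' := by
    have : (fun i j => u i j * (Z i j ⬝ᵥ slope Z u (t + t')))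
        = (fun i j => u i j * (Z i j ⬝ᵥ slope Z u t))
          + fun i j => u i j * (Z i j ⬝ᵥ slope Z u t') := by
      funext i j
      simp [dotProduct_add, mul_add]
    rw [this, map_add, map_add, map_add, Prod.mk_add_mk, add_sub_add_comm]
  map_smul' r t := by
    have : (fun i j => u i j * (Z i j ⬝ᵥ slope Z u (r • t)))
        = r • (fun i j => u i j * (Z i j ⬝ᵥ slope Z u t)) := by
      funext i j
      simp [mul_left_comm]
    rw [this, map_smul, map_smul, map_smul, RingHom.id_apply, Prod.smul_mk, smul_sub]

/-- The first-order change of the logarithm of the rate of an edge. -/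
def edgePred (Z : Fin n → Fin n → Fin p → ℝ) (x : (Fin (2 * n - 1) → ℝ) × (Fin p → ℝ))
    (i j : Fin n) : ℝ :=
  linPred x.1 i j + Z i j ⬝ᵥ x.2

lemma edgePred_sub (Z : Fin n → Fin n → Fin p → ℝ) (x y : (Fin (2 * n - 1) → ℝ) × (Fin p → ℝ))
    (i j : Fin n) : edgePred Z (x - y) i j = edgePred Z x i j - edgePred Z y i j := by
  simp only [edgePred, Prod.fst_sub, Prod.snd_sub, linPred_sub, dotProduct_sub]
  ring

lemma abs_dotProduct_le {z g : Fin p → ℝ} {B G : ℝ} (hz : ∀ c, |z c| ≤ B) (hg : ∀ c, |g c| ≤ G) :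
    |z ⬝ᵥ g| ≤ p * B * G := by
  refine (Finset.abs_sum_le_sum_abs _ _).trans ?_
  refine (Finset.sum_le_card_nsmul _ _ (B * G) fun c _ => ?_).trans ?_
  · rw [abs_mul]
    exact mul_le_mul (hz c) (hg c) (abs_nonneg _) ((abs_nonneg _).trans (hz c))
  · simp [mul_assoc]

lemma edgePred_linSolve (Z : Fin n → Fin n → Fin p → ℝ) (u t : Fin n → Fin n → ℝ) (i j : Fin n) :
    edgePred Z (linSolve Z u t) i j = linPred (fit u t) i j
      + (Z i j ⬝ᵥ slope Z u t
        - linPred (fit u fun i j => u i j * (Z i j ⬝ᵥ slope Z u t)) i j) := by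
  change linPred (_ - _) i j + Z i j ⬝ᵥ slope Z u t = _
  rw [linPred_sub]
  ring

lemma biSum_edgePred_linSolve (hb : IsBalanced u E) (t : Fin n → Fin n → ℝ) :
    biSum (fun i j => u i j * edgePred Z (linSolve Z u t) i j) = biSum t := by
  simp only [edgePred_linSolve, mul_add, mul_sub]
  rw [biSum_add, biSum_sub, hb.biSum_fit, hb.biSum_fit, sub_self, add_zero]

lemma IsRegular.offSum_edgePred_linSolve (hb : IsRegular Z u E B η) (t : Fin n → Fin n → ℝ)
    (c : Fin p) :
    offSum (fun i j => Z i j c * (u i j * edgePred Z (linSolve Z u t) i j))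
      = offSum fun i j => Z i j c * t i j := by
  simp only [edgePred_linSolve, mul_add]
  rw [offSum_add, ← residGram_mulVec]
  have h1 : residGram Z u *ᵥ slope Z u t
      = fun c => offSum fun i j => residCov Z u c i j * t i j := by
    change residGram Z u *ᵥ ((residGram Z u)⁻¹ *ᵥ _) = _
    rw [Matrix.mulVec_mulVec, Matrix.mul_nonsing_inv _ hb.isUnit_det_residGram, Matrix.one_mulVec]
    rfl
  have h2 := hb.offSum_mul_linPred_fit_comm t (fun i j => u i j * Z i j c)
  rw [h1]
  simp only [residCov, sub_mul]
  rw [offSum_sub, show offSum (fun i j =>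
      linPred (fit u fun i j => u i j * Z i j c) i j * t i j)
      = offSum (fun i j => t i j * linPred (fit u fun i j => u i j * Z i j c) i j) from
    offSum_congr fun i j _ => mul_comm _ _, h2]
  rw [show offSum (fun i j => Z i j c * (u i j * linPred (fit u t) i j))
      = offSum (fun i j => u i j * Z i j c * linPred (fit u t) i j) from
    offSum_congr fun i j _ => by ring]
  ring

/-- The linearized score equations have only the trivial homogeneous solution. -/
lemma IsRegular.eq_zero_of_edgePred (hb : IsRegular Z u E B η)
    {x : (Fin (2 * n - 1) → ℝ) × (Fin p → ℝ)}
    (h : ∀ i j, i ≠ j → edgePred Z x i j = 0) : x = 0 := by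
  have h1 : x.1 = - fit u fun i j => u i j * (Z i j ⬝ᵥ x.2) := by
    rw [← map_neg, ← hb.fit_weighted_linPred x.1]
    refine fit_congr fun i j hij => ?_
    have := h i j hij
    rw [edgePred] at this
    rw [Pi.neg_apply, Pi.neg_apply, ← mul_neg, eq_neg_of_add_eq_zero_left this]
  have h2 : residGram Z u *ᵥ x.2 = 0 := by
    funext c
    rw [residGram_mulVec]
    have : offSum (fun _ _ : Fin n => (0 : ℝ)) = 0 := by simp [offSum]
    rw [Pi.zero_apply, ← this]
    refine offSum_congr fun i j hij => ?_
    have h3 := h i j hij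
    have h4 : linPred x.1 i j = - linPred (fit u fun i j => u i j * (Z i j ⬝ᵥ x.2)) i j := by
      rw [h1, ← neg_one_smul ℝ, linPred_smul, neg_one_mul]
    rw [edgePred, h4] at h3
    rw [sub_eq_neg_add, h3, mul_zero, mul_zero]
  have h3 : x.2 = 0 := by
    have := congrArg ((residGram Z u)⁻¹ *ᵥ ·) h2
    simpa only [Matrix.mulVec_mulVec, Matrix.nonsing_inv_mul _ hb.isUnit_det_residGram,
      Matrix.one_mulVec, Matrix.mulVec_zero] using this
  have h4 : x.1 = 0 := by
    rw [h1, h3]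
    have : (fun i j => u i j * (Z i j ⬝ᵥ (0 : Fin p → ℝ))) = 0 := by
      funext i j; simp
    rw [this, map_zero, neg_zero]
  exact Prod.ext h4 h3

/-! ### Bounds for the linearized solution -/

lemma IsRegular.B_pos (hb : IsRegular Z u E B η) : 0 < B := by linarith [hb.one_le_B]

lemma IsRegular.abs_residCov_le (hb : IsRegular Z u E B η) (c : Fin p) {i j : Fin n}
    (hij : i ≠ j) : |residCov Z u c i j| ≤ 10 * B * E ^ 2 := by
  have h1 : |linPred (fit u fun i j => u i j * Z i j c) i j| ≤ 9 * E ^ 2 * B :=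
    hb.abs_linPred_fit_le (fun i j hij => by
      rw [abs_mul, abs_of_pos (hb.pos hij), mul_comm]
      exact mul_le_mul_of_nonneg_right (hb.cov_le i j hij c) (hb.pos hij).le) i j
  have h2 : 1 ≤ E ^ 2 := one_le_pow₀ hb.one_le
  have h3 := hb.cov_le i j hij c
  have h4 : |residCov Z u c i j|
      ≤ |Z i j c| + |linPred (fit u fun i j => u i j * Z i j c) i j| := abs_sub _ _
  nlinarith [hb.B_pos]

/-- The inverse profile information cannot be too small, because the profile information is at most
of order `n² E³`. -/
lemma IsRegular.one_le_mul_eta (hb : IsRegular Z u E B η) :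
    1 ≤ 10 * B ^ 2 * E ^ 3 * ((n : ℝ) ^ 2 * η) := by
  have hE := hb.pos_E
  have hB := hb.B_pos
  let c : Fin p := ⟨0, hb.one_le_p⟩
  have h1 : ∀ d, |residGram Z u d c| ≤ (n : ℝ) ^ 2 * (10 * B ^ 2 * E ^ 3) := by
    intro d
    rw [residGram, Matrix.of_apply]
    refine abs_offSum_le (by positivity) fun i j hij => ?_
    rw [abs_mul, abs_mul, abs_of_pos (hb.pos hij)]
    calc |Z i j d| * (u i j * |residCov Z u c i j|) ≤ B * (E * (10 * B * E ^ 2)) := by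
          have := (hb.pos hij).le
          gcongr
          · exact hb.cov_le i j hij d
          · exact hb.upper i j hij
          · exact hb.abs_residCov_le c hij
      _ = 10 * B ^ 2 * E ^ 3 := by ring
  have h2 := abs_mulVec_le_infNorm (residGram Z u)⁻¹ (v := fun d => residGram Z u d c) h1 c
  have h3 : ((residGram Z u)⁻¹ *ᵥ fun d => residGram Z u d c) c
      = ((residGram Z u)⁻¹ * residGram Z u) c c := rfl
  rw [h3, Matrix.nonsing_inv_mul _ hb.isUnit_det_residGram, Matrix.one_apply_eq, abs_one] at h2
  refine h2.trans ?_
  calc infNorm (residGram Z u)⁻¹ * ((n : ℝ) ^ 2 * (10 * B ^ 2 * E ^ 3))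
      ≤ η * ((n : ℝ) ^ 2 * (10 * B ^ 2 * E ^ 3)) := by
        gcongr; exact hb.infNorm_le
    _ = _ := by ring

lemma IsRegular.eta_pos (hb : IsRegular Z u E B η) : 0 < (n : ℝ) ^ 2 * η := by
  have h := hb.one_le_mul_eta
  have hE := hb.pos_E
  have hB := hb.B_pos
  by_contra hc
  push Not at hc
  have : 10 * B ^ 2 * E ^ 3 * ((n : ℝ) ^ 2 * η) ≤ 0 :=
    mul_nonpos_of_nonneg_of_nonpos (by positivity) hc
  linarith

lemma IsRegular.abs_slope_le (hb : IsRegular Z u E B η) {t : Fin n → Fin n → ℝ} {D : ℝ}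
    (hD : ∀ c, |offSum fun i j => residCov Z u c i j * t i j| ≤ D) (c : Fin p) :
    |slope Z u t c| ≤ η * D := by
  refine (abs_mulVec_le_infNorm _ hD c).trans ?_
  have : 0 ≤ D := (abs_nonneg _).trans (hD c)
  gcongr
  exact hb.infNorm_le

lemma IsRegular.abs_linPred_fit_cov_le (hb : IsRegular Z u E B η) {g : Fin p → ℝ} {G : ℝ}
    (hg : ∀ c, |g c| ≤ G) (i j : Fin n) :
    |linPred (fit u fun i j => u i j * (Z i j ⬝ᵥ g)) i j| ≤ 9 * E ^ 2 * (p * B * G) :=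
  hb.abs_linPred_fit_le (fun i j hij => by
    rw [abs_mul, abs_of_pos (hb.pos hij), mul_comm]
    exact mul_le_mul_of_nonneg_right (abs_dotProduct_le (hb.cov_le i j hij) hg)
      (hb.pos hij).le) i j

/-- The bound for noise, whose row sums, column sums and pairings with residual covariates are much
smaller than its entries suggest. -/
lemma IsRegular.norm_linSolve_le_of_bounds (hb : IsRegular Z u E B η) {t : Fin n → Fin n → ℝ}
    {ε D : ℝ} (hr : ∀ i, |rowSum t i| ≤ ε * rowSum u i)
    (hc : ∀ j, |colSum t j| ≤ ε * colSum u j)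
    (hD : ∀ c, |offSum fun i j => residCov Z u c i j * t i j| ≤ D) :
    ‖linSolve Z u t‖ ≤ 18 * E ^ 2 * ε + 19 * p * B * E ^ 2 * (η * D) := by
  have hE := hb.pos_E
  have hB := hb.B_pos
  have hn := hb.three_le
  have hs := hb.abs_slope_le hD
  have hG : 0 ≤ η * D := (abs_nonneg _).trans (hs ⟨0, hb.one_le_p⟩)
  have hε : 0 ≤ ε := nonneg_of_mul_nonneg_left ((abs_nonneg _).trans (hr ⟨0, by omega⟩))
    (hb.rowSum_pos _)
  have hp : (1 : ℝ) ≤ p := by exact_mod_cast hb.one_le_p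
  have hE2 : 1 ≤ E ^ 2 := one_le_pow₀ hb.one_le
  have h1 : 1 ≤ p * B * E ^ 2 := by
    have := mul_le_mul hp hb.one_le_B zero_le_one (by positivity)
    have := mul_le_mul this hE2 zero_le_one (by positivity)
    linarith
  rw [Prod.norm_def]
  refine max_le ?_ ?_
  · rw [pi_norm_le_iff_of_nonneg (by positivity)]
    intro l
    have h2 : ∀ i j : Fin n, |linPred (linSolve Z u t).1 i j|
        ≤ 9 * E ^ 2 * ε + 9 * E ^ 2 * (p * B * (η * D)) := by
      intro i j
      change |linPred (_ - _) i j| ≤ _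
      rw [linPred_sub]
      exact (abs_sub _ _).trans (add_le_add (hb.abs_linPred_fit_le_of_sums hr hc i j)
        (hb.abs_linPred_fit_cov_le hs i j))
    refine (abs_le_of_linPred_le h2 l).trans ?_
    have : 0 ≤ p * B * E ^ 2 * (η * D) := by positivity
    linarith
  · rw [pi_norm_le_iff_of_nonneg (by positivity)]
    intro c
    refine (hs c).trans ?_
    have h3 : 0 ≤ 18 * E ^ 2 * ε := by positivity
    nlinarith

/-- The bound for arrays of which only the size of the entries is known; it is applied to the
second-order remainder. -/
lemma IsRegular.norm_linSolve_le (hb : IsRegular Z u E B η) {t : Fin n → Fin n → ℝ} {τ : ℝ}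
    (hτ : 0 ≤ τ) (ht : ∀ i j, i ≠ j → |t i j| ≤ τ) :
    ‖linSolve Z u t‖ ≤ 370 * p * B ^ 2 * E ^ 6 * ((n : ℝ) ^ 2 * η) * τ := by
  have hE := hb.pos_E
  have hB := hb.B_pos
  have hE1 := hb.one_le
  have hp : (1 : ℝ) ≤ p := by exact_mod_cast hb.one_le_p
  have hk := hb.eta_pos
  have ht' : ∀ i j, i ≠ j → |t i j| ≤ E * τ * u i j := by
    intro i j hij
    refine (ht i j hij).trans ?_
    calc τ = E * τ * E⁻¹ := by field_simp
      _ ≤ E * τ * u i j := by gcongr; exact hb.lower i j hij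
  have h := hb.norm_linSolve_le_of_bounds (t := t) (ε := E * τ)
    (D := (n : ℝ) ^ 2 * (10 * B * E ^ 2 * τ))
    (fun i => by
      rw [rowSum, rowSum, Finset.mul_sum]
      exact (Finset.abs_sum_le_sum_abs _ _).trans
        (Finset.sum_le_sum fun j hj => ht' i j (Finset.ne_of_mem_erase hj).symm))
    (fun j => by
      rw [colSum, colSum, Finset.mul_sum]
      exact (Finset.abs_sum_le_sum_abs _ _).trans
        (Finset.sum_le_sum fun i hi => ht' i j (Finset.ne_of_mem_erase hi)))
    (fun c => abs_offSum_le (by positivity) fun i j hij => by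
      rw [abs_mul]
      exact mul_le_mul (hb.abs_residCov_le c hij) (ht i j hij) (abs_nonneg _) (by positivity))
  refine h.trans ?_
  have h1 := hb.one_le_mul_eta
  set K := (n : ℝ) ^ 2 * η with hK
  have e1 : 18 * E ^ 2 * (E * τ) ≤ 180 * (p * B ^ 2 * E ^ 6 * K * τ) := by
    calc 18 * E ^ 2 * (E * τ) = 18 * E ^ 3 * τ * 1 := by ring
      _ ≤ 18 * E ^ 3 * τ * (10 * B ^ 2 * E ^ 3 * K) := by gcongr
      _ = 180 * (1 * B ^ 2 * E ^ 6 * K * τ) := by ring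
      _ ≤ _ := by gcongr
  have e2 : 19 * p * B * E ^ 2 * (η * ((n : ℝ) ^ 2 * (10 * B * E ^ 2 * τ)))
      ≤ 190 * (p * B ^ 2 * E ^ 6 * K * τ) := by
    calc _ = 190 * (p * B ^ 2 * E ^ 4 * K * τ) := by rw [hK]; ring
      _ ≤ _ := by
        have hE46 : E ^ 4 ≤ E ^ 6 := pow_le_pow_right₀ hE1 (by norm_num)
        gcongr 190 * (p * B ^ 2 * ?_ * K * τ)
  linarith

end Solve

/-! ### Existence, localization and uniqueness of the estimate -/

/-- A map that contracts a closed ball around `0` by the factor `1 / 2`, and moves the centre by at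
most half the radius, has a fixed point in that ball. -/
lemma exists_fixedPoint_closedBall {X : Type*} [NormedAddCommGroup X] [CompleteSpace X]
    {f : X → X} {δ : ℝ} (hδ : 0 ≤ δ) (h0 : ‖f 0‖ ≤ δ / 2)
    (hf : ∀ x y, ‖x‖ ≤ δ → ‖y‖ ≤ δ → ‖f x - f y‖ ≤ 1 / 2 * ‖x - y‖) :
    ∃ x, ‖x‖ ≤ δ ∧ f x = x := by
  have hmaps : Set.MapsTo f (Metric.closedBall 0 δ) (Metric.closedBall 0 δ) := by
    intro x hx
    rw [mem_closedBall_zero_iff] at hx ⊢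
    have h1 := hf x 0 hx (by simpa using hδ)
    rw [sub_zero] at h1
    have h2 : ‖f x‖ ≤ ‖f x - f 0‖ + ‖f 0‖ := by simpa using norm_add_le (f x - f 0) (f 0)
    linarith
  have hc : ContractingWith (1 / 2) (hmaps.restrict f _ _) := by
    refine ⟨by rw [← NNReal.coe_lt_coe]; norm_num, LipschitzWith.of_dist_le_mul fun x y => ?_⟩
    have hx := mem_closedBall_zero_iff.1 x.2
    have hy := mem_closedBall_zero_iff.1 y.2
    simpa [Subtype.dist_eq, dist_eq_norm] using hf x y hx hy
  obtain ⟨x, hx, hfx, -⟩ := hc.exists_fixedPoint' (Metric.isClosed_closedBall.isComplete) hmaps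
    (x := 0) (by simpa using hδ) (edist_ne_top _ _)
  exact ⟨x, by simpa using hx, hfx⟩

/-- The second-order remainder of the exponential is Lipschitz with a small constant near `0`. -/
lemma abs_exp_remainder_sub_le {z w D : ℝ} (hD : D ≤ 1) (hz : |z| ≤ D) (hw : |w| ≤ D) :
    |(Real.exp z - 1 - z) - (Real.exp w - 1 - w)| ≤ 2 * D * |z - w| := by
  have h := (convex_Icc (-D) D).norm_image_sub_le_of_norm_hasDerivWithin_le
    (f := fun x => Real.exp x - 1 - x) (f' := fun x => Real.exp x - 1) (C := 2 * D)
    (fun x _ => (((Real.hasDerivAt_exp x).sub_const 1).sub (hasDerivAt_id x)).hasDerivWithinAt)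
    (fun x hx => by
      have hx' : |x| ≤ D := abs_le.2 hx
      have := Real.abs_exp_sub_one_le (hx'.trans hD)
      rw [Real.norm_eq_abs]
      linarith)
    (abs_le.1 hw) (abs_le.1 hz)
  simpa [Real.norm_eq_abs] using h

section MLE

variable {n p : ℕ} {Z : Fin n → Fin n → Fin p → ℝ} {θ : Fin (2 * n - 1) → ℝ} {γ : Fin p → ℝ}
  {E B η : ℝ}

lemma rate_pos (Z : Fin n → Fin n → Fin p → ℝ) (θ : Fin (2 * n - 1) → ℝ) (γ : Fin p → ℝ)
    (i j : Fin n) : 0 < rate Z θ γ i j :=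
  Real.exp_pos _

lemma rate_add (Z : Fin n → Fin n → Fin p → ℝ) (θ : Fin (2 * n - 1) → ℝ) (γ : Fin p → ℝ)
    (x : (Fin (2 * n - 1) → ℝ) × (Fin p → ℝ)) (i j : Fin n) :
    rate Z (θ + x.1) (γ + x.2) i j = rate Z θ γ i j * Real.exp (edgePred Z x i j) := by
  have h := linPred_add θ x.1 i j
  unfold linPred at h
  rw [rate, rate, ← Real.exp_add, h, edgePred, linPred, dotProduct_add]
  ring_nf

lemma isMLE_iff {a : Fin n → Fin n → ℕ} :
    IsMLE Z a θ γ ↔ biSum (rate Z θ γ) = biSum (fun i j => (a i j : ℝ)) ∧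
      ∀ c, offSum (fun i j => Z i j c * rate Z θ γ i j)
        = offSum fun i j => Z i j c * (a i j : ℝ) := by
  have h1 : scoreF Z a θ γ = biSum (rate Z θ γ) - biSum (fun i j => (a i j : ℝ)) := rfl
  have h2 : ∀ c, scoreQ Z a θ γ c = offSum (fun i j => Z i j c * rate Z θ γ i j)
      - offSum fun i j => Z i j c * (a i j : ℝ) := by
    intro c
    rw [← offSum_sub]
    simp only [← mul_sub]
    rfl
  rw [IsMLE, h1, sub_eq_zero, funext_iff (f := scoreQ Z a θ γ)]
  simp only [h2, Pi.zero_apply, sub_eq_zero]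

/-- The solution of the score equations is unique: they are the critical equations of a strictly
concave log-likelihood. -/
lemma IsRegular.isMLE_unique {θ₀ : Fin (2 * n - 1) → ℝ} {γ₀ : Fin p → ℝ}
    (hb : IsRegular Z (rate Z θ₀ γ₀) E B η) {a : Fin n → Fin n → ℕ} {θ' : Fin (2 * n - 1) → ℝ}
    {γ' : Fin p → ℝ} (h : IsMLE Z a θ γ) (h' : IsMLE Z a θ' γ') : θ' = θ := by
  rw [isMLE_iff] at h h'
  set x : (Fin (2 * n - 1) → ℝ) × (Fin p → ℝ) := (θ' - θ, γ' - γ) with hx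
  have hr : ∀ i j, rate Z θ' γ' i j = rate Z θ γ i j * Real.exp (edgePred Z x i j) := by
    intro i j
    rw [← rate_add]
    simp [hx]
  set y : Fin n → Fin n → ℝ := fun i j => rate Z θ' γ' i j - rate Z θ γ i j with hy
  have hF : biSum y = 0 := by rw [hy, biSum_sub, h.1, h'.1, sub_self]
  have hQ : ∀ c, offSum (fun i j => Z i j c * y i j) = 0 := by
    intro c
    simp only [hy, mul_sub]
    rw [offSum_sub, h.2 c, h'.2 c, sub_self]
  -- the difference of the scores, paired with the difference of the parameters, vanishes
  have hsum : offSum (fun i j => y i j * edgePred Z x i j) = 0 := by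
    simp only [edgePred, mul_add]
    rw [offSum_add, ← sum_mul_biSum, hF]
    have : offSum (fun i j => y i j * (Z i j ⬝ᵥ x.2))
        = ∑ c, x.2 c * offSum (fun i j => Z i j c * y i j) := by
      simp only [offSum, dotProduct, Finset.mul_sum]
      rw [Finset.sum_comm]
      refine Finset.sum_congr rfl fun i _ => ?_
      rw [Finset.sum_comm]
      exact Finset.sum_congr rfl fun j _ => Finset.sum_congr rfl fun d _ => by ring
    rw [this]
    simp [hQ]
  have hterm : ∀ i j, 0 ≤ y i j * edgePred Z x i j := by
    intro i j
    simp only [hy, hr]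
    have h1 := rate_pos Z θ γ i j
    have h2 : 0 ≤ (Real.exp (edgePred Z x i j) - 1) * edgePred Z x i j := by
      rcases le_total 0 (edgePred Z x i j) with h0 | h0
      · exact mul_nonneg (sub_nonneg.2 (Real.one_le_exp h0)) h0
      · exact mul_nonneg_of_nonpos_of_nonpos (sub_nonpos.2 (Real.exp_le_one_iff.2 h0)) h0
    calc (0 : ℝ) ≤ rate Z θ γ i j * ((Real.exp (edgePred Z x i j) - 1) * edgePred Z x i j) :=
          mul_nonneg h1.le h2
      _ = _ := by ring
  have hzero : ∀ i j, i ≠ j → edgePred Z x i j = 0 := by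
    intro i j hij
    have h1 := (Finset.sum_eq_zero_iff_of_nonneg
      (fun i _ => Finset.sum_nonneg fun j _ => hterm i j)).1 hsum i (Finset.mem_univ _)
    have h2 := (Finset.sum_eq_zero_iff_of_nonneg (fun j _ => hterm i j)).1 h1 j
      (Finset.mem_erase.2 ⟨hij.symm, Finset.mem_univ _⟩)
    rcases mul_eq_zero.1 h2 with h3 | h3
    · simp only [hy, hr] at h3
      have h4 : Real.exp (edgePred Z x i j) = 1 := by
        have h5 : rate Z θ γ i j * (Real.exp (edgePred Z x i j) - 1) = 0 := by linarith
        rcases mul_eq_zero.1 h5 with h6 | h6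
        · exact absurd h6 (rate_pos Z θ γ i j).ne'
        · linarith
      exact (Real.exp_eq_one_iff _).1 h4
    · exact h3
  have := congrArg Prod.fst (hb.eq_zero_of_edgePred hzero)
  exact sub_eq_zero.1 this

lemma IsRegular.abs_edgePred_le {u : Fin n → Fin n → ℝ} (hb : IsRegular Z u E B η)
    (x : (Fin (2 * n - 1) → ℝ) × (Fin p → ℝ)) {i j : Fin n} (hij : i ≠ j) :
    |edgePred Z x i j| ≤ (2 + p * B) * ‖x‖ := by
  have hB := hb.B_pos
  have h1 : |linPred x.1 i j| ≤ 2 * ‖x‖ :=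
    (abs_linPred_le i j).trans (by have := norm_fst_le x; linarith)
  have h2 : |Z i j ⬝ᵥ x.2| ≤ p * B * ‖x‖ :=
    abs_dotProduct_le (hb.cov_le i j hij) fun c =>
      (norm_le_pi_norm x.2 c).trans (norm_snd_le x)
  calc |edgePred Z x i j| ≤ |linPred x.1 i j| + |Z i j ⬝ᵥ x.2| := abs_add_le _ _
    _ ≤ _ := by linarith

/-- If the solution of the linearized score equations is small, then the score equations have a
solution, and it differs from the linearized one by a quadratic term. The score equations are
rewritten as a fixed point equation for `linSolve`, to which Banach's theorem applies. -/
theorem IsRegular.exists_isMLE (hb : IsRegular Z (rate Z θ γ) E B η) (a : Fin n → Fin n → ℕ)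
    {δ Λ : ℝ} (hδ : 0 ≤ δ) (hΛ0 : 0 ≤ Λ)
    (hΛ : ∀ (t : Fin n → Fin n → ℝ) (τ : ℝ), 0 ≤ τ → (∀ i j, i ≠ j → |t i j| ≤ τ) →
      ‖linSolve Z (rate Z θ γ) t‖ ≤ Λ * τ)
    (hδ1 : (2 + p * B) * δ ≤ 1) (hδ2 : 2 * (2 + p * B) ^ 2 * E * Λ * δ ≤ 1 / 2)
    (hx : ‖linSolve Z (rate Z θ γ) fun i j => a i j - rate Z θ γ i j‖ ≤ δ / 2) :
    ∃ x : (Fin (2 * n - 1) → ℝ) × (Fin p → ℝ), IsMLE Z a (θ + x.1) (γ + x.2) ∧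
      ‖x - linSolve Z (rate Z θ γ) fun i j => a i j - rate Z θ γ i j‖
        ≤ 2 * (2 + p * B) ^ 2 * E * Λ * δ ^ 2 := by
  set u := rate Z θ γ with hu
  set L : ℝ := 2 + p * B with hL
  have hB := hb.B_pos
  have hE := hb.pos_E
  have hL0 : 0 ≤ L := by positivity
  let t₀ : Fin n → Fin n → ℝ := fun i j => a i j - u i j
  let s : (Fin (2 * n - 1) → ℝ) × (Fin p → ℝ) → Fin n → Fin n → ℝ := fun x i j =>
    u i j * (Real.exp (edgePred Z x i j) - 1 - edgePred Z x i j)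
  let f : (Fin (2 * n - 1) → ℝ) × (Fin p → ℝ) → (Fin (2 * n - 1) → ℝ) × (Fin p → ℝ) := fun x =>
    linSolve Z u (t₀ - s x)
  have hlip : ∀ x y, ‖x‖ ≤ δ → ‖y‖ ≤ δ → ‖f x - f y‖ ≤ 2 * L ^ 2 * E * Λ * δ * ‖x - y‖ := by
    intro x y hx hy
    have h1 : f x - f y = linSolve Z u (s y - s x) := by
      simp only [f]
      rw [← map_sub]
      congr 1
      abel
    have h2 : ∀ x, ‖x‖ ≤ δ → ∀ i j, i ≠ j → |edgePred Z x i j| ≤ L * δ := fun x hx i j hij =>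
      (hb.abs_edgePred_le x hij).trans (by gcongr)
    rw [h1]
    refine (hΛ _ (E * (2 * (L * δ) * (L * ‖x - y‖))) (by positivity) ?_).trans (le_of_eq (by ring))
    intro i j hij
    simp only [s, Pi.sub_apply]
    rw [← mul_sub, abs_mul, abs_of_pos (hb.pos hij)]
    have h3 := abs_exp_remainder_sub_le hδ1 (h2 y hy i j hij) (h2 x hx i j hij)
    have h4 : |edgePred Z y i j - edgePred Z x i j| ≤ L * ‖x - y‖ := by
      rw [← edgePred_sub, norm_sub_rev]
      exact hb.abs_edgePred_le _ hij
    refine mul_le_mul (hb.upper i j hij) (h3.trans ?_) (abs_nonneg _) hE.le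
    gcongr
  have hs0 : s 0 = 0 := by
    funext i j
    have : edgePred Z 0 i j = 0 := by
      have := edgePred_sub Z 0 0 i j
      rwa [sub_zero, sub_self] at this
    simp [s, this]
  have hf0 : f 0 = linSolve Z u t₀ := by simp only [f, hs0, sub_zero]
  obtain ⟨x, hxδ, hfx⟩ := exists_fixedPoint_closedBall (f := f) hδ (by rw [hf0]; exact hx)
    (fun x y hx hy => (hlip x y hx hy).trans (by gcongr))
  refine ⟨x, ?_, ?_⟩
  · have hrate : ∀ i j, rate Z (θ + x.1) (γ + x.2) i j
        = u i j + (u i j * edgePred Z x i j + s x i j) := by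
      intro i j
      rw [rate_add]
      simp only [s]
      ring
    have hF := biSum_edgePred_linSolve (Z := Z) hb.toIsBalanced (t₀ - s x)
    have hQ := hb.offSum_edgePred_linSolve (t₀ - s x)
    change biSum (fun i j => u i j * edgePred Z (f x) i j) = _ at hF
    rw [hfx] at hF
    rw [isMLE_iff]
    constructor
    · have h1 : rate Z (θ + x.1) (γ + x.2)
          = fun i j => u i j + (u i j * edgePred Z x i j + s x i j) := by
        funext i j; exact hrate i j
      rw [h1, biSum_add, biSum_add, hF]
      have h2 : biSum (t₀ - s x) = biSum t₀ - biSum (s x) := biSum_sub t₀ (s x)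
      have h3 : biSum t₀ = biSum (fun i j => (a i j : ℝ)) - biSum u := biSum_sub _ _
      rw [h2, h3]
      abel
    · intro c
      have h1 := hQ c
      change offSum (fun i j => Z i j c * (u i j * edgePred Z (f x) i j)) = _ at h1
      rw [hfx] at h1
      simp only [hrate, mul_add]
      rw [offSum_add, offSum_add, h1]
      simp only [t₀, Pi.sub_apply, mul_sub]
      rw [offSum_sub, offSum_sub]
      ring
  · have h1 := hlip x 0 hxδ (by simpa using hδ)
    rw [hfx, hf0, sub_zero] at h1
    refine h1.trans ?_
    have : 0 ≤ 2 * L ^ 2 * E * Λ * δ := by positivity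
    nlinarith

end MLE

/-! ### The leading term of a sender coordinate -/

/-- The weights of the leading term of the sender effect of `i`, where `l` is the last node: the
sum of `x` against them is `xᵢ. / uᵢ. + x.ₗ / u.ₗ`. -/
def influence {n : ℕ} (u : Fin n → Fin n → ℝ) (l i a b : Fin n) : ℝ :=
  (if a = i then 1 / rowSum u i else 0) + (if b = l then 1 / colSum u l else 0)

/-- The difference between the exact weights of the sender effect of `i` in the additive fit and
their leading term. The exact weights are the additive fit of the indicator of the edge
`(i, l)`. -/
def influenceErr {n : ℕ} (u : Fin n → Fin n → ℝ) (l i a b : Fin n) : ℝ :=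
  linPred (fit u fun a b => if a = i ∧ b = l then 1 else 0) a b - influence u l i a b

section Influence

variable {n : ℕ} {u : Fin n → Fin n → ℝ} {E : ℝ} {l i : Fin n}

lemma offSum_mul_influence (x : Fin n → Fin n → ℝ) :
    offSum (fun a b => x a b * influence u l i a b)
      = rowSum x i / rowSum u i + colSum x l / colSum u l := by
  simp only [influence, mul_add]
  rw [offSum_add, offSum_eq_sum_rowSum, offSum_eq_sum_colSum]
  congr 1
  · rw [Finset.sum_eq_single i]
    · simp [rowSum, div_eq_mul_inv, Finset.sum_mul, -Finset.sum_erase_eq_sub]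
    · intro a _ ha
      simp [rowSum, ha]
    · simp
  · rw [Finset.sum_eq_single l]
    · simp [colSum, div_eq_mul_inv, Finset.sum_mul, -Finset.sum_erase_eq_sub]
    · intro a _ ha
      simp [colSum, ha]
    · simp

lemma offSum_indicator_mul (hil : i ≠ l) (x : Fin n → Fin n → ℝ) :
    offSum (fun a b => (if a = i ∧ b = l then 1 else 0) * x a b) = x i l := by
  rw [offSum, Finset.sum_eq_single i, Finset.sum_eq_single l]
  · simp
  · intro b _ hb; simp [hb]
  · intro h; simp [hil.symm] at h
  · intro a _ ha; simp [ha]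
  · simp

lemma recvPar_last (hl : (l : ℕ) + 1 = n) (θ : Fin (2 * n - 1) → ℝ) : recvPar θ l = 0 := by
  unfold recvPar
  rw [dif_neg]
  omega

/-- The sender effect of the additive fit, split into its leading term and an error term. -/
lemma IsBalanced.sendPar_fit (hb : IsBalanced u E) (hl : (l : ℕ) + 1 = n) (hil : i ≠ l)
    (x : Fin n → Fin n → ℝ) :
    sendPar (fit u x) i = rowSum x i / rowSum u i + colSum x l / colSum u l
      + offSum (fun a b => influenceErr u l i a b * x a b) := by
  have h1 : sendPar (fit u x) i = linPred (fit u x) i l := by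
    rw [linPred, recvPar_last hl, add_zero]
  rw [h1, ← offSum_indicator_mul hil (linPred (fit u x)), hb.offSum_mul_linPred_fit_comm,
    ← offSum_mul_influence, ← offSum_add]
  refine offSum_congr fun a b _ => ?_
  rw [influenceErr]
  ring

lemma IsBalanced.rowSum_mul_influence (hb : IsBalanced u E) (a : Fin n) :
    rowSum (fun a b => u a b * influence u l i a b) a
      = (if a = i then 1 else 0) + if a = l then 0 else u a l / colSum u l := by
    simp only [influence, mul_add]
    rw [rowSum_add]
    congr 1
    · by_cases h : a = i
      · subst h
        simp only [if_true, rowSum, ← Finset.sum_mul]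
        exact mul_one_div_cancel (hb.rowSum_pos a).ne'
      · simp [rowSum, h]
    · rw [rowSum]
      by_cases h : a = l
      · subst h
        rw [if_pos rfl]
        exact Finset.sum_eq_zero fun b hb => by simp [Finset.ne_of_mem_erase hb]
      · rw [if_neg h, Finset.sum_eq_single l]
        · simp [div_eq_mul_inv]
        · intro b _ hb; simp [hb]
        · intro h'; simp [Ne.symm h] at h'

lemma IsBalanced.colSum_mul_influence (hb : IsBalanced u E) (b : Fin n) :
    colSum (fun a b => u a b * influence u l i a b) b
      = (if b = i then 0 else u i b / rowSum u i) + if b = l then 1 else 0 := by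
    simp only [influence, mul_add]
    rw [show colSum (fun a b => u a b * (if a = i then 1 / rowSum u i else 0)
        + u a b * (if b = l then 1 / colSum u l else 0)) b
      = colSum (fun a b => u a b * (if a = i then 1 / rowSum u i else 0)) b
        + colSum (fun a b => u a b * (if b = l then 1 / colSum u l else 0)) b from
      Finset.sum_add_distrib]
    congr 1
    · rw [colSum]
      by_cases h : b = i
      · subst h
        rw [if_pos rfl]
        exact Finset.sum_eq_zero fun b hb => by simp [Finset.ne_of_mem_erase hb]
      · rw [if_neg h, Finset.sum_eq_single i]
        · simp [div_eq_mul_inv]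
        · intro b _ hb; simp [hb]
        · intro h'; simp [Ne.symm h] at h'
    · by_cases h : b = l
      · subst h
        simp only [if_true, colSum, ← Finset.sum_mul]
        exact mul_one_div_cancel (hb.colSum_pos b).ne'
      · simp [colSum, h]

/-- The leading weights solve the normal equations up to residuals of order `E² / n`, so sup-norm
stability applies to the error. -/
lemma IsBalanced.abs_influenceErr_le (hb : IsBalanced u E) (hil : i ≠ l) (a b : Fin n) :
    |influenceErr u l i a b| ≤ 36 * E ^ 5 / (n : ℝ) ^ 2 := by
  have hE := hb.pos_E
  have hn3 := hb.three_le_cast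
  have hn1 : (0 : ℝ) < n - 1 := by linarith
  set e : Fin n → Fin n → ℝ := fun a b => if a = i ∧ b = l then 1 else 0 with he
  set α : Fin n → ℝ := fun a => sendPar (fit u e) a - if a = i then 1 / rowSum u i else 0 with hα
  set β : Fin n → ℝ := fun b => recvPar (fit u e) b - if b = l then 1 / colSum u l else 0 with hβ
  have hsplit : ∀ a b, influenceErr u l i a b = α a + β b := by
    intro a b
    rw [influenceErr, influence, hα, hβ, linPred]
    ring
  have hquot : ∀ x s : ℝ, 0 ≤ x → x ≤ E → (n - 1) * E⁻¹ ≤ s → x / s ≤ E ^ 2 / (n - 1) := by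
    intro x s hx hxE hs
    have : 0 < (n - 1) * E⁻¹ := by positivity
    calc x / s ≤ E / ((n - 1) * E⁻¹) := by gcongr
      _ = E ^ 2 / (n - 1) := by field_simp
  have hres : ∀ s : ℝ, (n - 1) * E⁻¹ ≤ s → E ^ 2 / (n - 1) ≤ E ^ 3 / (n - 1) ^ 2 * s := by
    intro s hs
    calc E ^ 2 / (n - 1) = E ^ 3 / (n - 1) ^ 2 * ((n - 1) * E⁻¹) := by field_simp
      _ ≤ _ := by gcongr
  have hmul : ∀ a b, u a b * (α a + β b) = u a b * linPred (fit u e) a b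
      - u a b * influence u l i a b := by
    intro a b
    rw [← hsplit, influenceErr]
    ring
  have hrow : ∀ a, |rowSum (fun a b => u a b * (α a + β b)) a|
      ≤ E ^ 3 / (n - 1) ^ 2 * rowSum u a := by
    intro a
    refine le_trans ?_ (hres _ (hb.le_rowSum a))
    have h1 : rowSum e a = if a = i then 1 else 0 := by
      rw [rowSum]
      by_cases h : a = i
      · subst h
        rw [Finset.sum_eq_single l]
        · simp [he]
        · intro b _ hb; simp [he, hb]
        · intro h; simp [hil.symm] at h
      · simp [he, h]
    have h2 := hb.rowSum_mul_influence (l := l) (i := i) a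
    simp only [hmul]
    rw [rowSum_sub, rowSum_eq_of_biSum_eq (hb.biSum_fit e), h1, h2]
    by_cases h : a = l
    · simp only [h, if_true]
      simp only [add_zero, sub_self, abs_zero]
      positivity
    · rw [if_neg h, sub_add_cancel_left, abs_neg,
        abs_of_nonneg (div_nonneg (hb.pos h).le (hb.colSum_pos l).le)]
      exact hquot _ _ (hb.pos h).le (hb.upper _ _ h) (hb.le_colSum l)
  have hcol : ∀ b, |colSum (fun a b => u a b * (α a + β b)) b|
      ≤ E ^ 3 / (n - 1) ^ 2 * colSum u b := by
    intro b
    refine le_trans ?_ (hres _ (hb.le_colSum b))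
    have h1 : colSum e b = if b = l then 1 else 0 := by
      rw [colSum]
      by_cases h : b = l
      · subst h
        rw [Finset.sum_eq_single i]
        · simp [he]
        · intro b _ hb; simp [he, hb]
        · intro h; simp [hil] at h
      · simp [he, h]
    have h2 := hb.colSum_mul_influence (l := l) (i := i) b
    simp only [hmul]
    rw [colSum_sub, colSum_eq_of_biSum_eq (hb.biSum_fit e), h1, h2]
    by_cases h : b = i
    · simp only [h, if_true]
      simp only [zero_add, sub_self, abs_zero]
      positivity
    · rw [if_neg h, sub_add_cancel_right, abs_neg,
        abs_of_nonneg (div_nonneg (hb.pos (Ne.symm h)).le (hb.rowSum_pos i).le)]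
      exact hquot _ _ (hb.pos (Ne.symm h)).le (hb.upper _ _ (Ne.symm h)) (hb.le_rowSum i)
  rw [hsplit]
  refine (abs_add_le_of_weighted_means hb.three_le hb.one_le hb.lower hb.upper hrow hcol a b).trans
    ?_
  have h4 : (n : ℝ) ^ 2 ≤ 4 * (n - 1) ^ 2 := by nlinarith
  calc 9 * E ^ 2 * (E ^ 3 / (n - 1) ^ 2) = 36 * E ^ 5 / (4 * (n - 1) ^ 2) := by
        field_simp; norm_num
    _ ≤ _ := by gcongr

end Influence

/-! ### The expansion of the estimate on the event where the noise is small -/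

section Expansion

variable {n p : ℕ} {Z : Fin n → Fin n → Fin p → ℝ} {θ : Fin (2 * n - 1) → ℝ} {γ : Fin p → ℝ}
  {E B η : ℝ}

set_option maxHeartbeats 400000 in
/-- If the relevant linear functionals of the noise are at most `3 E ℓ` times the size of their
weights, then the score equations have a solution near the truth, whose first coordinates are
the leading terms up to an error which is small compared to `1 / (E √n)`. -/
theorem IsRegular.exists_isMLE_expansion (hb : IsRegular Z (rate Z θ γ) E B η)
    (a : Fin n → Fin n → ℕ) {ℓ : ℝ} (hℓ : 1 ≤ ℓ)
    (hW : 10 ^ 11 * (p * B) ^ 8 * ((n : ℝ) ^ 2 * η * E ^ 23 * ℓ ^ 2 / √n) ≤ 1)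
    {x : Fin n → Fin n → ℝ} (hxa : x = fun i j => a i j - rate Z θ γ i j)
    (hr : ∀ i, |rowSum x i| ≤ 3 * E * √n * ℓ) (hc : ∀ j, |colSum x j| ≤ 3 * E * √n * ℓ)
    (hD : ∀ c, |offSum fun i j => residCov Z (rate Z θ γ) c i j * x i j|
      ≤ 3 * E * (n * (10 * B * E ^ 2)) * ℓ) :
    ∃ y : (Fin (2 * n - 1) → ℝ) × (Fin p → ℝ), IsMLE Z a (θ + y.1) (γ + y.2) ∧
      ∀ l i : Fin n, (l : ℕ) + 1 = n → i ≠ l →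
        |offSum fun a b => influenceErr (rate Z θ γ) l i a b * x a b|
          ≤ 3 * E * (n * (36 * E ^ 5 / (n : ℝ) ^ 2)) * ℓ →
        |sendPar y.1 i - (rowSum x i / rowSum (rate Z θ γ) i
            + colSum x l / colSum (rate Z θ γ) l)| * (E * √n)
          ≤ 10 ^ 11 * (p * B) ^ 8 * ((n : ℝ) ^ 2 * η * E ^ 23 * ℓ ^ 2 / √n) := by
  set u := rate Z θ γ with hu
  have hE := hb.pos_E
  have hE1 := hb.one_le
  have hB1 := hb.one_le_B
  have hB := hb.B_pos
  have hp : (1 : ℝ) ≤ p := by exact_mod_cast hb.one_le_p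
  have hn3 := hb.three_le_cast
  have hκ0 := hb.eta_pos
  have hκ1 := hb.one_le_mul_eta
  set κ := (n : ℝ) ^ 2 * η with hκ
  set s := √(n : ℝ) with hs
  have hs0 : 0 < s := Real.sqrt_pos.2 (by linarith)
  have hns : (n : ℝ) = s ^ 2 := (Real.sq_sqrt (by linarith)).symm
  have hη : η = κ / s ^ 4 := by rw [hκ, hns]; field_simp
  set q := (p : ℝ) * B with hq
  have hq1 : 1 ≤ q := by
    have := mul_le_mul hp hB1 zero_le_one (by positivity); rwa [one_mul] at this
  have hBq : B ≤ q := by rw [hq]; nlinarith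
  have hq0 : 0 < q := by linarith
  have hpB : p * B ^ 2 ≤ q ^ 2 := by
    have : p * B ^ 2 = q * B := by rw [hq]; ring
    rw [this, sq]; gcongr
  have hℓ0 : 0 < ℓ := by linarith
  -- all error terms are multiples of `W`, which is small
  set W := κ * E ^ 23 * ℓ ^ 2 / s with hWdef
  have hW0 : 0 < W := by positivity
  -- monomials linear in `κ`, with lower powers of `E` and `ℓ` than in `W`
  have hmon : ∀ m r : ℕ, m ≤ 23 → r ≤ 2 → κ * E ^ m * ℓ ^ r / s ≤ W := by
    intro m r hm hr
    rw [hWdef]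
    gcongr
  -- monomials without `κ`, at the cost of three powers of `E` by the lower bound for `κ`
  have hmon0 : ∀ m r : ℕ, m ≤ 20 → r ≤ 2 → E ^ m * ℓ ^ r / s ≤ 10 * q ^ 2 * W := by
    intro m r hm hr
    calc E ^ m * ℓ ^ r / s = E ^ m * ℓ ^ r / s * 1 := by ring
      _ ≤ E ^ m * ℓ ^ r / s * (10 * B ^ 2 * E ^ 3 * κ) := by gcongr
      _ = 10 * B ^ 2 * (κ * E ^ (m + 3) * ℓ ^ r / s) := by ring
      _ ≤ 10 * q ^ 2 * W := by
        gcongr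
        exact hmon _ _ (by omega) hr
  have hqpow : ∀ m : ℕ, m ≤ 8 → q ^ m ≤ q ^ 8 := fun m hm => pow_le_pow_right₀ hq1 hm
  have hsmall : ∀ (c : ℝ) (m : ℕ), 0 ≤ c → c ≤ 10 ^ 11 → m ≤ 8 → c * q ^ m * W ≤ 1 := by
    intro c m hc0 hc hm
    refine le_trans ?_ hW
    gcongr
  -- the row and column sums of the noise, relative to those of the weights
  have hε : ∀ t : ℝ, (n - 1) * E⁻¹ ≤ t → 3 * E * s * ℓ ≤ 6 * E ^ 2 * ℓ / s * t := by
    intro t ht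
    have h1 : (n : ℝ) / 2 ≤ n - 1 := by linarith
    calc 3 * E * s * ℓ = 6 * E ^ 2 * ℓ / s * (n / 2 * E⁻¹) := by rw [hns]; field_simp; norm_num
      _ ≤ 6 * E ^ 2 * ℓ / s * ((n - 1) * E⁻¹) := by gcongr
      _ ≤ _ := by gcongr
  set D := 3 * E * (n * (10 * B * E ^ 2)) * ℓ with hDdef
  have hηD : η * D = 30 * B * E ^ 3 * κ * ℓ / s ^ 2 := by
    rw [hDdef, hη, hns]; field_simp; norm_num
  have hκs : κ * E ≤ s := by
    have h1 := hmon 1 0 (by norm_num) (by norm_num)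
    have h2 := hsmall 1 0 (by norm_num) (by norm_num) (by norm_num)
    rw [pow_zero, mul_one, one_mul] at h2
    rw [pow_one, pow_zero, mul_one] at h1
    have h3 := h1.trans h2
    rwa [div_le_one hs0] at h3
  have hlin := hb.norm_linSolve_le_of_bounds (t := x) (ε := 6 * E ^ 2 * ℓ / s) (D := D)
    (fun i => (hr i).trans (hε _ (hb.le_rowSum i))) (fun j => (hc j).trans (hε _ (hb.le_colSum j)))
    hD
  -- twice the bound that `hlin` gives for the linearized solution, since `κ E ≤ √n`
  set δ := 1400 * q ^ 2 * (E ^ 4 * ℓ / s) with hδ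
  have hδ0 : 0 ≤ δ := by positivity
  have hlin' : ‖linSolve Z u x‖ ≤ δ / 2 := by
    refine hlin.trans ?_
    have e1 : 18 * E ^ 2 * (6 * E ^ 2 * ℓ / s) ≤ 108 * q ^ 2 * (E ^ 4 * ℓ / s) := by
      calc _ = 108 * 1 * (E ^ 4 * ℓ / s) := by ring
        _ ≤ _ := by gcongr; exact one_le_pow₀ hq1
    have e2 : 19 * p * B * E ^ 2 * (η * D) ≤ 570 * q ^ 2 * (E ^ 4 * ℓ / s) := by
      rw [hηD]
      calc _ = 570 * (p * B ^ 2) * (E ^ 4 * ℓ / s) * (κ * E / s) := by field_simp; norm_num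
        _ ≤ 570 * q ^ 2 * (E ^ 4 * ℓ / s) * 1 := by
          gcongr
          exact (div_le_one hs0).2 hκs
        _ = _ := by ring
    have : 0 ≤ q ^ 2 * (E ^ 4 * ℓ / s) := by positivity
    rw [hδ]
    linarith
  set Λ := 370 * q ^ 2 * E ^ 6 * κ with hΛ
  have hΛ0 : 0 ≤ Λ := by positivity
  have hL : 2 + q ≤ 3 * q := by linarith
  have hL0 : 0 ≤ 2 + q := by linarith
  obtain ⟨y, hy, hyx⟩ := hb.exists_isMLE a hδ0 hΛ0
    (fun t τ hτ ht => (hb.norm_linSolve_le hτ ht).trans (by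
      calc 370 * p * B ^ 2 * E ^ 6 * κ * τ = 370 * (p * B ^ 2) * E ^ 6 * κ * τ := by ring
        _ ≤ Λ * τ := by rw [hΛ]; gcongr))
    (by
      have h1 := hmon0 4 1 (by norm_num) (by norm_num)
      rw [pow_one] at h1
      have h2 := hsmall (3 * 1400 * 10) 5 (by norm_num) (by norm_num) (by norm_num)
      calc (2 + q) * δ ≤ 3 * q * (1400 * q ^ 2 * (10 * q ^ 2 * W)) := by rw [hδ]; gcongr
        _ = 3 * 1400 * 10 * q ^ 5 * W := by ring
        _ ≤ 1 := h2)
    (by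
      have h1 := hmon 11 1 (by norm_num) (by norm_num)
      have h2 := hsmall (4 * 9 * 370 * 1400) 6 (by norm_num) (by norm_num) (by norm_num)
      calc 2 * (2 + q) ^ 2 * E * Λ * δ ≤ 2 * (3 * q) ^ 2 * E * Λ * δ := by gcongr
        _ = 2 * 9 * 370 * 1400 * q ^ 6 * (κ * E ^ 11 * ℓ ^ 1 / s) := by rw [hΛ, hδ]; ring
        _ ≤ 2 * 9 * 370 * 1400 * q ^ 6 * W := by gcongr
        _ ≤ 1 / 2 := by linarith)
    (by rw [← hu, ← hxa]; exact hlin')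
  refine ⟨y, hy, fun l i hl hil herr => ?_⟩
  rw [← hu, ← hxa] at hyx
  have hslope := hb.abs_slope_le hD
  have h1 : sendPar (linSolve Z u x).1 i = sendPar (fit u x) i
      - linPred (fit u fun i j => u i j * (Z i j ⬝ᵥ slope Z u x)) i l := by
    rw [linPred, recvPar_last hl, add_zero]
    rfl
  have h2 := hb.abs_linPred_fit_cov_le hslope i l
  have h3 : |sendPar y.1 i - sendPar (linSolve Z u x).1 i| ≤ ‖y - linSolve Z u x‖ :=
    (norm_le_pi_norm (y.1 - (linSolve Z u x).1) ⟨i, by omega⟩).trans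
      (norm_fst_le (y - linSolve Z u x))
  have h4 := hb.sendPar_fit hl hil x
  set T := rowSum x i / rowSum u i + colSum x l / colSum u l with hT
  have h5 : |sendPar y.1 i - T| ≤ 2 * (2 + q) ^ 2 * E * Λ * δ ^ 2
      + 3 * E * (n * (36 * E ^ 5 / (n : ℝ) ^ 2)) * ℓ + 9 * E ^ 2 * (p * B * (η * D)) := by
    have e : sendPar y.1 i - T = (sendPar y.1 i - sendPar (linSolve Z u x).1 i)
        + offSum (fun a b => influenceErr u l i a b * x a b)
        - linPred (fit u fun i j => u i j * (Z i j ⬝ᵥ slope Z u x)) i l := by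
      rw [h1, h4]; ring
    rw [e]
    refine (abs_sub _ _).trans (add_le_add ((abs_add_le _ _).trans (add_le_add ?_ herr)) h2)
    exact h3.trans hyx
  refine (mul_le_mul_of_nonneg_right h5 (by positivity)).trans ?_
  have f1 : 2 * (2 + q) ^ 2 * E * Λ * δ ^ 2 * (E * s)
      ≤ 2 * 9 * 370 * 1400 ^ 2 * q ^ 8 * W := by
    calc _ ≤ 2 * (3 * q) ^ 2 * E * Λ * δ ^ 2 * (E * s) := by gcongr
      _ = 2 * 9 * 370 * 1400 ^ 2 * q ^ 8 * (κ * E ^ 16 * ℓ ^ 2 / s) := by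
        rw [hΛ, hδ]; field_simp; norm_num
      _ ≤ _ := by gcongr; exact hmon _ _ (by norm_num) le_rfl
  have f2 : 3 * E * (n * (36 * E ^ 5 / (n : ℝ) ^ 2)) * ℓ * (E * s) ≤ 1080 * q ^ 8 * W := by
    calc _ = 108 * (E ^ 7 * ℓ ^ 1 / s) := by rw [hns]; field_simp; norm_num
      _ ≤ 108 * (10 * q ^ 2 * W) := by
        gcongr; exact hmon0 7 1 (by norm_num) (by norm_num)
      _ ≤ 108 * (10 * q ^ 8 * W) := by gcongr 108 * (10 * ?_ * W); exact hqpow 2 (by norm_num)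
      _ = _ := by ring
  have f3 : 9 * E ^ 2 * (p * B * (η * D)) * (E * s) ≤ 270 * q ^ 8 * W := by
    rw [hηD]
    calc _ = 270 * (p * B ^ 2) * (κ * E ^ 6 * ℓ ^ 1 / s) := by field_simp; norm_num
      _ ≤ 270 * q ^ 2 * W := by gcongr; exact hmon 6 1 (by norm_num) (by norm_num)
      _ ≤ _ := by gcongr 270 * ?_ * W; exact hqpow 2 (by norm_num)
  have : 0 ≤ q ^ 8 * W := by positivity
  rw [add_mul, add_mul]
  linarith

end Expansion

/-! ### Linear functionals of centred independent Poisson variables -/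

lemma integral_cexp_mul_poissonMeasure (r : NNReal) (z : ℂ) :
    ∫ k : ℕ, Complex.exp (z * k) ∂poissonMeasure r = Complex.exp (r * (Complex.exp z - 1)) := by
  rw [integral_poissonMeasure]
  calc ∑' k : ℕ, (Real.exp (-r) * (r : ℝ) ^ k / (k.factorial : ℝ)) • Complex.exp (z * k)
      = ∑' k : ℕ, (Real.exp (-r) : ℂ) * ((r * Complex.exp z) ^ k / k.factorial) := by
        congr with k
        rw [mul_comm z, Complex.exp_nat_mul, Complex.real_smul, mul_pow]
        push_cast
        ring
    _ = (Real.exp (-r) : ℂ) * Complex.exp (r * Complex.exp z) := by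
        rw [tsum_mul_left, (NormedSpace.expSeries_div_hasSum_exp (r * Complex.exp z)).tsum_eq,
          Complex.exp_eq_exp_ℂ]
    _ = _ := by
        rw [Complex.ofReal_exp, ← Complex.exp_add]
        push_cast
        ring_nf

lemma sum_offDiag {M : Type*} [AddCommMonoid M] {n : ℕ} (f : Fin n → Fin n → M) :
    ∑ e : OffDiag n, f e.1.1 e.1.2 = ∑ i, ∑ j ∈ Finset.univ.erase i, f i j := by
  rw [← Finset.sum_subtype (Finset.univ.filter fun e : Fin n × Fin n => e.1 ≠ e.2) (by simp)
    (fun e : Fin n × Fin n => f e.1 e.2), Finset.sum_filter, ← Finset.univ_product_univ,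
    Finset.sum_product]
  refine Finset.sum_congr rfl fun i _ => ?_
  rw [← Finset.sum_filter]
  refine Finset.sum_congr ?_ fun _ _ => rfl
  ext j
  simp [eq_comm]

section Noise

variable {n p : ℕ} {Ω : Type*} [MeasurableSpace Ω] {μ : Measure Ω}
  {Z : Fin n → Fin n → Fin p → ℝ} {θ : Fin (2 * n - 1) → ℝ} {γ : Fin p → ℝ}
  {a : Ω → Fin n → Fin n → ℕ}

/-- The centred weighted adjacency matrix. -/
def noise (Z : Fin n → Fin n → Fin p → ℝ) (θ : Fin (2 * n - 1) → ℝ) (γ : Fin p → ℝ)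
    (a : Fin n → Fin n → ℕ) (i j : Fin n) : ℝ :=
  a i j - rate Z θ γ i j

/-- The Laplace transform, at complex arguments, of the centred edge weights. -/
lemma IsNetworkPoisson.integral_cexp (ha : IsNetworkPoisson μ Z θ γ a) (z : Fin n → Fin n → ℂ) :
    ∫ ω, Complex.exp (∑ i, ∑ j ∈ Finset.univ.erase i, z i j * noise Z θ γ (a ω) i j) ∂μ
      = Complex.exp (∑ i, ∑ j ∈ Finset.univ.erase i,
          rate Z θ γ i j * (Complex.exp (z i j) - 1 - z i j)) := by
  simp only [← sum_offDiag fun i j => z i j * (noise Z θ γ (a _) i j : ℂ),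
    ← sum_offDiag fun i j => (rate Z θ γ i j : ℂ) * (Complex.exp (z i j) - 1 - z i j),
    Complex.exp_sum]
  have h := ha.indep.integral_fun_prod_comp
    (f := fun (e : OffDiag n) (k : ℕ) =>
      Complex.exp (z e.1.1 e.1.2 * ((k : ℂ) - (rate Z θ γ e.1.1 e.1.2 : ℂ))))
    (fun e => (ha.law e.1.1 e.1.2 e.2).aemeasurable)
    (fun e => (measurable_of_countable _).aestronglyMeasurable)
  have h' : ∀ ω, ∏ e : OffDiag n, Complex.exp (z e.1.1 e.1.2 * (noise Z θ γ (a ω) e.1.1 e.1.2 : ℂ))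
      = ∏ e : OffDiag n, Complex.exp (z e.1.1 e.1.2
        * ((a ω e.1.1 e.1.2 : ℂ) - (rate Z θ γ e.1.1 e.1.2 : ℂ))) := by
    intro ω
    refine Finset.prod_congr rfl fun e _ => ?_
    rw [noise]
    push_cast
    rfl
  simp only [h']
  rw [h]
  refine Finset.prod_congr rfl fun e _ => ?_
  set u := rate Z θ γ e.1.1 e.1.2 with hu
  set w := z e.1.1 e.1.2
  have hlaw := ha.law e.1.1 e.1.2 e.2
  refine (hlaw.integral_comp (f := fun k : ℕ => Complex.exp (w * ((k : ℂ) - (u : ℂ))))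
    (measurable_of_countable _).aestronglyMeasurable).trans ?_
  have h1 : ∀ k : ℕ, Complex.exp (w * ((k : ℂ) - (u : ℂ)))
      = Complex.exp (w * k) * Complex.exp (-(w * u)) := by
    intro k
    rw [← Complex.exp_add]
    ring_nf
  simp only [h1]
  rw [integral_mul_const, integral_cexp_mul_poissonMeasure, ← Complex.exp_add]
  congr 1
  have : ((u.toNNReal : NNReal) : ℂ) = (u : ℂ) := by
    rw [Real.coe_toNNReal _ (rate_pos Z θ γ _ _).le]
  rw [← hu, this]
  ring

lemma IsNetworkPoisson.integral_exp (ha : IsNetworkPoisson μ Z θ γ a) (w : Fin n → Fin n → ℝ) :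
    ∫ ω, Real.exp (offSum fun i j => w i j * noise Z θ γ (a ω) i j) ∂μ
      = Real.exp (offSum fun i j => rate Z θ γ i j * (Real.exp (w i j) - 1 - w i j)) := by
  have h := ha.integral_cexp (fun i j => (w i j : ℂ))
  have h1 : ∀ ω, Complex.exp (∑ i, ∑ j ∈ Finset.univ.erase i,
      (w i j : ℂ) * (noise Z θ γ (a ω) i j : ℂ))
      = ((Real.exp (offSum fun i j => w i j * noise Z θ γ (a ω) i j) : ℝ) : ℂ) := by
    intro ω
    simp [offSum, -Finset.sum_erase_eq_sub]
  simp only [h1] at h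
  rw [integral_complex_ofReal] at h
  have h2 : Complex.exp (∑ i, ∑ j ∈ Finset.univ.erase i,
      (rate Z θ γ i j : ℂ) * (Complex.exp (w i j) - 1 - w i j))
      = ((Real.exp (offSum fun i j => rate Z θ γ i j * (Real.exp (w i j) - 1 - w i j)) : ℝ) : ℂ) := by
    simp [offSum, -Finset.sum_erase_eq_sub]
  rw [h2] at h
  exact_mod_cast h

/-- One-sided Chernoff bound. -/
lemma IsNetworkPoisson.measure_ge_le [IsProbabilityMeasure μ] (ha : IsNetworkPoisson μ Z θ γ a)
    {E v ℓ : ℝ} (hE : 1 ≤ E)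
    (hu : ∀ i j, i ≠ j → rate Z θ γ i j ≤ E) (hv : 0 < v) (hℓ : 0 ≤ ℓ) {w : Fin n → Fin n → ℝ}
    (hw : offSum (fun i j => w i j ^ 2) ≤ v ^ 2) (hwv : ∀ i j, i ≠ j → |w i j| * ℓ ≤ v) :
    μ.real {ω | 3 * E * v * ℓ ≤ offSum fun i j => w i j * noise Z θ γ (a ω) i j}
      ≤ Real.exp (-2 * ℓ ^ 2) := by
  have hE0 : 0 < E := by linarith
  -- the exponent is at most `-t (3 E v ℓ) + E t² v²`, which is at most `-2 ℓ²` for this `t`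
  set t := ℓ / (E * v) with ht
  have ht0 : 0 ≤ t := by positivity
  set X : Ω → ℝ := fun ω => offSum fun i j => w i j * noise Z θ γ (a ω) i j with hX
  have hmul : ∀ ω, t * X ω = offSum fun i j => (t * w i j) * noise Z θ γ (a ω) i j := by
    intro ω
    simp only [hX, mul_assoc]
    rw [offSum_mul_left]
  have hmgf := ha.integral_exp fun i j => t * w i j
  simp only [← hmul] at hmgf
  have hint : Integrable (fun ω => Real.exp (t * X ω)) μ := by
    by_contra hc
    rw [integral_undef hc] at hmgf
    exact (Real.exp_pos _).ne hmgf
  refine (measure_ge_le_exp_mul_mgf (X := X) _ ht0 hint).trans ?_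
  rw [mgf, hmgf, ← Real.exp_add, Real.exp_le_exp]
  have h1 : offSum (fun i j => rate Z θ γ i j * (Real.exp (t * w i j) - 1 - t * w i j))
      ≤ E * t ^ 2 * v ^ 2 := by
    calc _ ≤ offSum fun i j => E * t ^ 2 * w i j ^ 2 := by
          refine Finset.sum_le_sum fun i _ => Finset.sum_le_sum fun j hj => ?_
          have hij := (Finset.ne_of_mem_erase hj).symm
          have h2 : |t * w i j| ≤ 1 := by
            rw [abs_mul, abs_of_nonneg ht0, ht, div_mul_eq_mul_div, div_le_one (by positivity)]
            have := hwv i j hij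
            nlinarith
          have h3 := (le_abs_self _).trans (Real.abs_exp_sub_one_sub_id_le h2)
          refine (mul_le_mul_of_nonneg_left h3 (rate_pos _ _ _ _ _).le).trans ?_
          calc rate Z θ γ i j * (t * w i j) ^ 2 ≤ E * (t * w i j) ^ 2 := by gcongr; exact hu i j hij
            _ = _ := by ring
      _ ≤ _ := by rw [offSum_mul_left]; gcongr
  have h2 : E * t ^ 2 * v ^ 2 = ℓ ^ 2 / E := by rw [ht]; field_simp
  have h3 : -t * (3 * E * v * ℓ) = -3 * ℓ ^ 2 := by rw [ht]; field_simp
  have h4 : ℓ ^ 2 / E ≤ ℓ ^ 2 := div_le_self (by positivity) hE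
  rw [h3]
  linarith

/-- Two-sided tail bound for a linear functional of the noise with square-summed weights `v²`. -/
lemma IsNetworkPoisson.measure_abs_gt_le [IsProbabilityMeasure μ]
    (ha : IsNetworkPoisson μ Z θ γ a) {E v ℓ : ℝ} (hE : 1 ≤ E)
    (hu : ∀ i j, i ≠ j → rate Z θ γ i j ≤ E) (hv : 0 < v) (hℓ : 0 ≤ ℓ) {w : Fin n → Fin n → ℝ}
    (hw : offSum (fun i j => w i j ^ 2) ≤ v ^ 2) (hwv : ∀ i j, i ≠ j → |w i j| * ℓ ≤ v) :
    μ {ω | ¬ |offSum fun i j => w i j * noise Z θ γ (a ω) i j| ≤ 3 * E * v * ℓ}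
      ≤ ENNReal.ofReal (2 * Real.exp (-2 * ℓ ^ 2)) := by
  have h1 := ha.measure_ge_le hE hu hv hℓ hw hwv
  have h2 := ha.measure_ge_le hE hu hv hℓ (w := fun i j => - w i j) (by simpa using hw)
    (by simpa using hwv)
  have hsub : {ω | ¬ |offSum fun i j => w i j * noise Z θ γ (a ω) i j| ≤ 3 * E * v * ℓ}
      ⊆ {ω | 3 * E * v * ℓ ≤ offSum fun i j => w i j * noise Z θ γ (a ω) i j}
        ∪ {ω | 3 * E * v * ℓ ≤ offSum fun i j => -w i j * noise Z θ γ (a ω) i j} := by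
    intro ω hω
    simp only [Set.mem_ofPred_eq, not_le, lt_abs] at hω
    rcases hω with h | h
    · exact Or.inl h.le
    · right
      have : offSum (fun i j => -w i j * noise Z θ γ (a ω) i j)
          = - offSum fun i j => w i j * noise Z θ γ (a ω) i j := by
        rw [← neg_one_mul, ← offSum_mul_left]
        simp only [neg_mul, one_mul]
      rw [Set.mem_ofPred_eq, this]
      exact h.le
  refine (measure_mono hsub).trans ((measure_union_le _ _).trans ?_)
  rw [two_mul, ENNReal.ofReal_add (by positivity) (by positivity)]
  refine add_le_add ?_ ?_
  · rw [← ofReal_measureReal]; exact ENNReal.ofReal_le_ofReal h1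
  · rw [← ofReal_measureReal]; exact ENNReal.ofReal_le_ofReal h2

end Noise

/-! ### The event of small noise -/

section Event

variable {n p : ℕ} {Ω : Type*} [MeasurableSpace Ω] {μ : Measure Ω}
  {Z : Fin n → Fin n → Fin p → ℝ} {θ : Fin (2 * n - 1) → ℝ} {γ : Fin p → ℝ}
  {a : Ω → Fin n → Fin n → ℕ} {E B η : ℝ}

lemma offSum_rowIndicator_mul (i : Fin n) (x : Fin n → Fin n → ℝ) :
    offSum (fun a b => (if a = i then 1 else 0) * x a b) = rowSum x i := by
  rw [offSum_eq_sum_rowSum, Finset.sum_eq_single i]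
  · simp [rowSum]
  · intro a _ ha; simp [rowSum, ha]
  · simp

lemma offSum_colIndicator_mul (j : Fin n) (x : Fin n → Fin n → ℝ) :
    offSum (fun a b => (if b = j then 1 else 0) * x a b) = colSum x j := by
  rw [offSum_eq_sum_colSum, Finset.sum_eq_single j]
  · simp [colSum]
  · intro a _ ha; simp [colSum, ha]
  · simp

lemma rowSum_one_le (i : Fin n) : rowSum (fun _ _ => (1 : ℝ)) i ≤ n := by
  rw [rowSum, Finset.sum_const, nsmul_eq_mul, card_erase_cast]
  linarith

lemma colSum_one_le (j : Fin n) : colSum (fun _ _ => (1 : ℝ)) j ≤ n := rowSum_one_le j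

/-- At the level `3 E v √(log n)` the tail bound is `2 / n²`, which leaves room for a union bound over
the nodes. -/
lemma IsRegular.measure_functional_le [IsProbabilityMeasure μ]
    (hb : IsRegular Z (rate Z θ γ) E B η) (ha : IsNetworkPoisson μ Z θ γ a) {v : ℝ} (hv : 0 < v)
    {w : Fin n → Fin n → ℝ} (hw : offSum (fun i j => w i j ^ 2) ≤ v ^ 2)
    (hwv : ∀ i j, i ≠ j → |w i j| * √(Real.log n) ≤ v) :
    μ {ω | ¬ |offSum fun i j => w i j * noise Z θ γ (a ω) i j| ≤ 3 * E * v * √(Real.log n)}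
      ≤ ENNReal.ofReal (2 / (n : ℝ) ^ 2) := by
  have hn := hb.three_le_cast
  refine (ha.measure_abs_gt_le hb.one_le hb.upper hv (Real.sqrt_nonneg _) hw hwv).trans
    (le_of_eq ?_)
  rw [Real.sq_sqrt (Real.log_nonneg (by linarith)), neg_mul, Real.exp_neg,
    show 2 * Real.log (n : ℝ) = Real.log ((n : ℝ) ^ 2) by rw [Real.log_pow]; norm_num,
    Real.exp_log (by positivity), div_eq_mul_inv]

/-- The tail bound for weights of size at most `D`, whose sum of squares is at most `(n D)²`. -/
lemma IsRegular.measure_bounded_functional_le [IsProbabilityMeasure μ]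
    (hb : IsRegular Z (rate Z θ γ) E B η) (ha : IsNetworkPoisson μ Z θ γ a) {D : ℝ} (hD : 0 < D)
    {w : Fin n → Fin n → ℝ} (hw : ∀ i j, i ≠ j → |w i j| ≤ D) :
    μ {ω | ¬ |offSum fun i j => w i j * noise Z θ γ (a ω) i j|
        ≤ 3 * E * (n * D) * √(Real.log n)}
      ≤ ENNReal.ofReal (2 / (n : ℝ) ^ 2) := by
  have hn := hb.three_le_cast
  have hln : √(Real.log n) ≤ n := by
    rw [Real.sqrt_le_left (by linarith)]
    have := Real.log_le_self (x := (n : ℝ)) (by linarith)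
    nlinarith
  refine hb.measure_functional_le ha (by positivity) ?_ fun i j hij => ?_
  · refine (le_abs_self _).trans ((abs_offSum_le (D := D ^ 2) (by positivity) ?_).trans (le_of_eq ?_))
    · intro i j hij
      rw [abs_pow]
      gcongr
      exact hw i j hij
    · ring
  · calc |w i j| * √(Real.log n) ≤ D * n := by gcongr; exact hw i j hij
      _ = n * D := mul_comm _ _

/-- With probability at least `1 - (6 + 2 p) / n`, the score equations have a solution whose sender
coordinates have the expansion of `IsRegular.exists_isMLE_expansion`. -/
theorem IsRegular.exists_event [IsProbabilityMeasure μ]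
    (hb : IsRegular Z (rate Z θ γ) E B η) (ha : IsNetworkPoisson μ Z θ γ a)
    (hW : 10 ^ 11 * (p * B) ^ 8 * ((n : ℝ) ^ 2 * η * E ^ 23 * Real.log n / √n) ≤ 1) :
    ∃ G : Set Ω, μ Gᶜ ≤ ENNReal.ofReal ((6 + 2 * p) / n) ∧ ∀ ω ∈ G,
      ∃ y : (Fin (2 * n - 1) → ℝ) × (Fin p → ℝ), IsMLE Z (a ω) (θ + y.1) (γ + y.2) ∧
      ∀ l i : Fin n, (l : ℕ) + 1 = n → i ≠ l →
        |sendPar y.1 i - offSum fun b c => noise Z θ γ (a ω) b c * influence (rate Z θ γ) l i b c|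
            * (E * √n)
          ≤ 10 ^ 11 * (p * B) ^ 8 * ((n : ℝ) ^ 2 * η * E ^ 23 * Real.log n / √n) := by
  have hn := hb.three_le_cast
  have hn0 : (0 : ℝ) < n := by linarith
  have hE := hb.pos_E
  have hB := hb.B_pos
  have hlog : 1 ≤ Real.log n := by
    rw [Real.le_log_iff_exp_le hn0]
    linarith [Real.exp_one_lt_three]
  set ℓ := √(Real.log n) with hℓ
  have hℓ1 : 1 ≤ ℓ := by rw [hℓ, Real.one_le_sqrt]; exact hlog
  have hℓ2 : ℓ ^ 2 = Real.log n := Real.sq_sqrt (by linarith)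
  have hℓn : ℓ ≤ √n := Real.sqrt_le_sqrt (Real.log_le_self hn0.le)
  set u := rate Z θ γ with hu
  obtain ⟨l, hl⟩ : ∃ l : Fin n, (l : ℕ) + 1 = n :=
    ⟨⟨n - 1, by have := hb.three_le; omega⟩, by have := hb.three_le; simp only; omega⟩
  let bad : (Fin n → Fin n → ℝ) → ℝ → Set Ω := fun w v =>
    {ω | ¬ |offSum fun i j => w i j * noise Z θ γ (a ω) i j| ≤ 3 * E * v * ℓ}
  let R : Fin n → Set Ω := fun i => bad (fun a _ => if a = i then 1 else 0) √n
  let C : Fin n → Set Ω := fun i => bad (fun _ b => if b = i then 1 else 0) √n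
  let Q : Fin p → Set Ω := fun c => bad (residCov Z u c) (n * (10 * B * E ^ 2))
  let I : Fin n → Set Ω := fun i =>
    if i = l then ∅ else bad (influenceErr u l i) (n * (36 * E ^ 5 / (n : ℝ) ^ 2))
  have hR : ∀ i, μ (R i) ≤ ENNReal.ofReal (2 / (n : ℝ) ^ 2) := by
    intro i
    refine hb.measure_functional_le ha (Real.sqrt_pos.2 hn0) ?_ fun a b _ => ?_
    · rw [Real.sq_sqrt hn0.le]
      refine le_trans (le_of_eq ?_) (rowSum_one_le i)
      rw [← offSum_rowIndicator_mul]
      exact offSum_congr fun a b _ => by split_ifs <;> norm_num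
    · refine le_trans ?_ hℓn
      split_ifs
      · rw [abs_one, one_mul]
      · rw [abs_zero, zero_mul]; linarith
  have hC : ∀ i, μ (C i) ≤ ENNReal.ofReal (2 / (n : ℝ) ^ 2) := by
    intro i
    refine hb.measure_functional_le ha (Real.sqrt_pos.2 hn0) ?_ fun a b _ => ?_
    · rw [Real.sq_sqrt hn0.le]
      refine le_trans (le_of_eq ?_) (colSum_one_le i)
      rw [← offSum_colIndicator_mul]
      exact offSum_congr fun a b _ => by split_ifs <;> norm_num
    · refine le_trans ?_ hℓn
      split_ifs
      · rw [abs_one, one_mul]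
      · rw [abs_zero, zero_mul]; linarith
  have hQ : ∀ c, μ (Q c) ≤ ENNReal.ofReal (2 / (n : ℝ) ^ 2) := fun c =>
    hb.measure_bounded_functional_le ha (by positivity) fun i j hij => hb.abs_residCov_le c hij
  have hI : ∀ i, μ (I i) ≤ ENNReal.ofReal (2 / (n : ℝ) ^ 2) := by
    intro i
    by_cases h : i = l
    · simp [I, h]
    · simp only [I, if_neg h]
      exact hb.measure_bounded_functional_le ha (by positivity) fun a b _ =>
        hb.abs_influenceErr_le h a b
  have hunion : ∀ (m : ℕ) (s : Fin m → Set Ω),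
      (∀ i, μ (s i) ≤ ENNReal.ofReal (2 / (n : ℝ) ^ 2)) →
      μ (⋃ i, s i) ≤ ENNReal.ofReal (m * (2 / (n : ℝ) ^ 2)) := by
    intro m s hs
    refine (measure_iUnion_fintype_le μ s).trans ((Finset.sum_le_sum fun i _ => hs i).trans ?_)
    rw [Finset.sum_const, nsmul_eq_mul, Finset.card_univ, Fintype.card_fin,
      ENNReal.ofReal_mul (by positivity), ENNReal.ofReal_natCast]
  refine ⟨((⋃ i, R i) ∪ (⋃ i, C i) ∪ (⋃ c, Q c) ∪ ⋃ i, I i)ᶜ, ?_, ?_⟩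
  · rw [compl_compl]
    have h1 : μ ((⋃ i, R i) ∪ (⋃ i, C i) ∪ (⋃ c, Q c) ∪ ⋃ i, I i)
        ≤ ENNReal.ofReal (n * (2 / (n : ℝ) ^ 2)) + ENNReal.ofReal (n * (2 / (n : ℝ) ^ 2))
          + ENNReal.ofReal (p * (2 / (n : ℝ) ^ 2)) + ENNReal.ofReal (n * (2 / (n : ℝ) ^ 2)) := by
      refine (measure_union_le _ _).trans (add_le_add ?_ (hunion n I hI))
      refine (measure_union_le _ _).trans (add_le_add ?_ (hunion p Q hQ))
      exact (measure_union_le _ _).trans (add_le_add (hunion n R hR) (hunion n C hC))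
    refine h1.trans ?_
    rw [← ENNReal.ofReal_add (by positivity) (by positivity),
      ← ENNReal.ofReal_add (by positivity) (by positivity),
      ← ENNReal.ofReal_add (by positivity) (by positivity)]
    refine ENNReal.ofReal_le_ofReal ?_
    have h2 : (p : ℝ) * (2 / (n : ℝ) ^ 2) ≤ 2 * p / n := by
      rw [mul_div_assoc', div_le_div_iff₀ (by positivity) hn0]
      have : (0 : ℝ) ≤ p * n := by positivity
      nlinarith
    have h3 : (n : ℝ) * (2 / (n : ℝ) ^ 2) = 2 / n := by field_simp
    rw [h3, show (6 + 2 * (p : ℝ)) / n = 2 / n + 2 / n + 2 * p / n + 2 / n by ring]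
    linarith
  · intro ω hω
    simp only [Set.mem_compl_iff, Set.mem_union, Set.mem_iUnion, not_or, not_exists] at hω
    obtain ⟨⟨⟨h1, h2⟩, h3⟩, h4⟩ := hω
    obtain ⟨y, hy, hexp⟩ := hb.exists_isMLE_expansion (a ω) hℓ1 (by rw [hℓ2]; exact hW)
      (x := noise Z θ γ (a ω)) rfl
      (fun i => by
        have := not_not.1 (h1 i)
        rwa [offSum_rowIndicator_mul] at this)
      (fun i => by
        have := not_not.1 (h2 i)
        rwa [offSum_colIndicator_mul] at this)
      (fun c => not_not.1 (h3 c))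
    refine ⟨y, hy, fun l' i hl' hil => ?_⟩
    have hll : l' = l := Fin.ext (by omega)
    subst hll
    rw [offSum_mul_influence, ← hℓ2]
    refine hexp l' i hl' hil ?_
    have h5 := h4 i
    simp only [I, if_neg hil] at h5
    exact not_not.1 h5

end Event

/-! ### Characteristic functions -/

/-- Characteristic functions of two random variables that are close outside a small event. -/
lemma norm_integral_cexp_sub_le {Ω : Type*} [MeasurableSpace Ω] {μ : Measure Ω}
    [IsProbabilityMeasure μ] {f g : Ω → ℝ} (hf : AEMeasurable f μ) (hg : AEMeasurable g μ)
    {G : Set Ω} {ε δ : ℝ} (hε : 0 ≤ ε) (hδ : 0 ≤ δ) (hG : μ Gᶜ ≤ ENNReal.ofReal δ)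
    (h : ∀ᵐ ω ∂μ, ω ∈ G → |f ω - g ω| ≤ ε) :
    ‖∫ ω, Complex.exp (f ω * Complex.I) ∂μ - ∫ ω, Complex.exp (g ω * Complex.I) ∂μ‖
      ≤ ε + 2 * δ := by
  set T := toMeasurable μ Gᶜ with hT
  have hTm : MeasurableSet T := measurableSet_toMeasurable _ _
  have hTδ : μ.real T ≤ δ := by
    rw [measureReal_def, hT, measure_toMeasurable]
    exact ENNReal.toReal_le_of_le_ofReal hδ hG
  have hint : ∀ f : Ω → ℝ, AEMeasurable f μ →
      Integrable (fun ω => Complex.exp (f ω * Complex.I)) μ := by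
    intro f hf
    refine Integrable.of_bound (C := 1) ?_ (ae_of_all _ fun ω => ?_)
    · exact (Complex.measurable_exp.comp_aemeasurable
        ((Complex.measurable_ofReal.comp_aemeasurable hf).mul_const _)).aestronglyMeasurable
    · rw [Complex.norm_exp_ofReal_mul_I]
  rw [← integral_sub (hint f hf) (hint g hg)]
  have hbound : Integrable (fun ω => ε + T.indicator (fun _ => (2 : ℝ)) ω) μ :=
    (integrable_const _).add ((integrable_const _).indicator hTm)
  refine (norm_integral_le_of_norm_le hbound ?_).trans ?_
  · filter_upwards [h] with ω hω
    by_cases hωG : ω ∈ G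
    · have h1 : Complex.exp (f ω * Complex.I) - Complex.exp (g ω * Complex.I)
          = Complex.exp (g ω * Complex.I)
            * (Complex.exp (Complex.I * ((f ω - g ω : ℝ) : ℂ)) - 1) := by
        rw [mul_sub, ← Complex.exp_add, mul_one]
        congr 2
        push_cast
        ring
      have h2 : ‖Complex.exp (f ω * Complex.I) - Complex.exp (g ω * Complex.I)‖ ≤ ε := by
        rw [h1, norm_mul, Complex.norm_exp_ofReal_mul_I, one_mul]
        exact Real.norm_exp_I_mul_ofReal_sub_one_le.trans (hω hωG)
      have h3 : (0 : ℝ) ≤ T.indicator (fun _ => (2 : ℝ)) ω :=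
        Set.indicator_nonneg (fun _ _ => by norm_num) _
      linarith
    · have h1 : ω ∈ T := subset_toMeasurable _ _ hωG
      rw [Set.indicator_of_mem h1]
      have h2 := norm_sub_le (Complex.exp (f ω * Complex.I)) (Complex.exp (g ω * Complex.I))
      rw [Complex.norm_exp_ofReal_mul_I, Complex.norm_exp_ofReal_mul_I] at h2
      linarith
  · rw [integral_add (integrable_const _) ((integrable_const _).indicator hTm),
      integral_indicator_const _ hTm]
    simp only [integral_const, probReal_univ, smul_eq_mul, one_mul]
    linarith

/-- The logarithm of the characteristic function of `∑ wᵢⱼ xᵢⱼ` at `1` is minus half the variance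
`∑ uᵢⱼ wᵢⱼ²`, up to a relative error of the size of the largest weight. -/
lemma norm_cumulant_add_le {n : ℕ} {u w : Fin n → Fin n → ℝ} {m : ℝ} (hm : m ≤ 1)
    (hu : ∀ i j, i ≠ j → 0 ≤ u i j) (hw : ∀ i j, i ≠ j → |w i j| ≤ m) :
    ‖(∑ i, ∑ j ∈ Finset.univ.erase i,
        (u i j : ℂ) * (Complex.exp (w i j * Complex.I) - 1 - w i j * Complex.I))
      + ((offSum fun i j => u i j * w i j ^ 2 : ℝ) : ℂ) / 2‖
      ≤ m * offSum fun i j => u i j * w i j ^ 2 := by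
  have h1 : (∑ i, ∑ j ∈ Finset.univ.erase i,
        (u i j : ℂ) * (Complex.exp (w i j * Complex.I) - 1 - w i j * Complex.I))
      + ((offSum fun i j => u i j * w i j ^ 2 : ℝ) : ℂ) / 2
      = ∑ i, ∑ j ∈ Finset.univ.erase i, (u i j : ℂ) *
        (Complex.exp (w i j * Complex.I) - (1 + w i j * Complex.I + (w i j * Complex.I) ^ 2 / 2)) := by
    rw [offSum, Complex.ofReal_sum, Finset.sum_div, ← Finset.sum_add_distrib]
    refine Finset.sum_congr rfl fun i _ => ?_
    rw [Complex.ofReal_sum, Finset.sum_div, ← Finset.sum_add_distrib]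
    refine Finset.sum_congr rfl fun j _ => ?_
    rw [mul_pow, Complex.I_sq]
    push_cast
    ring
  rw [h1, offSum, Finset.mul_sum]
  refine (norm_sum_le _ _).trans (Finset.sum_le_sum fun i _ => ?_)
  rw [Finset.mul_sum]
  refine (norm_sum_le _ _).trans (Finset.sum_le_sum fun j hj => ?_)
  have hij := (Finset.ne_of_mem_erase hj).symm
  have hnorm : ‖(w i j : ℂ) * Complex.I‖ = |w i j| := by simp
  have h2 := Complex.exp_bound (x := w i j * Complex.I)
    (by rw [hnorm]; exact (hw i j hij).trans hm) (n := 3) (by norm_num)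
  rw [hnorm] at h2
  have h3 : ∑ m ∈ Finset.range 3, ((w i j : ℂ) * Complex.I) ^ m / (m.factorial : ℂ)
      = 1 + w i j * Complex.I + (w i j * Complex.I) ^ 2 / 2 := by
    simp [Finset.sum_range_succ, Nat.factorial]
  rw [h3] at h2
  have h4 : |w i j| ^ 3 * (((3 : ℕ).succ : ℝ) * (((3 : ℕ).factorial : ℝ) * ((3 : ℕ) : ℝ))⁻¹)
      ≤ |w i j| ^ 3 := by
    refine mul_le_of_le_one_right (by positivity) ?_
    norm_num [Nat.factorial]
  rw [norm_mul, Complex.norm_real, Real.norm_eq_abs, abs_of_nonneg (hu i j hij)]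
  calc _ ≤ u i j * |w i j| ^ 3 := mul_le_mul_of_nonneg_left (h2.trans h4) (hu i j hij)
    _ = |w i j| * (u i j * w i j ^ 2) := by rw [← sq_abs (w i j)]; ring
    _ ≤ m * (u i j * w i j ^ 2) :=
        mul_le_mul_of_nonneg_right (hw i j hij) (mul_nonneg (hu i j hij) (sq_nonneg _))

/-! ### The covariance of the leading terms -/

section Covariance

variable {n k : ℕ} {u : Fin n → Fin n → ℝ} {E : ℝ}

lemma upperLeft_approxInv (hk : k < n) {l : Fin n} (hl : (l : ℕ) + 1 = n) (i j : Fin k) :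
    upperLeft k (approxInv u) i j
      = (if i = j then 1 / rowSum u (Fin.castLE hk.le i) else 0) + 1 / colSum u l := by
  have hi : (i : ℕ) < n := by omega
  have hj : (j : ℕ) < n := by omega
  have hll : (⟨n - 1, by omega⟩ : Fin n) = l := Fin.ext (by simp only; omega)
  rw [upperLeft, Matrix.of_apply, dif_pos ⟨by omega, by omega⟩, approxInv, Matrix.of_apply]
  simp only [hi, hj, if_true, hll, Fin.mk.injEq, Fin.val_inj, biSum, dif_pos]
  rfl

lemma dotProduct_upperLeft_mulVec (hk : k < n) {l : Fin n} (hl : (l : ℕ) + 1 = n)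
    (b : Fin k → ℝ) :
    b ⬝ᵥ (upperLeft k (approxInv u) *ᵥ b)
      = ∑ i, b i ^ 2 / rowSum u (Fin.castLE hk.le i) + (∑ i, b i) ^ 2 / colSum u l := by
  have h : ∀ i, (upperLeft k (approxInv u) *ᵥ b) i
      = b i / rowSum u (Fin.castLE hk.le i) + (∑ j, b j) / colSum u l := by
    intro i
    simp only [Matrix.mulVec, dotProduct, upperLeft_approxInv hk hl, add_mul, ite_mul, zero_mul,
      Finset.sum_add_distrib, Finset.sum_ite_eq, Finset.mem_univ, if_true, ← Finset.mul_sum]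
    ring
  simp only [dotProduct, h, mul_add, Finset.sum_add_distrib, ← Finset.sum_mul]
  congr 1
  · exact Finset.sum_congr rfl fun i _ => by ring
  · ring

lemma IsBalanced.posDef_upperLeft (hb : IsBalanced u E) (hk : k < n) :
    (upperLeft k (approxInv u)).PosDef := by
  obtain ⟨l, hl⟩ : ∃ l : Fin n, (l : ℕ) + 1 = n := ⟨⟨n - 1, by omega⟩, by simp only; omega⟩
  refine Matrix.PosDef.of_dotProduct_mulVec_pos ?_ fun b hb0 => ?_
  · ext i j
    rw [Matrix.conjTranspose_apply, star_trivial, upperLeft_approxInv hk hl,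
      upperLeft_approxInv hk hl]
    by_cases h : i = j
    · subst h; rfl
    · rw [if_neg h, if_neg (Ne.symm h)]
  · rw [star_trivial, dotProduct_upperLeft_mulVec hk hl]
    obtain ⟨i, hi⟩ := Function.ne_iff.1 hb0
    refine add_pos_of_pos_of_nonneg ?_ (div_nonneg (sq_nonneg _) (hb.colSum_pos l).le)
    refine Finset.sum_pos' (fun i _ => div_nonneg (sq_nonneg _) (hb.rowSum_pos _).le)
      ⟨i, Finset.mem_univ _, div_pos (sq_pos_of_ne_zero hi) (hb.rowSum_pos _)⟩

/-- The weights of the linear combination with coefficients `b` of the leading terms of the first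
`k` sender effects. -/
def leadWeight (u : Fin n → Fin n → ℝ) (hk : k < n) (l : Fin n) (b : Fin k → ℝ) (c d : Fin n) : ℝ :=
  ∑ i, b i * influence u l (Fin.castLE hk.le i) c d

lemma offSum_mul_leadWeight (hk : k < n) (l : Fin n) (b : Fin k → ℝ) (x : Fin n → Fin n → ℝ) :
    offSum (fun c d => x c d * leadWeight u hk l b c d)
      = ∑ i, b i * offSum fun c d => x c d * influence u l (Fin.castLE hk.le i) c d := by
  simp only [offSum, leadWeight, Finset.mul_sum]
  rw [Finset.sum_comm]
  refine Finset.sum_congr rfl fun c _ => ?_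
  rw [Finset.sum_comm]
  exact Finset.sum_congr rfl fun d _ => Finset.sum_congr rfl fun i _ => by ring

/-- A coefficient vector has entries of order at most `√n` if the leading terms it combines have
variance `T²`. -/
lemma IsBalanced.abs_coeff_le (hb : IsBalanced u E) (hk : k < n) {b : Fin k → ℝ} {T : ℝ}
    (hT : 0 ≤ T) (hbT : b ⬝ᵥ (upperLeft k (approxInv u) *ᵥ b) = T ^ 2) (i : Fin k) :
    |b i| ≤ T * (E * √n) := by
  have hE := hb.pos_E
  have hn := hb.three_le_cast
  obtain ⟨l, hl⟩ : ∃ l : Fin n, (l : ℕ) + 1 = n := ⟨⟨n - 1, by omega⟩, by simp only; omega⟩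
  rw [dotProduct_upperLeft_mulVec hk hl] at hbT
  have h1 : b i ^ 2 / rowSum u (Fin.castLE hk.le i) ≤ T ^ 2 := by
    have h2 := Finset.single_le_sum (f := fun i => b i ^ 2 / rowSum u (Fin.castLE hk.le i))
      (fun i _ => div_nonneg (sq_nonneg _) (hb.rowSum_pos _).le) (Finset.mem_univ i)
    have h3 : 0 ≤ (∑ i, b i) ^ 2 / colSum u l := div_nonneg (sq_nonneg _) (hb.colSum_pos l).le
    linarith
  rw [div_le_iff₀ (hb.rowSum_pos _)] at h1
  refine abs_le_of_sq_le_sq ?_ (by positivity)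
  refine h1.trans ?_
  rw [mul_pow, mul_pow, Real.sq_sqrt (by linarith)]
  gcongr
  refine (hb.rowSum_le _).trans ?_
  have : E ≤ E ^ 2 := le_self_pow₀ hb.one_le (by norm_num)
  calc ((n : ℝ) - 1) * E ≤ n * E ^ 2 := by gcongr; linarith
    _ = E ^ 2 * n := mul_comm _ _

lemma IsBalanced.inv_le (hb : IsBalanced u E) {s : ℝ} (hs : (n - 1) * E⁻¹ ≤ s) :
    1 / s ≤ 2 * E / n := by
  have hE := hb.pos_E
  have hn := hb.three_le_cast
  have h1 : (0 : ℝ) < n / 2 * E⁻¹ := by positivity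
  have h2 : n / 2 * E⁻¹ ≤ s := le_trans (by gcongr; linarith) hs
  calc 1 / s ≤ 1 / (n / 2 * E⁻¹) := one_div_le_one_div_of_le h1 h2
    _ = 2 * E / n := by field_simp

lemma IsBalanced.abs_influence_le (hb : IsBalanced u E) (l i c d : Fin n) :
    |influence u l i c d| ≤ 4 * E / n := by
  have hE := hb.pos_E
  have hn := hb.three_le_cast
  have h0 : 0 ≤ 2 * E / n := by positivity
  have h1 := hb.inv_le (hb.le_rowSum i)
  have h2 := hb.inv_le (hb.le_colSum l)
  have h3 := (one_div_pos.2 (hb.rowSum_pos i)).le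
  have h4 := (one_div_pos.2 (hb.colSum_pos l)).le
  have h5 : 4 * E / n = 2 * E / n + 2 * E / n := by ring
  rw [influence, h5]
  refine (abs_add_le _ _).trans (add_le_add ?_ ?_)
  · split_ifs
    · rwa [abs_of_nonneg h3]
    · rwa [abs_zero]
  · split_ifs
    · rwa [abs_of_nonneg h4]
    · rwa [abs_zero]

lemma IsBalanced.abs_leadWeight_le (hb : IsBalanced u E) (hk : k < n) (l : Fin n)
    {b : Fin k → ℝ} {T : ℝ} (hT : 0 ≤ T) (hbT : ∀ i, |b i| ≤ T * (E * √n)) (c d : Fin n) :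
    |leadWeight u hk l b c d| ≤ 4 * k * T * (E ^ 2 / √n) := by
  have hE := hb.pos_E
  have hn := hb.three_le_cast
  have hs : 0 < √(n : ℝ) := Real.sqrt_pos.2 (by linarith)
  have hns : (n : ℝ) = √n ^ 2 := (Real.sq_sqrt (by linarith)).symm
  refine (Finset.abs_sum_le_sum_abs _ _).trans ?_
  refine (Finset.sum_le_card_nsmul _ _ (T * (E * √n) * (4 * E / n)) fun i _ => ?_).trans
    (le_of_eq ?_)
  · rw [abs_mul]
    exact mul_le_mul (hbT i) (hb.abs_influence_le _ _ _ _) (abs_nonneg _) (by positivity)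
  · rw [Finset.card_univ, Fintype.card_fin, nsmul_eq_mul]
    generalize √(n : ℝ) = s at hs hns
    rw [hns]
    field_simp

/-- The covariances of the leading terms agree with the entries of `approxInv` up to an error of
order `1 / n²`, the contribution of the edges into the last node. -/
lemma IsBalanced.abs_covariance_sub_le (hb : IsBalanced u E) (hk : k < n) {l : Fin n}
    (hl : (l : ℕ) + 1 = n) (i j : Fin k) :
    |offSum (fun c d => u c d * influence u l (Fin.castLE hk.le j) c d
        * influence u l (Fin.castLE hk.le i) c d) - upperLeft k (approxInv u) i j|
      ≤ 8 * E ^ 3 / (n : ℝ) ^ 2 := by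
  have hE := hb.pos_E
  have hn := hb.three_le_cast
  have hne : ∀ i : Fin k, Fin.castLE hk.le i ≠ l := by
    intro i h
    have h1 := congrArg Fin.val h
    rw [Fin.val_castLE] at h1
    omega
  set i' := Fin.castLE hk.le i with hi'
  set j' := Fin.castLE hk.le j with hj'
  have hij : (i' = j') = (i = j) := by
    rw [hi', hj', (Fin.castLE_injective hk.le).eq_iff]
  rw [offSum_mul_influence, hb.rowSum_mul_influence, hb.colSum_mul_influence,
    upperLeft_approxInv hk hl, if_neg (hne i), if_neg (hne j).symm, if_pos rfl]
  simp only [hij]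
  have e : ((if i = j then (1 : ℝ) else 0) + u i' l / colSum u l) / rowSum u i'
      + (u j' l / rowSum u j' + 1) / colSum u l
      - ((if i = j then 1 / rowSum u i' else 0) + 1 / colSum u l)
      = u i' l * (1 / colSum u l) * (1 / rowSum u i')
        + u j' l * (1 / colSum u l) * (1 / rowSum u j') := by
    split_ifs <;> ring
  have hterm : ∀ i : Fin n, i ≠ l → 0 ≤ u i l * (1 / colSum u l) * (1 / rowSum u i) ∧
      u i l * (1 / colSum u l) * (1 / rowSum u i) ≤ 4 * E ^ 3 / (n : ℝ) ^ 2 := by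
    intro i hil
    have h1 := hb.inv_le (hb.le_rowSum i)
    have h2 := hb.inv_le (hb.le_colSum l)
    have h3 := (one_div_pos.2 (hb.rowSum_pos i)).le
    have h4 := (one_div_pos.2 (hb.colSum_pos l)).le
    have h5 := (hb.pos hil).le
    refine ⟨by positivity, ?_⟩
    calc _ ≤ E * (2 * E / n) * (2 * E / n) := by
          gcongr
          exact hb.upper i l hil
      _ = _ := by field_simp; norm_num
  rw [e]
  have h1 := hterm i' (hne i)
  have h2 := hterm j' (hne j)
  rw [abs_of_nonneg (add_nonneg h1.1 h2.1)]
  have : 8 * E ^ 3 / (n : ℝ) ^ 2 = 4 * E ^ 3 / (n : ℝ) ^ 2 + 4 * E ^ 3 / (n : ℝ) ^ 2 := by ring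
  linarith [h1.2, h2.2]

lemma IsBalanced.abs_variance_sub_le (hb : IsBalanced u E) (hk : k < n) {l : Fin n}
    (hl : (l : ℕ) + 1 = n) {b : Fin k → ℝ} {T : ℝ} (hT : 0 ≤ T)
    (hbT : ∀ i, |b i| ≤ T * (E * √n)) :
    |offSum (fun c d => u c d * leadWeight u hk l b c d ^ 2)
        - b ⬝ᵥ (upperLeft k (approxInv u) *ᵥ b)| ≤ 8 * k ^ 2 * T ^ 2 * (E ^ 5 / n) := by
  have hE := hb.pos_E
  have hn := hb.three_le_cast
  have h1 : offSum (fun c d => u c d * leadWeight u hk l b c d ^ 2)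
      = ∑ i, ∑ j, b i * b j * offSum (fun c d => u c d * influence u l (Fin.castLE hk.le j) c d
        * influence u l (Fin.castLE hk.le i) c d) := by
    have h2 : ∀ i, (offSum fun c d => u c d * leadWeight u hk l b c d
        * influence u l (Fin.castLE hk.le i) c d)
        = ∑ j, b j * offSum (fun c d => u c d * influence u l (Fin.castLE hk.le j) c d
          * influence u l (Fin.castLE hk.le i) c d) := by
      intro i
      have h3 := offSum_mul_leadWeight (u := u) hk l b
        (fun c d => u c d * influence u l (Fin.castLE hk.le i) c d)
      simp only [mul_right_comm _ (influence u l (Fin.castLE hk.le i) _ _)] at h3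
      exact h3
    have h4 := offSum_mul_leadWeight (u := u) hk l b (fun c d => u c d * leadWeight u hk l b c d)
    simp only [sq, ← mul_assoc] at h4 ⊢
    rw [h4]
    refine Finset.sum_congr rfl fun i _ => ?_
    rw [h2, Finset.mul_sum]
    exact Finset.sum_congr rfl fun j _ => (mul_assoc _ _ _).symm
  have h2 : b ⬝ᵥ (upperLeft k (approxInv u) *ᵥ b)
      = ∑ i, ∑ j, b i * b j * upperLeft k (approxInv u) i j := by
    simp only [dotProduct, Matrix.mulVec, Finset.mul_sum]
    exact Finset.sum_congr rfl fun i _ => Finset.sum_congr rfl fun j _ => by ring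
  rw [h1, h2, ← Finset.sum_sub_distrib]
  simp only [← Finset.sum_sub_distrib, ← mul_sub]
  have h3 : ∀ i j, |b i * b j * (offSum (fun c d => u c d * influence u l (Fin.castLE hk.le j) c d
        * influence u l (Fin.castLE hk.le i) c d) - upperLeft k (approxInv u) i j)|
      ≤ T * (E * √n) * (T * (E * √n)) * (8 * E ^ 3 / (n : ℝ) ^ 2) := by
    intro i j
    rw [abs_mul, abs_mul]
    exact mul_le_mul (mul_le_mul (hbT i) (hbT j) (abs_nonneg _) (by positivity))
      (hb.abs_covariance_sub_le hk hl i j) (abs_nonneg _) (by positivity)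
  refine (Finset.abs_sum_le_sum_abs _ _).trans ?_
  refine (Finset.sum_le_sum fun i _ => (Finset.abs_sum_le_sum_abs _ _).trans
    (Finset.sum_le_sum fun j _ => h3 i j)).trans (le_of_eq ?_)
  simp only [Finset.sum_const, Finset.card_univ, Fintype.card_fin, nsmul_eq_mul]
  have hs : 0 < √(n : ℝ) := Real.sqrt_pos.2 (by linarith)
  have hns : (n : ℝ) = √n ^ 2 := (Real.sq_sqrt (by linarith)).symm
  generalize √(n : ℝ) = s at hs hns
  rw [hns]
  field_simp

end Covariance

/-! ### The characteristic function of the standardized estimate -/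

section CharFun

variable {n p k : ℕ} {Ω : Type*} [MeasurableSpace Ω] {μ : Measure Ω}
  {Z : Fin n → Fin n → Fin p → ℝ} {θ : Fin (2 * n - 1) → ℝ} {γ : Fin p → ℝ}
  {a : Ω → Fin n → Fin n → ℕ} {E B η : ℝ}

lemma measurable_firstCoords {d : ℕ} (k : ℕ) : Measurable (firstCoords (d := d) k) := by
  refine measurable_pi_lambda _ fun i => ?_
  unfold firstCoords
  split_ifs
  · exact measurable_pi_apply _
  · exact measurable_const

lemma measurable_toLp_mulVec (A : Matrix (Fin k) (Fin k) ℝ) :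
    Measurable fun x : Fin k → ℝ => (WithLp.toLp 2 (A *ᵥ x) : EuclideanSpace ℝ (Fin k)) :=
  (PiLp.continuous_toLp 2 _).measurable.comp (A.mulVecLin.continuous_of_finiteDimensional).measurable

lemma inner_toLp_mulVec (A : Matrix (Fin k) (Fin k) ℝ) (x : Fin k → ℝ)
    (t : EuclideanSpace ℝ (Fin k)) :
    inner ℝ (WithLp.toLp 2 (A *ᵥ x)) t = (Aᵀ *ᵥ t.ofLp) ⬝ᵥ x := by
  rw [EuclideanSpace.inner_eq_star_dotProduct, star_trivial, Matrix.mulVec_transpose,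
    Matrix.dotProduct_mulVec]

lemma IsNetworkPoisson.aemeasurable_offSum (ha : IsNetworkPoisson μ Z θ γ a)
    (w : Fin n → Fin n → ℝ) :
    AEMeasurable (fun ω => offSum fun i j => noise Z θ γ (a ω) i j * w i j) μ := by
  refine Finset.aemeasurable_fun_sum _ fun i _ => Finset.aemeasurable_fun_sum _ fun j hj => ?_
  have h := (ha.law i j (Finset.ne_of_mem_erase hj).symm).aemeasurable
  exact ((measurable_from_nat (f := fun m : ℕ => (m : ℝ))).comp_aemeasurable h).sub_const _
    |>.mul_const _

/-- The characteristic function of the standardized estimate differs little from that of the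
corresponding combination of the leading terms. -/
theorem IsRegular.norm_charFun_sub_le [IsProbabilityMeasure μ]
    (hb : IsRegular Z (rate Z θ γ) E B η) (ha : IsNetworkPoisson μ Z θ γ a)
    (hW : 10 ^ 11 * (p * B) ^ 8 * ((n : ℝ) ^ 2 * η * E ^ 23 * Real.log n / √n) ≤ 1)
    {θh : Ω → Fin (2 * n - 1) → ℝ} {γh : Ω → Fin p → ℝ} (hθh : AEMeasurable θh μ)
    (hMLE : ∀ᵐ ω ∂μ, (∃ θ γ, IsMLE Z (a ω) θ γ) → IsMLE Z (a ω) (θh ω) (γh ω))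
    (hk : k < n) {l : Fin n} (hl : (l : ℕ) + 1 = n) {A : Matrix (Fin k) (Fin k) ℝ}
    (t : EuclideanSpace ℝ (Fin k)) {T : ℝ} (hT : 0 ≤ T)
    (hbT : ∀ i, |(Aᵀ *ᵥ t.ofLp) i| ≤ T * (E * √n)) :
    ‖charFun (μ.map fun ω => (WithLp.toLp 2 (A *ᵥ firstCoords k (θh ω - θ)) :
          EuclideanSpace ℝ (Fin k))) t
        - ∫ ω, Complex.exp (((offSum fun c d => noise Z θ γ (a ω) c d
          * leadWeight (rate Z θ γ) hk l (Aᵀ *ᵥ t.ofLp) c d : ℝ) : ℂ) * Complex.I) ∂μ‖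
      ≤ k * T * (10 ^ 11 * (p * B) ^ 8 * ((n : ℝ) ^ 2 * η * E ^ 23 * Real.log n / √n))
        + 2 * ((6 + 2 * p) / n) := by
  have hE := hb.pos_E
  have hn := hb.three_le_cast
  obtain ⟨G, hG, hGy⟩ := hb.exists_event ha hW
  set W := 10 ^ 11 * (p * B) ^ 8 * ((n : ℝ) ^ 2 * η * E ^ 23 * Real.log n / √n) with hWdef
  set b := Aᵀ *ᵥ t.ofLp with hbdef
  have hW0 : 0 ≤ W := by
    have h1 := hb.eta_pos
    have h2 := hb.B_pos
    have h3 := Real.log_nonneg (x := (n : ℝ)) (by linarith)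
    positivity
  have hX : AEMeasurable (fun ω => firstCoords k (θh ω - θ)) μ :=
    (measurable_firstCoords k).comp_aemeasurable (hθh.sub_const _)
  have hchar : charFun (μ.map fun ω => (WithLp.toLp 2 (A *ᵥ firstCoords k (θh ω - θ)) :
      EuclideanSpace ℝ (Fin k))) t
      = ∫ ω, Complex.exp (((b ⬝ᵥ firstCoords k (θh ω - θ) : ℝ) : ℂ) * Complex.I) ∂μ := by
    have hm : AEMeasurable (fun ω => (WithLp.toLp 2 (A *ᵥ firstCoords k (θh ω - θ)) :
        EuclideanSpace ℝ (Fin k))) μ := (measurable_toLp_mulVec A).comp_aemeasurable hX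
    rw [charFun_apply, integral_map hm (by fun_prop)]
    simp only [inner_toLp_mulVec]
    rfl
  rw [hchar]
  refine norm_integral_cexp_sub_le (G := G) ?_ (ha.aemeasurable_offSum _) (by positivity)
    (by positivity) hG ?_
  · simp only [dotProduct]
    exact Finset.aemeasurable_fun_sum _ fun i _ =>
      ((measurable_pi_apply i).comp_aemeasurable hX).const_mul _
  · filter_upwards [hMLE] with ω hω hωG
    obtain ⟨y, hy, hexp⟩ := hGy ω hωG
    have hθ : θh ω - θ = y.1 := by
      rw [hb.isMLE_unique hy (hω ⟨_, _, hy⟩), add_sub_cancel_left]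
    rw [hθ, offSum_mul_leadWeight, dotProduct, ← Finset.sum_sub_distrib]
    refine (Finset.abs_sum_le_sum_abs _ _).trans ?_
    refine (Finset.sum_le_card_nsmul _ _ (T * W) fun i _ => ?_).trans (le_of_eq ?_)
    · have hil : Fin.castLE hk.le i ≠ l := by
        intro h
        have h1 := congrArg Fin.val h
        rw [Fin.val_castLE] at h1
        omega
      have h1 := hexp l (Fin.castLE hk.le i) hl hil
      have h2 : firstCoords k y.1 i = sendPar y.1 (Fin.castLE hk.le i) := by
        rw [firstCoords, dif_pos (by omega)]
        rfl
      rw [← mul_sub, abs_mul, h2]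
      calc _ ≤ T * (E * √n) * |_| := mul_le_mul_of_nonneg_right (hbT i) (abs_nonneg _)
        _ = T * (|_| * (E * √n)) := by ring
        _ ≤ T * W := mul_le_mul_of_nonneg_left h1 hT
    · rw [Finset.card_univ, Fintype.card_fin, nsmul_eq_mul, mul_assoc]

end CharFun

section Gaussian

variable {n p k : ℕ} {Ω : Type*} [MeasurableSpace Ω] {μ : Measure Ω}
  {Z : Fin n → Fin n → Fin p → ℝ} {θ : Fin (2 * n - 1) → ℝ} {γ : Fin p → ℝ}
  {a : Ω → Fin n → Fin n → ℕ} {E B η : ℝ}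

/-- Quantitative form of the asymptotic normality: a bound for the distance of the characteristic
function of the standardized estimate from that of the standard normal law. -/
theorem IsRegular.norm_charFun_sub_gaussian_le [IsProbabilityMeasure μ]
    (hb : IsRegular Z (rate Z θ γ) E B η) (ha : IsNetworkPoisson μ Z θ γ a)
    (hW : 10 ^ 11 * (p * B) ^ 8 * ((n : ℝ) ^ 2 * η * E ^ 23 * Real.log n / √n) ≤ 1)
    {θh : Ω → Fin (2 * n - 1) → ℝ} {γh : Ω → Fin p → ℝ} (hθh : AEMeasurable θh μ)
    (hMLE : ∀ᵐ ω ∂μ, (∃ θ γ, IsMLE Z (a ω) θ γ) → IsMLE Z (a ω) (θh ω) (γh ω))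
    (hk : k < n) {A : Matrix (Fin k) (Fin k) ℝ}
    (hA : A * upperLeft k (approxInv (rate Z θ γ)) * Aᵀ = 1) (t : EuclideanSpace ℝ (Fin k))
    {e d : ℝ} (he : e = E ^ 5 / √n) (he1 : 4 * k * ‖t‖ * e ≤ 1)
    (hd : d = 4 * k * ‖t‖ * e * (‖t‖ ^ 2 + 8 * k ^ 2 * ‖t‖ ^ 2 * e) + 4 * k ^ 2 * ‖t‖ ^ 2 * e)
    (hd1 : d ≤ 1) :
    ‖charFun (μ.map fun ω => (WithLp.toLp 2 (A *ᵥ firstCoords k (θh ω - θ)) :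
          EuclideanSpace ℝ (Fin k))) t - Complex.exp (-‖t‖ ^ 2 / 2)‖
      ≤ k * ‖t‖ * (10 ^ 11 * (p * B) ^ 8 * ((n : ℝ) ^ 2 * η * E ^ 23 * Real.log n / √n))
        + 2 * ((6 + 2 * p) / n) + 2 * d := by
  have hE := hb.pos_E
  have hn := hb.three_le_cast
  have hs : 0 < √(n : ℝ) := Real.sqrt_pos.2 (by linarith)
  obtain ⟨l, hl⟩ : ∃ l : Fin n, (l : ℕ) + 1 = n := ⟨⟨n - 1, by omega⟩, by simp only; omega⟩
  set u := rate Z θ γ with hu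
  set T := ‖t‖ with hTdef
  have hT : 0 ≤ T := norm_nonneg t
  set b := Aᵀ *ᵥ t.ofLp with hbdef
  have hvar : b ⬝ᵥ (upperLeft k (approxInv u) *ᵥ b) = T ^ 2 := by
    have h1 : b ⬝ᵥ (upperLeft k (approxInv u) *ᵥ b)
        = t.ofLp ⬝ᵥ ((A * upperLeft k (approxInv u) * Aᵀ) *ᵥ t.ofLp) := by
      rw [hbdef, Matrix.mulVec_transpose, ← Matrix.dotProduct_mulVec, Matrix.mulVec_mulVec,
        ← Matrix.mulVec_transpose, Matrix.mulVec_mulVec]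
    rw [h1, hA, Matrix.one_mulVec, hTdef, EuclideanSpace.real_norm_sq_eq, dotProduct]
    exact Finset.sum_congr rfl fun i _ => (sq _).symm
  have hbT := hb.abs_coeff_le hk hT hvar
  have h1 := hb.norm_charFun_sub_le ha hW hθh hMLE hk hl t hT hbT
  set w := leadWeight u hk l b with hw
  have hint := ha.integral_cexp fun i j => (w i j : ℂ) * Complex.I
  have h2 : ∀ ω, ((offSum fun c d => noise Z θ γ (a ω) c d * w c d : ℝ) : ℂ) * Complex.I
      = ∑ i, ∑ j ∈ Finset.univ.erase i, (w i j : ℂ) * Complex.I * (noise Z θ γ (a ω) i j : ℂ) := by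
    intro ω
    rw [offSum, Complex.ofReal_sum, Finset.sum_mul]
    refine Finset.sum_congr rfl fun i _ => ?_
    rw [Complex.ofReal_sum, Finset.sum_mul]
    refine Finset.sum_congr rfl fun j _ => ?_
    push_cast
    ring
  simp only [h2] at h1
  rw [hint] at h1
  set ζ := ∑ i, ∑ j ∈ Finset.univ.erase i,
    (rate Z θ γ i j : ℂ) * (Complex.exp (w i j * Complex.I) - 1 - w i j * Complex.I) with hζ
  -- sizes of the weights and of the variance of the leading terms, in terms of `e`
  have he0 : 0 ≤ e := by rw [he]; positivity
  have hEe : E ^ 2 / √n ≤ e := by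
    rw [he]
    gcongr
    · exact hb.one_le
    · norm_num
  have hne : E ^ 5 / n ≤ e := by
    rw [he]
    gcongr
    exact Real.sqrt_le_left (by linarith) |>.2 (by nlinarith)
  have hwm : ∀ c d : Fin n, |w c d| ≤ 4 * k * T * e := fun c d =>
    (hb.abs_leadWeight_le hk l hT hbT c d).trans (by gcongr)
  have hV := hb.abs_variance_sub_le hk hl hT hbT
  rw [hvar] at hV
  set V := offSum fun c d => u c d * leadWeight u hk l b c d ^ 2 with hVdef
  have hV' : |V - T ^ 2| ≤ 8 * k ^ 2 * T ^ 2 * e := hV.trans (by gcongr)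
  have hcum := norm_cumulant_add_le (u := u) (w := w) he1 (fun i j hij => (hb.pos hij).le)
    fun i j _ => hwm i j
  have hζd : ‖ζ - (-T ^ 2 / 2 : ℂ)‖ ≤ d := by
    have e1 : ζ - (-T ^ 2 / 2 : ℂ) = (ζ + (V : ℂ) / 2) - ((V - T ^ 2 : ℝ) : ℂ) / 2 := by
      push_cast
      ring
    have e2 : ‖((V - T ^ 2 : ℝ) : ℂ) / 2‖ ≤ 4 * k ^ 2 * T ^ 2 * e := by
      rw [norm_div, Complex.norm_real, Real.norm_eq_abs, Complex.norm_ofNat]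
      linarith
    have e3 : ‖ζ + (V : ℂ) / 2‖ ≤ 4 * k * T * e * (T ^ 2 + 8 * k ^ 2 * T ^ 2 * e) := by
      refine hcum.trans ?_
      have := (abs_le.1 hV').2
      gcongr
      linarith
    rw [e1, hd]
    exact (norm_sub_le _ _).trans (add_le_add e3 e2)
  have h3 : ‖Complex.exp ζ - Complex.exp (-T ^ 2 / 2)‖ ≤ 2 * d := by
    have e1 : Complex.exp ζ - Complex.exp (-T ^ 2 / 2)
        = Complex.exp (-T ^ 2 / 2) * (Complex.exp (ζ - (-T ^ 2 / 2 : ℂ)) - 1) := by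
      rw [mul_sub, ← Complex.exp_add, mul_one, add_sub_cancel]
    have e2 : ‖Complex.exp (-T ^ 2 / 2)‖ ≤ 1 := by
      rw [Complex.norm_exp]
      have : (-(T : ℂ) ^ 2 / 2).re = -T ^ 2 / 2 := by
        rw [show -(T : ℂ) ^ 2 / 2 = ((-T ^ 2 / 2 : ℝ) : ℂ) by push_cast; ring, Complex.ofReal_re]
      rw [this, Real.exp_le_one_iff]
      have := sq_nonneg T
      linarith
    rw [e1, norm_mul]
    calc _ ≤ 1 * (2 * ‖ζ - (-T ^ 2 / 2 : ℂ)‖) := by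
          gcongr
          exact Complex.norm_exp_sub_one_le (hζd.trans hd1)
      _ ≤ 2 * d := by linarith
  refine (norm_sub_le_norm_sub_add_norm_sub _ (Complex.exp ζ) _).trans ?_
  exact add_le_add h1 h3

end Gaussian

/-! ### The balance of the design is measured by `rho` -/

section Rho

variable {n p : ℕ} {Z : Fin n → Fin n → Fin p → ℝ} {θ : Fin (2 * n - 1) → ℝ} {γ : Fin p → ℝ}
  {ε₁ ε₂ : ℝ}

lemma abs_log_rate_le_rho (hε₁ : 0 ≤ ε₁) (hε₂ : 0 ≤ ε₂) {i j : Fin n} (hij : i ≠ j) :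
    |sendPar θ i + recvPar θ j + Z i j ⬝ᵥ γ| ≤ rho Z θ γ ε₁ ε₂ := by
  let e : OffDiag n := ⟨(i, j), hij⟩
  have h1 : |sendPar θ i + recvPar θ j| ≤ ⨆ e : OffDiag n, |sendPar θ e.1.1 + recvPar θ e.1.2| :=
    le_ciSup (f := fun e : OffDiag n => |sendPar θ e.1.1 + recvPar θ e.1.2|)
      (Set.finite_range _).bddAbove e
  have h2 : ‖Z i j‖ ≤ ⨆ e : OffDiag n, ‖Z e.1.1 e.1.2‖ :=
    le_ciSup (f := fun e : OffDiag n => ‖Z e.1.1 e.1.2‖) (Set.finite_range _).bddAbove e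
  have h3 : |Z i j ⬝ᵥ γ| ≤ p * ‖Z i j‖ * ‖γ‖ :=
    abs_dotProduct_le (fun c => norm_le_pi_norm (Z i j) c) fun c => norm_le_pi_norm γ c
  have h4 : 0 ≤ ⨆ e : OffDiag n, ‖Z e.1.1 e.1.2‖ := (norm_nonneg _).trans h2
  have h5 : p * ‖Z i j‖ * ‖γ‖ ≤ p * (⨆ e : OffDiag n, ‖Z e.1.1 e.1.2‖) * ‖γ‖ := by gcongr
  have h6 : 0 ≤ p * (⨆ e : OffDiag n, ‖Z e.1.1 e.1.2‖) * ε₂ := by positivity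
  have h7 := abs_add_le (sendPar θ i + recvPar θ j) (Z i j ⬝ᵥ γ)
  rw [rho]
  linarith

lemma isBalanced_rate (hn : 3 ≤ n) (hε₁ : 0 ≤ ε₁) (hε₂ : 0 ≤ ε₂) :
    IsBalanced (rate Z θ γ) (Real.exp (rho Z θ γ ε₁ ε₂)) := by
  refine ⟨hn, ?_, fun i j hij => ?_, fun i j hij => ?_⟩
  · have hij : (⟨0, by omega⟩ : Fin n) ≠ ⟨1, by omega⟩ := by simp
    exact Real.one_le_exp
      ((abs_nonneg _).trans (abs_log_rate_le_rho (Z := Z) (θ := θ) (γ := γ) hε₁ hε₂ hij))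
  · rw [← Real.exp_neg]
    exact Real.exp_le_exp.2 (abs_le.1 (abs_log_rate_le_rho hε₁ hε₂ hij)).1
  · exact Real.exp_le_exp.2 (abs_le.1 (abs_log_rate_le_rho hε₁ hε₂ hij)).2

end Rho

end

end NetworkPoisson

/-! ### Existence and asymptotic normality -/

theorem theorem2
    -- the fixed dimension of the covariates, and a compact set containing all their coordinates
    (p : ℕ) (hp : 1 ≤ p) (K : Set ℝ) (hK : IsCompact K)
    (Z : ∀ n : ℕ, Fin n → Fin n → Fin p → ℝ)
    (hZ : ∀ (n : ℕ) (i j : Fin n), i ≠ j → ∀ c, Z n i j c ∈ K)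
    -- the true parameters
    (θs : ∀ n : ℕ, Fin (2 * n - 1) → ℝ) (γs : ℕ → Fin p → ℝ)
    -- the data, for every number `n` of nodes
    (Ω : ℕ → Type*) [∀ n, MeasurableSpace (Ω n)]
    (μ : ∀ n, Measure (Ω n)) [∀ n, IsProbabilityMeasure (μ n)]
    (a : ∀ n : ℕ, Ω n → Fin n → Fin n → ℕ)
    (ha : ∀ n, IsNetworkPoisson (μ n) (Z n) (θs n) (γs n) (a n))
    -- the estimator: a solution of the score equations whenever there is one
    (θh : ∀ n : ℕ, Ω n → Fin (2 * n - 1) → ℝ) (γh : ∀ n : ℕ, Ω n → Fin p → ℝ)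
    (hθh : ∀ n, AEMeasurable (θh n) (μ n))
    (hMLE : ∀ n, ∀ᵐ ω ∂(μ n), (∃ θ γ, IsMLE (Z n) (a n ω) θ γ) →
      IsMLE (Z n) (a n ω) (θh n ω) (γh n ω))
    -- the radii of the neighbourhoods, and the bound on the inverse profile information
    (ε₁ ε₂ : ℕ → ℝ) (hε₁ : ∀ n, 0 < ε₁ n) (hε₂ : ∀ n, 0 < ε₂ n) (κ : ℕ → ℝ)
    (hH : ∀ᶠ n in atTop, ∀ θ ∈ Metric.closedBall (θs n) (ε₁ n),
      (profileInfo (Z n) θ (γs n)).PosDef ∧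
      infNorm (profileInfo (Z n) θ (γs n))⁻¹ ≤ κ n / (n : ℝ) ^ 2)
    (hκ : (fun n : ℕ => κ n * Real.exp (23 * rho (Z n) (θs n) (γs n) (ε₁ n) (ε₂ n)))
      =o[atTop] fun n : ℕ => (n : ℝ) ^ (1 / 2 : ℝ) / Real.log n) :
    Tendsto (fun n => μ n {ω | ∃ θ γ, IsMLE (Z n) (a n ω) θ γ}) atTop (𝓝 1) ∧
    ∀ k : ℕ, 1 ≤ k →
      AsymptoticallyNormal μ (fun n ω => firstCoords k (θh n ω - θs n))
        (fun n => upperLeft k (approxInv (rate (Z n) (θs n) (γs n)))) := by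
  obtain ⟨B, hB1, hBK⟩ : ∃ B : ℝ, 1 ≤ B ∧ ∀ x ∈ K, |x| ≤ B := by
    obtain ⟨C, hC⟩ := hK.isBounded.exists_norm_le
    exact ⟨max C 1, le_max_right _ _, fun x hx => (hC x hx).trans (le_max_left _ _)⟩
  set E : ℕ → ℝ := fun n => Real.exp (rho (Z n) (θs n) (γs n) (ε₁ n) (ε₂ n)) with hE
  set η : ℕ → ℝ := fun n => κ n / (n : ℝ) ^ 2 with hη
  have hreg : ∀ᶠ n in atTop, IsRegular (Z n) (rate (Z n) (θs n) (γs n)) (E n) B (η n) := by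
    filter_upwards [hH, eventually_ge_atTop 3] with n hn h3
    obtain ⟨h1, h2⟩ := hn (θs n) (Metric.mem_closedBall_self (hε₁ n).le)
    rw [profileInfo_eq_residGram] at h1 h2
    exact { toIsBalanced := isBalanced_rate h3 (hε₁ n).le (hε₂ n).le
            one_le_p := hp
            one_le_B := hB1
            cov_le := fun i j hij c => hBK _ (hZ n i j hij c)
            isUnit_det_residGram := (Matrix.isUnit_iff_isUnit_det _).1 h1.isUnit
            infNorm_le := h2 }
  -- the quantity that controls all error terms
  set W₀ : ℕ → ℝ := fun n => (n : ℝ) ^ 2 * η n * E n ^ 23 * Real.log n / √n with hW₀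
  have hW₀lim : Tendsto W₀ atTop (𝓝 0) := by
    refine hκ.tendsto_div_nhds_zero.congr' ?_
    filter_upwards [eventually_ge_atTop 3] with n hn
    have hn0 : (n : ℝ) ≠ 0 := by positivity
    simp only [hW₀, hη, hE]
    rw [← Real.exp_nat_mul, ← Real.sqrt_eq_rpow, mul_div_cancel₀ _ (pow_ne_zero 2 hn0),
      div_div_eq_mul_div]
    norm_num
  have hWlim : Tendsto (fun n => 10 ^ 11 * (p * B) ^ 8 * W₀ n) atTop (𝓝 0) := by
    simpa using hW₀lim.const_mul (10 ^ 11 * (p * B) ^ 8)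
  have hW : ∀ᶠ n in atTop, 10 ^ 11 * (p * B) ^ 8 * W₀ n ≤ 1 :=
    hWlim.eventually (eventually_le_nhds zero_lt_one)
  have hPlim : Tendsto (fun n : ℕ => (6 + 2 * (p : ℝ)) / n) atTop (𝓝 0) :=
    tendsto_const_div_atTop_nhds_zero_nat _
  refine ⟨?_, fun k _ => ⟨?_, fun A hA => ?_⟩⟩
  · have h1 : Tendsto (fun n : ℕ => 1 - ENNReal.ofReal ((6 + 2 * (p : ℝ)) / n)) atTop (𝓝 1) := by
      have := ENNReal.Tendsto.sub (tendsto_const_nhds (x := (1 : ENNReal)) (f := atTop))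
        (ENNReal.tendsto_ofReal hPlim) (Or.inl ENNReal.one_ne_top)
      simpa using this
    refine tendsto_of_tendsto_of_tendsto_of_le_of_le' h1 tendsto_const_nhds ?_
      (Eventually.of_forall fun n => prob_le_one)
    filter_upwards [hreg, hW] with n hb hWn
    obtain ⟨G, hG, hGy⟩ := hb.exists_event (ha n) hWn
    refine le_trans ?_ (measure_mono (s := G) fun ω hω => ?_)
    · rw [tsub_le_iff_right]
      calc (1 : ENNReal) = μ n Set.univ := measure_univ.symm
        _ = μ n (G ∪ Gᶜ) := by rw [Set.union_compl_self]
        _ ≤ μ n G + μ n Gᶜ := measure_union_le _ _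
        _ ≤ _ := by gcongr
    · obtain ⟨y, hy, -⟩ := hGy ω hω
      exact ⟨_, _, hy⟩
  · filter_upwards [hreg, eventually_gt_atTop k] with n hb hk
    exact hb.posDef_upperLeft hk
  · have hmeas : ∀ n, AEMeasurable (fun ω => (WithLp.toLp 2 (A n *ᵥ firstCoords k (θh n ω - θs n)) :
        EuclideanSpace ℝ (Fin k))) (μ n) := fun n =>
      (measurable_toLp_mulVec (A n)).comp_aemeasurable
        ((measurable_firstCoords k).comp_aemeasurable ((hθh n).sub_const _))
    refine ⟨hmeas, aemeasurable_id, ?_⟩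
    refine ProbabilityMeasure.tendsto_of_tendsto_charFun fun t => ?_
    simp only [ProbabilityMeasure.coe_mk, Measure.map_id, charFun_stdGaussian]
    set e : ℕ → ℝ := fun n => E n ^ 5 / √n with he
    have helim : Tendsto e atTop (𝓝 0) := by
      have h1 : Tendsto (fun n => 10 * B ^ 2 * W₀ n) atTop (𝓝 0) := by
        simpa using hW₀lim.const_mul (10 * B ^ 2)
      refine tendsto_of_tendsto_of_tendsto_of_le_of_le' tendsto_const_nhds h1
        (Eventually.of_forall fun n => by positivity) ?_
      filter_upwards [hreg] with n hb
      have hn := hb.three_le_cast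
      have hlog : 1 ≤ Real.log n := by
        rw [Real.le_log_iff_exp_le (by linarith)]
        linarith [Real.exp_one_lt_three]
      have hE0 := hb.pos_E
      have hη0 := hb.eta_pos
      calc E n ^ 5 / √n = E n ^ 5 * 1 / √n := by rw [mul_one]
        _ ≤ E n ^ 5 * (10 * B ^ 2 * E n ^ 3 * ((n : ℝ) ^ 2 * η n)) / √n := by
          gcongr
          exact hb.one_le_mul_eta
        _ = 10 * B ^ 2 * ((n : ℝ) ^ 2 * η n * E n ^ 8 * 1 / √n) := by ring
        _ ≤ 10 * B ^ 2 * W₀ n := by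
          have := pow_le_pow_right₀ hb.one_le (show 8 ≤ 23 by norm_num)
          simp only [hW₀]
          gcongr
    set d : ℕ → ℝ := fun n => 4 * k * ‖t‖ * e n * (‖t‖ ^ 2 + 8 * k ^ 2 * ‖t‖ ^ 2 * e n)
      + 4 * k ^ 2 * ‖t‖ ^ 2 * e n with hd
    have he1lim : Tendsto (fun n => 4 * k * ‖t‖ * e n) atTop (𝓝 0) := by
      simpa using helim.const_mul (4 * k * ‖t‖)
    have hdlim : Tendsto d atTop (𝓝 0) := by
      have h1 := (he1lim.mul ((helim.const_mul (8 * k ^ 2 * ‖t‖ ^ 2)).const_add (‖t‖ ^ 2))).add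
        (helim.const_mul (4 * k ^ 2 * ‖t‖ ^ 2))
      simpa using h1
    rw [tendsto_iff_norm_sub_tendsto_zero]
    have hbound : Tendsto (fun n : ℕ => k * ‖t‖ * (10 ^ 11 * (p * B) ^ 8 * W₀ n)
        + 2 * ((6 + 2 * (p : ℝ)) / n) + 2 * d n) atTop (𝓝 0) := by
      simpa using ((hWlim.const_mul (k * ‖t‖)).add (hPlim.const_mul 2)).add (hdlim.const_mul 2)
    refine squeeze_zero' (Eventually.of_forall fun n => norm_nonneg _) ?_ hbound
    filter_upwards [hreg, hW, eventually_gt_atTop k, hA,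
      he1lim.eventually (eventually_le_nhds zero_lt_one),
      hdlim.eventually (eventually_le_nhds zero_lt_one)] with n hb hWn hk hAn he1 hd1
    exact hb.norm_charFun_sub_gaussian_le (ha n) hWn (hθh n) (hMLE n) hk hAn t rfl he1 rfl hd1
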